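/- **Problem.** An instance of rooted node-weighted $k$-MST (NW-$k$-MST) is a finite graph $G=(V,E)$ on $n$ vertices with weights $c\colon V\to\mathbb{R}_{\ge 0}$, a root $r_0\in V$ and an integer $k\ge 1$. A solution is a set $X\ni r_0$ with $|X|\ge k$ and $G[X]$ connected; its cost is $c(X)=\sum_{v\in X}c_v$, and $\mathrm{OPT}$ is the minimum cost. An instance of rooted node-weighted prize-collecting Steiner tree (NW-PC-ST) has, instead of $k$, penalties $\pi\colon V\to\mathbb{R}_{\ge0}$; solutions are sets $X\ni r_0$ with $G[X]$ connected, of cost $c(X)+\pi(V\setminus X)$. **Moat growing (Byrka, Lewandowski, Moldenhauer).** Given NW-PC-ST data and a set $W$ of vertices whose penalty is regarded as infinite ($W=\emptyset$ for the plain problem), subtract $\min(c_v,\pi_v)$ from the cost and the penalty of each $v$. Vertices with reduced cost $0$ (these include $W$) are terminals. At time $0$ the root and all terminals are bought. The moats are the connected components of the graph induced by the bought vertices. The potential of a moat $S$ is the total reduced penalty of $S$ minus $\sum_{X\subseteq S}y_X$, where all $y_X$ are initially $0$ (it is infinite if $S\cap W\ne\emptyset$). A moat is active if it does not contain $r_0$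 and has positive potential. The $y_S$ of all active moats $S$ are raised at unit rate. When $\sum_{S:\,v\in\Gamma(S)}y_S$ reaches the reduced cost of an unbought vertex $v$ ($\Gamma(S)$ being the set of vertices outside $S$ with a neighbour in $S$), $v$ is bought; when a moat runs out of potential, its unmarked terminals are marked with the current time. Simultaneous events are processed one by one, vertices first, by a fixed vertex order. When no moat is active, the bought vertices other than $r_0$ are considered in reverse order of buying, and $v$ is deleted unless this disconnects from $r_0$ a terminal that is unmarked or marked with a time greater than the time of buying $v$. The remaining vertex set $T$ is returned. For a real $r$, this algorithm (with $W=\emptyset$) has *ratio $r$ on a graph class $\mathcal{G}$* if, for all $G\in\mathcal G$, all $c,\pi\ge 0$ and all roots, $T$ is a solution and is Lagrangian multiplier preserving (LMP), i.e. $c(T)+r\,\pi(V\setminus T)\le r\,(c(X)+\pi(V\setminus X))$ for every solution $X$. **Algorithm $\mathcal A_\delta$ for NW-$k$-MST** ($\delta>0$). For each guess $g$ of $\mathrm{OPT}$ of the form $c_v(1+\delta)^j$ ($v\in V$, $0\le j\le\lceil n/\delta\rceil$) and each $W\subseteq V$ with $|W|\le 1/\delta$: 1. *Pruning.* Keep the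 set $A$ of vertices $v$ having a path to some $u\in W\cup\{r_0\}$ whose weight, not counting $u$, is at most $\delta g$. Discard the guess if $G[A]$ is disconnected, $|A|<k$, or some vertex of $W\cup\{r_0\}$ costs more than $g$. 2. *Lagrangian binary search.* Let $T^\lambda$ be the output of moat growing on $G[A]$ with forced set $W$ and all penalties $\lambda$. If $|T^0|\ge k$, then $T^0$ is a candidate. Otherwise binary search on $[0,(n+1)g]$ (on $[0,1]$ if $g=0$) yields $T_1=T^{\lambda_1}$ and $T_2=T^{\lambda_2}$ with $|T_1|<k\le|T_2|$ and $\lambda_2-\lambda_1\le\delta g/(3n)$ (when $g=0$, after the same number of steps as for $g>0$), stopping early if $|T_2|=k$. If $|T_2|=k$, then $T_2$ is a candidate. 3. *Tree merging* (if $|T_2|>k$). Contract $T_1\cap T_2$ in $G[T_2]$ to a vertex $r'$ of cost and cardinality $0$. Call a set $S$ cost-effective if $c(S)\,|T_2\setminus T_1|\le c(T_2\setminus T_1)\,|S|$. Let $H$ be a spanning tree of the contracted graph and $q=k-|T_1|$. As long as possible, choose an edge of $H$ and a cost-effective component $X$ of $H$ minus this edge that has at least $q$ vertices (then delete the other component)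 or is not a single node of $H$ (then contract $X$ to a super vertex of cardinality $|X|$). If at most $q$ vertices are left, pick all of them. Otherwise pick the leaves of $H$ by decreasing cardinality as long as the total does not exceed $q$; if $q$ is not reached, proceed recursively, with the remaining number of vertices to pick, inside the first leaf that would exceed $q$; in the last of at most $\lceil\log_2\lceil 4/\delta\rceil\rceil+1$ nested calls, pick that leaf completely. The picked vertices, $T_1$, and for each call a minimum-weight path from the centre of the final tree $H$ (if there is no centre or all vertices left were picked, from a vertex picked in this call) to $W\cup\{r_0\}$, form a candidate; $T_2$ is another one. The output is a cheapest candidate that is a solution. **Corollary.** For every $\varepsilon>0$ there is $\delta_0>0$ such that for every $\delta\in(0,\delta_0]$: - the number of elementary operations (arithmetic operations and comparisons of real numbers, adjacency and membership queries, accesses to single cells) of $\mathcal A_\delta$ is at most a polynomial in $n$ that depends only on $\delta$; and - for every graph class $\mathcal G$ and every real $r$ such that the moat-growing algorithm for NW-PC-ST has ratio $r$ on $\mathcal G$, and for every NW-$k$-MST instance on a graph of $\mathcal G$ that has a solution, $\mathcal A_\delta$ returns a solution of cost at most $\left(\tfrac43+\varepsilon\right) r\cdot\mathrm{OPT}$.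 -/

import Mathlib

open scoped Classical

noncomputable section

/-!
Conventions.  Graphs have vertex set `Fin n`, node weights are real, and running time is
the number of elementary operations of a real random access machine: an arithmetic operation
or a comparison on numbers, an adjacency query, a membership query, or a read or write
of a single cell all have unit cost. Every algorithm below is written in the monad `Timed`,
which carries the result together with the number of elementary operations.
-/

/-- A result together with the number of elementary operations spent on it. -/
structure Timed (α : Type) where
  val : α
  time : ℕ

namespace Timed

instance : Monad Timed where
  pure a := ⟨a, 0⟩
  bind x f := ⟨(f x.val).val, x.time + (f x.val).time⟩

variable {α β σ : Type} {n : ℕ}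

/-- One elementary operation (a bounded number of arithmetic operations, comparisons, and
accesses to cells). -/
def op (a : α) : Timed α := ⟨a, 1⟩

/-- One elementary test. -/
def test (p : Prop) : Timed Bool := ⟨decide p, 1⟩

/-- Spend `m` operations. -/
def charge (m : ℕ) : Timed Unit := ⟨(), m⟩

/-- Loop over the vertices: fill an array. -/
def tabulate (f : Fin n → Timed α) : Timed (Fin n → α) :=
  ⟨fun v => (f v).val, ∑ v, ((f v).time + 1)⟩

/-- Loop over the vertices: the set of all vertices that pass a test. -/
def vertexSet (p : Fin n → Timed Bool) : Timed (Finset (Fin n)) :=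
  ⟨Finset.univ.filter (fun v => (p v).val = true), ∑ v, ((p v).time + 1)⟩

/-- Loop over the vertices: does some vertex pass the test? -/
def anyVertex (p : Fin n → Timed Bool) : Timed Bool :=
  ⟨decide (∃ v, (p v).val = true), ∑ v, ((p v).time + 1)⟩

/-- Loop over the vertices: do all vertices pass the test? -/
def allVertices (p : Fin n → Timed Bool) : Timed Bool :=
  ⟨decide (∀ v, (p v).val = true), ∑ v, ((p v).time + 1)⟩

/-- Loop over the vertices: a sum of numbers. -/
def sumVertices (f : Fin n → Timed ℝ) : Timed ℝ :=
  ⟨∑ v, (f v).val, ∑ v, ((f v).time + 1)⟩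

/-- Loop over a list: apply a function. -/
def mapList (l : List α) (f : α → Timed β) : Timed (List β) :=
  ⟨l.map (fun a => (f a).val), (l.map (fun a => (f a).time + 1)).sum⟩

/-- Loop over a list: keep the entries that pass a test. -/
def filterList (l : List α) (p : α → Timed Bool) : Timed (List α) :=
  ⟨l.filter (fun a => (p a).val), (l.map (fun a => (p a).time + 1)).sum⟩

/-- Loop over a list: does some entry pass the test? -/
def anyList (l : List α) (p : α → Timed Bool) : Timed Bool :=
  ⟨l.any (fun a => (p a).val), (l.map (fun a => (p a).time + 1)).sum⟩

/-- Loop over a list: a sum of numbers. -/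
def sumList (l : List α) (f : α → Timed ℝ) : Timed ℝ :=
  ⟨(l.map (fun a => (f a).val)).sum, (l.map (fun a => (f a).time + 1)).sum⟩

/-- Loop over a list: the first entry of smallest key. -/
def minList (l : List (α × ℝ)) : Timed (Option (α × ℝ)) :=
  ⟨l.argmin Prod.snd, l.length + 1⟩

/-- Insertion sort of a list by decreasing second entry. -/
def sortDesc (l : List (α × ℕ)) : Timed (List (α × ℕ)) :=
  ⟨l.insertionSort (fun a b => b.2 ≤ a.2), l.length ^ 2 + 1⟩

/-- Number of elements of a vertex set. -/
def card (S : Finset (Fin n)) : Timed ℕ := ⟨S.card, n + 1⟩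

/-- Repeat a step `m` times. -/
def iterate : ℕ → (σ → Timed σ) → σ → Timed σ
  | 0, _, s => pure s
  | m + 1, f, s => do
    charge 1
    let s' ← f s
    iterate m f s'

/-- Loop over a list with an accumulator. -/
def foldList (f : σ → α → Timed σ) : σ → List α → Timed σ
  | s, [] => pure s
  | s, a :: l => do
    charge 1
    let s' ← f s a
    foldList f s' l

end Timed

open Timed in
/-- Breadth-first search: the vertices of `B` that can be reached from `v` inside `B`. -/
def reach {n : ℕ} (adj : Fin n → Fin n → Timed Bool) (B : Finset (Fin n)) (v : Fin n) :
    Timed (Finset (Fin n)) := do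
  let start ← vertexSet fun u => test (u = v ∧ u ∈ B)
  iterate n (fun S => vertexSet fun u => do
    let old ← test (u ∈ S)
    let inB ← test (u ∈ B)
    let nb ← anyVertex fun w => do
      let a ← adj w u
      let b ← test (w ∈ S)
      return a && b
    return old || (inB && nb)) start

/-- Adjacency query to a graph. -/
def graphAdj {n : ℕ} (G : SimpleGraph (Fin n)) (u v : Fin n) : Timed Bool :=
  Timed.test (G.Adj u v)

open Timed in
/-- The connected components of the subgraph induced by `B`. -/
def components {n : ℕ} (G : SimpleGraph (Fin n)) (B : Finset (Fin n)) :
    Timed (List (Finset (Fin n))) := do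
  let comp ← tabulate fun v => reach (graphAdj G) B v
  let leaders ← filterList (List.finRange n) fun v => do
    let inB ← test (v ∈ B)
    let least ← allVertices fun u => test (u ∈ comp v → v ≤ u)
    return inB && least
  mapList leaders fun v => op (comp v)

open Timed in
/-- Does `v` belong to `Γ(S)`, the set of vertices outside `S` with a neighbour in `S`? -/
def inBoundary {n : ℕ} (G : SimpleGraph (Fin n)) (S : Finset (Fin n)) (v : Fin n) :
    Timed Bool := do
  let nb ← anyVertex fun u => test (u ∈ S ∧ G.Adj u v)
  let out ← test (v ∉ S)
  return nb && out

/-- An instance of rooted node-weighted prize-collecting Steiner tree, on the subgraph induced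
by `alive`, in which the penalty of the vertices of `forced` is infinite (`penalty` is not used
at these vertices). The plain problem has `alive = univ` and `forced = ∅`. -/
structure PrizeInstance (n : ℕ) where
  graph : SimpleGraph (Fin n)
  alive : Finset (Fin n)
  forced : Finset (Fin n)
  cost : Fin n → ℝ
  penalty : Fin n → ℝ
  root : Fin n

namespace PrizeInstance

variable {n : ℕ} (I : PrizeInstance n)

/-- The cost that is left after the amount `p_v = min (cost, penalty)` has been subtracted. -/
def redCost (v : Fin n) : ℝ :=
  if v ∈ I.forced then 0 else I.cost v - min (I.cost v) (I.penalty v)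

/-- The penalty that is left after the amount `p_v = min (cost, penalty)` has been
subtracted. -/
def redPenalty (v : Fin n) : ℝ := I.penalty v - min (I.cost v) (I.penalty v)

/-- After the reduction, terminals have cost zero and all other vertices have penalty zero. -/
def IsTerminal (v : Fin n) : Prop :=
  v ∈ I.alive ∧ (v ∈ I.forced ∨ I.cost v ≤ I.penalty v)

end PrizeInstance

/-- State of the growing phase: the current time, the bought vertices with the times of
buying (the most recent one first), the dual variables `y_S` raised so far (as a list
of increments), and the times at which terminals have been marked. -/
structure MoatState (n : ℕ) where
  time : ℝ
  bought : List (Fin n × ℝ)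
  dual : List (Finset (Fin n) × ℝ)
  mark : Fin n → Option ℝ

section MoatGrowing

open Timed

variable {n : ℕ} (I : PrizeInstance n)

/-- The set of bought vertices. -/
def boughtSet (l : List (Fin n × ℝ)) : Timed (Finset (Fin n)) :=
  vertexSet fun v => anyList l fun e => test (e.1 = v)

/-- Potential of `S`: the penalties in `S` minus the dual variables of all subsets of `S`. -/
def potential (y : List (Finset (Fin n) × ℝ)) (S : Finset (Fin n)) : Timed ℝ := do
  let total ← sumVertices fun v => op (if v ∈ S then I.redPenalty v else 0)
  let spent ← sumList y fun e => do
    let sub ← allVertices fun u => test (u ∈ e.1 → u ∈ S)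
    return if sub then e.2 else 0
  op (total - spent)

/-- The sum of the dual variables `y_S` over all `S` with `v ∈ Γ(S)`. -/
def load (y : List (Finset (Fin n) × ℝ)) (v : Fin n) : Timed ℝ :=
  sumList y fun e => do
    let b ← inBoundary I.graph e.1 v
    return if b then e.2 else 0

/-- Does the moat contain a vertex of infinite penalty? -/
def hasForced (S : Finset (Fin n)) : Timed Bool :=
  anyVertex fun u => test (u ∈ S ∧ u ∈ I.forced)

/-- A moat is active if it does not contain the root and has positive potential. -/
def isActive (y : List (Finset (Fin n) × ℝ)) (S : Finset (Fin n)) : Timed Bool := do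
  let inf ← hasForced I S
  let pot ← potential I y S
  let pos ← test (0 < pot)
  let noRoot ← test (I.root ∉ S)
  return noRoot && (inf || pos)

/-- In every moat that has run out of potential (and does not contain the root), the terminals
that are still unmarked are marked with the current time. -/
def markDead (s : MoatState n) : Timed (MoatState n) := do
  let B ← boughtSet s.bought
  let moats ← components I.graph B
  let dead ← filterList moats fun S => do
    let inf ← hasForced I S
    let pot ← potential I s.dual S
    let spent ← test (pot ≤ 0)
    let noRoot ← test (I.root ∉ S)
    return noRoot && !inf && spent
  let mark ← tabulate fun v => do
    let inDead ← anyList dead fun S => test (v ∈ S)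
    let new ← test (I.IsTerminal v ∧ s.mark v = none)
    return if inDead && new then some s.time else s.mark v
  return { s with mark := mark }

/-- Initially the root and all terminals (which have reduced cost zero) are bought. -/
def moatInit : Timed (MoatState n) := do
  let start ← filterList (List.finRange n) fun v => test (v = I.root ∨ I.IsTerminal v)
  let bought ← mapList start fun v => op (v, (0 : ℝ))
  let mark ← tabulate fun _ => op (none : Option ℝ)
  markDead I { time := 0, bought := bought, dual := [], mark := mark }

/-- Raise the dual variables of all active moats by `Δ`, and then buy the given vertex,
if any. -/
def advance (s : MoatState n) (active : List (Finset (Fin n))) (Δ : ℝ)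
    (buy : Option (Fin n)) : Timed (MoatState n) := do
  let inc ← mapList active fun S => op (S, Δ)
  charge 1
  markDead I
    { time := s.time + Δ
      bought := match buy with
        | none => s.bought
        | some v => (v, s.time + Δ) :: s.bought
      dual := inc ++ s.dual
      mark := s.mark }

/-- One event of the growing phase: all active moats grow simultaneously until either a vertex
goes tight (and is bought) or a moat runs out of potential. -/
def moatStep (s : MoatState n) : Timed (MoatState n) := do
  let B ← boughtSet s.bought
  let moats ← components I.graph B
  let active ← filterList moats fun S => isActive I s.dual S
  let cand ← filterList (List.finRange n) fun v => do
    let new ← test (v ∈ I.alive ∧ v ∉ B)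
    let touched ← anyList active fun S => inBoundary I.graph S v
    return new && touched
  let slack ← mapList cand fun v => do
    let rate ← sumList active fun S => do
      let b ← inBoundary I.graph S v
      return if b then (1 : ℝ) else 0
    let used ← load I s.dual v
    op (v, (I.redCost v - used) / rate)
  let mortal ← filterList active fun S => do
    let inf ← hasForced I S
    return !inf
  let life ← mapList mortal fun S => do
    let pot ← potential I s.dual S
    op ((), pot)
  let firstTight ← minList slack
  let firstDead ← minList life
  match firstTight, firstDead with
  | none, none => pure s
  | some (v, Δ), none => advance I s active Δ (some v)
  | none, some (_, Δ) => advance I s active Δ none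
  | some (v, Δ), some (_, Δ') => do
    let vertexFirst ← test (Δ ≤ Δ')
    if vertexFirst then advance I s active Δ (some v) else advance I s active Δ' none

/-- Pruning step for the vertex `e.1`, bought at time `e.2`: delete it from `X` unless this
disconnects from the root a terminal that is unmarked or marked later than `e.2`. -/
def pruneStep (mark : Fin n → Option ℝ) (X : Finset (Fin n)) (e : Fin n × ℝ) :
    Timed (Finset (Fin n)) := do
  let X' ← vertexSet fun u => test (u ∈ X ∧ u ≠ e.1)
  let before ← reach (graphAdj I.graph) X I.root
  let after ← reach (graphAdj I.graph) X' I.root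
  let harmless ← allVertices fun t =>
    test (I.IsTerminal t ∧ (∀ m, mark t = some m → e.2 < m) ∧ t ∈ before → t ∈ after)
  let isRoot ← test (e.1 = I.root)
  return if harmless && !isRoot then X' else X

/-- The primal-dual moat-growing algorithm: at most `n` vertices go tight and at most `n` moats
run out of potential, so that the growing phase has at most `2 * n` events; then
the bought vertices are pruned in the reverse order of buying. -/
def moatGrowing : Timed (Finset (Fin n)) := do
  let s₀ ← moatInit I
  let s ← iterate (2 * n) (moatStep I) s₀
  let X ← boughtSet s.bought
  foldList (pruneStep I s.mark) X s.bought

end MoatGrowing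

/-- The vertex set `X` spans a connected subgraph that contains the root. -/
def IsRootedConnected {n : ℕ} (G : SimpleGraph (Fin n)) (root : Fin n) (X : Finset (Fin n)) :
    Prop :=
  root ∈ X ∧ (G.induce (X : Set (Fin n))).Connected

/-- The LMP algorithm for the plain rooted node-weighted prize-collecting Steiner tree
problem. -/
def prizeCollecting {n : ℕ} (G : SimpleGraph (Fin n)) (cost penalty : Fin n → ℝ)
    (root : Fin n) : Timed (Finset (Fin n)) :=
  moatGrowing
    { graph := G, alive := Finset.univ, forced := ∅, cost := cost, penalty := penalty,
      root := root }

/-- On the graph class `𝒢` the algorithm `prizeCollecting` is a Lagrangian multiplier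
preserving `r`-approximation: it returns a solution whose cost plus `r` times the
penalties of the vertices left out is at most `r` times the optimum value. -/
def HasLMPRatio (𝒢 : ∀ n : ℕ, Set (SimpleGraph (Fin n))) (r : ℝ) : Prop :=
  ∀ (n : ℕ) (G : SimpleGraph (Fin n)), G ∈ 𝒢 n →
    ∀ (cost penalty : Fin n → ℝ) (root : Fin n), (∀ v, 0 ≤ cost v) → (∀ v, 0 ≤ penalty v) →
      IsRootedConnected G root (prizeCollecting G cost penalty root).val ∧
      ∀ X : Finset (Fin n), IsRootedConnected G root X →
        ∑ v ∈ (prizeCollecting G cost penalty root).val, cost v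
            + r * ∑ v ∈ (prizeCollecting G cost penalty root).valᶜ, penalty v
          ≤ r * (∑ v ∈ X, cost v + ∑ v ∈ Xᶜ, penalty v)

section Merging

open Timed

variable {n : ℕ}

/-- Adjacency in the graph obtained by contracting the set `M` (which contains `root`) to
the single vertex `root`. -/
def contractedAdj (G : SimpleGraph (Fin n)) (M : Finset (Fin n)) (root a b : Fin n) :
    Timed Bool := do
  let direct ← test (a ≠ root ∧ b ≠ root ∧ G.Adj a b)
  let fromRoot ← anyVertex fun u => test (a = root ∧ b ≠ root ∧ u ∈ M ∧ G.Adj u b)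
  let toRoot ← anyVertex fun u => test (b = root ∧ a ≠ root ∧ u ∈ M ∧ G.Adj u a)
  return direct || fromRoot || toRoot

/-- The edges of a spanning tree of the vertex set `B`, grown from `root`. -/
def spanningTree (adj : Fin n → Fin n → Timed Bool) (B : Finset (Fin n)) (root : Fin n) :
    Timed (List (Fin n × Fin n)) := do
  let start ← vertexSet fun v => test (v = root)
  let final ← iterate n (fun (s : Finset (Fin n) × List (Fin n × Fin n)) => do
    let new ← filterList ((List.finRange n).product (List.finRange n)) fun e => do
      let a ← adj e.1 e.2
      let b ← test (e.1 ∈ s.1 ∧ e.2 ∈ B ∧ e.2 ∉ s.1)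
      return a && b
    match new.head? with
    | none => pure s
    | some e => op (insert e.2 s.1, e :: s.2)) (start, [])
  return final.2

/-- Adjacency given by a list of edges. -/
def edgeAdj (E : List (Fin n × Fin n)) (u v : Fin n) : Timed Bool :=
  anyList E fun e => test (e = (u, v) ∨ e = (v, u))

/-- The edges with both ends in `X`. -/
def edgesInside (X : Finset (Fin n)) (E : List (Fin n × Fin n)) :
    Timed (List (Fin n × Fin n)) :=
  filterList E fun e => test (e.1 ∈ X ∧ e.2 ∈ X)

/-- The edges that do not have both ends in `X`. -/
def edgesNotInside (X : Finset (Fin n)) (E : List (Fin n × Fin n)) :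
    Timed (List (Fin n × Fin n)) :=
  filterList E fun e => test (¬ (e.1 ∈ X ∧ e.2 ∈ X))

/-- Data for picking vertices: the node weights, the vertex `root` that stands for the
contracted set (of cost and cardinality zero), and the cost and cardinality of the
whole contracted tree, which are the reference for cost-effectiveness. -/
structure PickData (n : ℕ) where
  cost : Fin n → ℝ
  root : Fin n
  totalCost : ℝ
  totalSize : ℕ

/-- Cardinality, not counting the contracted vertex. -/
def superSize (D : PickData n) (X : Finset (Fin n)) : Timed ℕ := do
  let Y ← vertexSet fun v => test (v ∈ X ∧ v ≠ D.root)
  card Y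

/-- `c(X) / |X|` is at most the corresponding quotient for the whole contracted tree. -/
def costEffective (D : PickData n) (X : Finset (Fin n)) : Timed Bool := do
  let s ← superSize D X
  let w ← sumVertices fun v => op (if v ∈ X ∧ v ≠ D.root then D.cost v else 0)
  test (w * D.totalSize ≤ D.totalCost * s)

/-- The tree `H`: its vertices (before contraction), the edges that are still present, and
the edges that have been contracted. The nodes of `H` are the blocks, i.e. the connected
components of the contracted edges. -/
structure ContractedTree (n : ℕ) where
  vertices : Finset (Fin n)
  edges : List (Fin n × Fin n)
  contracted : List (Fin n × Fin n)

/-- The component of `x` that arises by removing the edge `e` from `H`. -/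
def sideOf (H : ContractedTree n) (e : Fin n × Fin n) (x : Fin n) :
    Timed (Finset (Fin n)) := do
  let rest ← filterList H.edges fun f => test (f ≠ e)
  reach (edgeAdj (rest ++ H.contracted)) H.vertices x

/-- Take an edge of `H` with a cost-effective side `X` that has at least `q` vertices or is
not yet contracted, if there is any. In the first case remove the other side, in the
second case contract `X`. -/
def contractStep (D : PickData n) (q : ℕ) (H : ContractedTree n) :
    Timed (ContractedTree n) := do
  let sides₁ ← mapList H.edges fun e => sideOf H e e.1
  let sides₂ ← mapList H.edges fun e => sideOf H e e.2
  let good ← filterList (sides₁ ++ sides₂) fun X => do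
    let ce ← costEffective D X
    let s ← superSize D X
    let large ← test (q ≤ s)
    let inner ← edgesInside X H.edges
    let fresh ← test (inner ≠ [])
    return ce && (large || fresh)
  match good.head? with
  | none => pure H
  | some X => do
    let s ← superSize D X
    let large ← test (q ≤ s)
    let inner ← edgesInside X H.edges
    let contr ← edgesInside X H.contracted
    let outer ← edgesNotInside X H.edges
    return if large then { vertices := X, edges := inner, contracted := contr }
      else { vertices := H.vertices, edges := outer, contracted := inner ++ H.contracted }

/-- The node of `H` that contains `x`. -/
def block (H : ContractedTree n) (x : Fin n) : Timed (Finset (Fin n)) :=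
  reach (edgeAdj H.contracted) H.vertices x

/-- Number of edges of `H` at the node `X`. -/
def blockDegree (H : ContractedTree n) (X : Finset (Fin n)) : Timed ℕ := do
  let inc ← filterList H.edges fun e => test (e.1 ∈ X ∨ e.2 ∈ X)
  op inc.length

/-- Add leaves (given with their cardinalities) in the given order, as long as the total
cardinality stays at most `q`. Returns the picked vertices, their number, and the
first leaf that would lead beyond `q`, if `q` has not been reached before. -/
def takeLeaves (q : ℕ) : Finset (Fin n) → ℕ → List (Finset (Fin n) × ℕ) →
    Timed (Finset (Fin n) × ℕ × Option (Finset (Fin n)))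
  | S, t, [] => pure (S, t, none)
  | S, t, (L, s) :: l => do
    let beyond ← test (q < t + s)
    let reached ← test (q = t + s)
    let S' ← vertexSet fun v => test (v ∈ S ∨ v ∈ L)
    if beyond then pure (S, t, some L)
    else if reached then pure (S', t + s, none)
    else takeLeaves q S' (t + s) l

/-- Pick at least `q` vertices from the tree with vertex set `U` and edges `E`, with at most
`depth` recursive calls below this one. Returns the picked vertices and the list
of central vertices, from which paths have to be bought. -/
def pick (D : PickData n) : ℕ → ℕ → Finset (Fin n) → List (Fin n × Fin n) →
    Timed (Finset (Fin n) × List (Fin n))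
  | depth, q, U, E => do
    let H ← iterate (2 * n) (contractStep D q) { vertices := U, edges := E, contracted := [] }
    let ends := H.edges.map Prod.fst ++ H.edges.map Prod.snd
    let blocks ← mapList ends fun x => do
      let X ← block H x
      let d ← blockDegree H X
      let s ← superSize D X
      return (x, X, d, s)
    let leaves ← filterList blocks fun b => test (b.2.2.1 = 1)
    let inner ← filterList blocks fun b => test (b.2.2.1 ≠ 1)
    let size ← superSize D H.vertices
    let small ← test (size ≤ q)
    if small then do
      let verts ← filterList (List.finRange n) fun v => test (v ∈ H.vertices)
      return (H.vertices, verts.take 1)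
    else do
    let sorted ← sortDesc (leaves.map fun b => (b.2.1, b.2.2.2))
    let first ← filterList (List.finRange n) fun v => test (∃ L ∈ sorted.head?, v ∈ L.1)
    -- the centre of the star, or a vertex of the first leaf if `H` is a single edge
    let center := (inner.map Prod.fst ++ first).take 1
    let (S, t, excess) ← takeLeaves q ∅ 0 sorted
    match excess, depth with
    | none, _ => pure (S, center)
    | some L, 0 => do
      let S' ← vertexSet fun v => test (v ∈ S ∨ v ∈ L)
      return (S', center)
    | some L, depth' + 1 => do
      let EL ← edgesInside L E
      let (S', centers) ← pick D depth' (q - t) L EL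
      let S'' ← vertexSet fun v => test (v ∈ S ∨ v ∈ S')
      return (S'', center ++ centers)

/-- Shortest paths to `U`: for each vertex `v` the least weight, not counting the last vertex,
of a path from `v` to a vertex of `U`, together with the vertices of such a path (or `none`
if there is no such path). Computed in `n` rounds of relaxation. -/
def pathsTo (G : SimpleGraph (Fin n)) (cost : Fin n → ℝ) (U : Finset (Fin n)) :
    Timed (Fin n → Option (List (Fin n) × ℝ)) := do
  let start ← tabulate fun v => op (if v ∈ U then some ([v], (0 : ℝ)) else none)
  iterate n (fun (lab : Fin n → Option (List (Fin n) × ℝ)) => tabulate fun v => do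
    let nbs ← filterList (List.finRange n) fun u => test (G.Adj v u ∧ lab u ≠ none)
    let ext ← mapList nbs fun u =>
      op (match lab u with
        | none => ([], 0)
        | some (P, d) => (v :: P, cost v + d))
    minList ((lab v).toList ++ ext)) start

/-- Tree merging: pick `k - |T₁|` (or slightly more) vertices of `T₂ \ T₁` and connect them
to `T₁` by the given paths from the central vertices. -/
def mergeTrees (G : SimpleGraph (Fin n)) (cost : Fin n → ℝ) (root : Fin n) (k depth : ℕ)
    (paths : Fin n → Option (List (Fin n) × ℝ)) (T₁ T₂ : Finset (Fin n)) :
    Timed (Finset (Fin n)) := do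
  let M ← vertexSet fun v => test (v ∈ T₁ ∧ v ∈ T₂)
  let R ← vertexSet fun v => test (v ∈ T₂ ∧ v ∉ T₁)
  let U ← vertexSet fun v => test (v = root ∨ v ∈ R)
  let E ← spanningTree (contractedAdj G M root) U root
  let totalCost ← sumVertices fun v => op (if v ∈ R then cost v else 0)
  let totalSize ← card R
  let size₁ ← card T₁
  let (S, centers) ← pick
    { cost := cost, root := root, totalCost := totalCost, totalSize := totalSize }
    depth (k - size₁) U E
  let S₁ ← vertexSet fun v => test (v ∈ T₁ ∨ v ∈ S)
  foldList (fun X x => foldList (fun Y v => op (insert v Y)) X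
    (match paths x with
      | none => []
      | some (P, _) => P)) S₁ centers

end Merging

section Main

open Timed

variable {n : ℕ}

/-- State of the binary search for the Lagrangian multiplier. -/
structure SearchState (n : ℕ) where
  lo : ℝ
  hi : ℝ
  treeLo : Finset (Fin n)
  treeHi : Finset (Fin n)

/-- Candidate solutions for the guess `g` of the optimum value and the guess `W` of the skeleton,
with accuracy `δ`. -/
def solveGuess (δ : ℝ) (G : SimpleGraph (Fin n)) (cost : Fin n → ℝ) (root : Fin n) (k : ℕ)
    (g : ℝ) (W : Finset (Fin n)) : Timed (List (Finset (Fin n))) := do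
  -- prune all vertices that are not `δ`-distant to the skeleton and the root
  let U ← vertexSet fun v => test (v = root ∨ v ∈ W)
  let paths ← pathsTo G cost U
  let A ← vertexSet fun v => test (∃ P d, paths v = some (P, d) ∧ d ≤ δ * g)
  -- discard guesses that are certainly wrong
  let cheap ← allVertices fun v => test (v ∈ U → cost v ≤ g)
  let comp ← reach (graphAdj G) A root
  let conn ← allVertices fun v => test (v ∈ A → v ∈ comp)
  let sizeA ← card A
  let enough ← test (k ≤ sizeA)
  if !(cheap && conn && enough) then pure [] else do
  -- the trees for the multiplier `lam`
  let tree : ℝ → Timed (Finset (Fin n)) := fun lam => moatGrowing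
    { graph := G, alive := A, forced := W, cost := cost, penalty := fun _ => lam, root := root }
  let T₀ ← tree 0
  let size₀ ← card T₀
  let done ← test (k ≤ size₀)
  if done then pure [T₀] else do
  let top : ℝ := if g = 0 then 1 else (n + 1) * g
  let T ← tree top
  -- binary search until `hi - lo` is at most `δ * g / (3 * n)`
  charge ⌈3 * n * (n + 1) / δ⌉₊
  let s ← iterate (Nat.clog 2 ⌈3 * n * (n + 1) / δ⌉₊) (fun (s : SearchState n) => do
    let sizeHi ← card s.treeHi
    let lucky ← test (sizeHi = k)
    if lucky then pure s else do
    let mid := (s.lo + s.hi) / 2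
    let T ← tree mid
    let size ← card T
    let less ← test (size < k)
    return if less then { s with lo := mid, treeLo := T } else { s with hi := mid, treeHi := T })
    { lo := 0, hi := top, treeLo := T₀, treeHi := T }
  let sizeHi ← card s.treeHi
  let lucky ← test (sizeHi = k)
  if lucky then pure [s.treeHi] else do
  let merged ← mergeTrees G cost root k (Nat.clog 2 ⌈4 / δ⌉₊) paths s.treeLo s.treeHi
  pure [merged, s.treeHi]

/-- All vertex sets with at most `m` elements. -/
def smallSets (n : ℕ) : ℕ → Timed (List (Finset (Fin n)))
  | 0 => op [∅]
  | m + 1 => do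
    let l ← smallSets n m
    let ext ← mapList ((List.finRange n).product l) fun e =>
      vertexSet fun u => test (u = e.1 ∨ u ∈ e.2)
    return l ++ ext

/-- Guesses of the optimum value, up to a factor `1 + δ`: the optimum lies between the largest
weight of a vertex in an optimum solution and `n` times this weight. -/
def optGuesses (δ : ℝ) (cost : Fin n → ℝ) : Timed (List ℝ) :=
  mapList ((List.finRange n).product (List.range (⌈n / δ⌉₊ + 1))) fun e => do
    charge e.2
    op (cost e.1 * (1 + δ) ^ e.2)

/-- Keep the cheaper one of the best solution so far and the candidate `T`, provided that `T` is
feasible. -/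
def keepBetter (G : SimpleGraph (Fin n)) (cost : Fin n → ℝ) (root : Fin n) (k : ℕ)
    (best : Option (Finset (Fin n) × ℝ)) (T : Finset (Fin n)) :
    Timed (Option (Finset (Fin n) × ℝ)) := do
  let comp ← reach (graphAdj G) T root
  let conn ← allVertices fun v => test (v ∈ T → v ∈ comp)
  let size ← card T
  let feasible ← test (root ∈ T ∧ k ≤ size)
  let w ← sumVertices fun v => op (if v ∈ T then cost v else 0)
  let better ← test (∀ b ∈ best, w < b.2)
  return if conn && feasible && better then some (T, w) else best

/-- The algorithm for rooted node-weighted `k`-MST with accuracy parameter `δ`: for all guesses of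
the optimum value and of the skeleton, prune the instance, find two trees by the Lagrangian
binary search, and merge them; return the cheapest solution found. -/
def nwkMST (δ : ℝ) (G : SimpleGraph (Fin n)) (cost : Fin n → ℝ) (root : Fin n) (k : ℕ) :
    Timed (Option (Finset (Fin n))) := do
  let values ← optGuesses δ cost
  charge ⌊1 / δ⌋₊
  let skeletons ← smallSets n ⌊1 / δ⌋₊
  let best ← foldList (fun best (e : ℝ × Finset (Fin n)) => do
    let candidates ← solveGuess δ G cost root k e.1 e.2
    foldList (keepBetter G cost root k) best candidates) none (values.product skeletons)
  return best.map Prod.fst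

/-- Feasible solutions of rooted node-weighted `k`-MST: vertex sets of connected subgraphs that
contain the root and at least `k` vertices. -/
def IsKSolution (G : SimpleGraph (Fin n)) (root : Fin n) (k : ℕ) (X : Finset (Fin n)) : Prop :=
  IsRootedConnected G root X ∧ k ≤ X.card

end Main

end

/-! Let `X` be any solution and `c` its cost. It suffices that one guess produces a feasible
candidate of cost at most `(4/3 + loss δ) r c`, because the running minimum (`foldl_keepBetter`)
then does at least as well. The final choice of `δ` makes `loss δ ≤ ε` (`loss_le`).

The right guess consists of a value `g` between `c` and `(1 + δ) c` (`exists_optGuess`) and a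
skeleton `W` of `X`. Folding `X` together leaf by leaf, and keeping a vertex whenever more than `δ
g` has accumulated, gives at most `c / (δ g) ≤ 1 / δ` vertices such that every vertex of `X` has a
path of weight at most `δ g` to `W` or the root (`exists_skeleton_of_heights`). For this guess
pruning keeps `X`, leaves a connected graph whose vertices cost at most `g`, and makes every
remaining vertex connectable to the skeleton at price `δ g`.

The hypothesis on moat growing concerns plain instances, while the algorithm uses infinite penalties
and deleted vertices. These are simulated by a huge penalty `N` and a huge cost `N`: for all large
`N` the two runs agree event by event (`eventually_moatGrowing_simulate`), so the LMP guarantee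
carries over (`HasLMPRatio.moatGrowing`). For the uniform penalty `λ` it says that the tree `T`
satisfies `c(T) ≤ r (c + λ (|T| - k))` (`isLagrangeTree_moatGrowing`).

The binary search yields `T₁`, `T₂` with `|T₁| < k ≤ |T₂|` and almost equal multipliers. Put `q = k
- |T₁|`, `s = |T₂| - k`, `α = q / (q + s)` and `u = λ₁ q`. Up to small errors, `c(T₁) ≤ r (c - u)`
and `c(T₂) ≤ r (c + λ₁ s)`, where `α λ₁ s = (1 - α) u`. If `q` vertices of `T₂ \ T₁` can be added to
`T₁` at the average price, the result costs at most `r (c + α (c - u))`. Either `λ₁ s ≤ c/3` and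
`T₂` is good enough, or `α (c - u) ≤ c/3` and the merged tree is; that one of them holds amounts to
`(2 α - 1)² ≥ 0` (`merge_or_large`).

It remains to add `q` vertices at about the average price. The contracted tree is exactly average,
so every edge has a side that is no worse than average. Contracting or isolating such sides as long
as possible ends with at most `q` vertices, or with a star or a single edge, all of whose leaves are
cost-effective and have at most `q` vertices. If leaves are taken by decreasing size, the one that
overflows is no larger than what has been taken, so at most half of the target is missing; recursion
inside this leaf halves the relative excess at each level (`pick_spec`). Each level needs one path
of weight `δ g` to the skeleton, which lies in `T₁` (`mergeTrees_spec`).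

For the running time, a single number `N`, polynomial in `n` for fixed `δ`, bounds all loop lengths,
and the nesting depth of loops depends only on `δ`; thus the time is at most a fixed power of `N`.
-/

section

/-! ### Values of the basic programs: search, connectivity, running minimum. -/

namespace Timed

variable {α β σ : Type} {n : ℕ}

@[simp] theorem val_pure (a : α) : (pure a : Timed α).val = a := rfl
@[simp] theorem time_pure (a : α) : (pure a : Timed α).time = 0 := rfl
@[simp] theorem val_bind (x : Timed α) (f : α → Timed β) : (x >>= f).val = (f x.val).val := rfl
@[simp] theorem val_op (a : α) : (op a).val = a := rfl
@[simp] theorem val_test (p : Prop) : (test p).val = decide p := rfl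
@[simp] theorem val_tabulate (f : Fin n → Timed α) : (tabulate f).val = fun v => (f v).val := rfl
@[simp] theorem mem_vertexSet (p : Fin n → Timed Bool) (v : Fin n) :
    v ∈ (vertexSet p).val ↔ (p v).val = true := by
  simp [vertexSet]
@[simp] theorem val_anyVertex (p : Fin n → Timed Bool) :
    (anyVertex p).val = decide (∃ v, (p v).val = true) := rfl
@[simp] theorem val_allVertices (p : Fin n → Timed Bool) :
    (allVertices p).val = decide (∀ v, (p v).val = true) := rfl
@[simp] theorem val_sumVertices (f : Fin n → Timed ℝ) :
    (sumVertices f).val = ∑ v, (f v).val := rfl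
@[simp] theorem val_mapList (l : List α) (f : α → Timed β) :
    (mapList l f).val = l.map (fun a => (f a).val) := rfl
@[simp] theorem val_filterList (l : List α) (p : α → Timed Bool) :
    (filterList l p).val = l.filter (fun a => (p a).val) := rfl
@[simp] theorem val_anyList (l : List α) (p : α → Timed Bool) :
    (anyList l p).val = l.any (fun a => (p a).val) := rfl
@[simp] theorem val_sumList (l : List α) (f : α → Timed ℝ) :
    (sumList l f).val = (l.map (fun a => (f a).val)).sum := rfl
@[simp] theorem val_minList (l : List (α × ℝ)) : (minList l).val = l.argmin Prod.snd := rfl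
@[simp] theorem val_sortDesc (l : List (α × ℕ)) :
    (sortDesc l).val = l.insertionSort (fun a b => b.2 ≤ a.2) := rfl
@[simp] theorem val_card (S : Finset (Fin n)) : (card S).val = S.card := rfl

@[simp] theorem val_iterate (m : ℕ) (f : σ → Timed σ) (s : σ) :
    (iterate m f s).val = (fun x => (f x).val)^[m] s := by
  induction m generalizing s with
  | zero => rfl
  | succ m ih => simp [iterate, ih]

@[simp] theorem val_foldList (f : σ → α → Timed σ) (s : σ) (l : List α) :
    (foldList f s l).val = l.foldl (fun s a => (f s a).val) s := by
  induction l generalizing s with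
  | nil => rfl
  | cons a l ih => simp [foldList, ih]

end Timed

/-- `v` can be reached from `u` by steps along `r` whose targets lie in `B`. -/
def LinkedIn {n : ℕ} (r : Fin n → Fin n → Prop) (B : Finset (Fin n)) (u v : Fin n) : Prop :=
  Relation.ReflTransGen (fun a b => r a b ∧ b ∈ B) u v

theorem LinkedIn.mono {n : ℕ} {r r' : Fin n → Fin n → Prop} {B B' : Finset (Fin n)} {u v : Fin n}
    (h : LinkedIn r B u v) (hr : ∀ a b, r a b → b ∈ B → r' a b) (hB : B ⊆ B') :
    LinkedIn r' B' u v :=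
  Relation.ReflTransGen.mono (fun _ _ hab => ⟨hr _ _ hab.1 hab.2, hB hab.2⟩) _ _ h

theorem LinkedIn.mem {n : ℕ} {r : Fin n → Fin n → Prop} {B : Finset (Fin n)} {u v : Fin n}
    (h : LinkedIn r B u v) (hu : u ∈ B) : v ∈ B := by
  induction h with
  | refl => exact hu
  | tail _ h _ => exact h.2

/-- A growing sequence of vertex sets is stationary after `n` steps. -/
theorem iterate_eq_of_subset {n : ℕ} (f : Finset (Fin n) → Finset (Fin n))
    (hf : ∀ S, S ⊆ f S) (S : Finset (Fin n)) : f (f^[n] S) = f^[n] S := by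
  by_contra hne
  -- Once stationary, the sequence stays so; if it still moves at step `n`, then all steps up to
  -- this one add a vertex, which makes more than `n` vertices.
  have key : ∀ i, i ≤ n → f (f^[i] S) ≠ f^[i] S := by
    intro i hi heq
    apply hne
    obtain ⟨j, rfl⟩ := Nat.exists_eq_add_of_le hi
    have : ∀ j, f^[i + j] S = f^[i] S := by
      intro j
      induction j with
      | zero => rfl
      | succ j ih => rw [← add_assoc, Function.iterate_succ_apply', ih, heq]
    rw [this, heq]
  have hcard : ∀ i, i ≤ n + 1 → i ≤ (f^[i] S).card := by
    intro i
    induction i with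
    | zero => simp
    | succ i ih =>
      intro hi
      rw [Function.iterate_succ_apply']
      have h1 := ih (by omega)
      have h2 : (f^[i] S).card < (f (f^[i] S)).card :=
        Finset.card_lt_card ((hf _).ssubset_of_ne (key i (by omega)).symm)
      omega
  have h1 := hcard (n + 1) le_rfl
  have h2 := Finset.card_le_univ (f^[n + 1] S)
  rw [Fintype.card_fin] at h2
  omega

/-- After `n` rounds the set is a fixed point by `iterate_eq_of_subset`, hence closed under steps
into `B`. The search starts from the empty set if `v ∉ B`, which accounts for the first conjunct. -/
theorem mem_reach {n : ℕ} (adj : Fin n → Fin n → Timed Bool) (B : Finset (Fin n)) (v u : Fin n) :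
    u ∈ (reach adj B v).val ↔ v ∈ B ∧ LinkedIn (fun a b => (adj a b).val = true) B v u := by
  set f : Finset (Fin n) → Finset (Fin n) := fun S => (Timed.vertexSet fun u => do
    let old ← Timed.test (u ∈ S)
    let inB ← Timed.test (u ∈ B)
    let nb ← Timed.anyVertex fun w => do
      let a ← adj w u
      let b ← Timed.test (w ∈ S)
      return a && b
    return old || (inB && nb)).val with hf
  have hmem : ∀ S x, x ∈ f S ↔ x ∈ S ∨ (x ∈ B ∧ ∃ w, (adj w x).val = true ∧ w ∈ S) := by
    intro S x
    simp [hf]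
  set S₀ : Finset (Fin n) := (Timed.vertexSet fun u => Timed.test (u = v ∧ u ∈ B)).val with hS₀
  have hval : (reach adj B v).val = f^[n] S₀ := by
    simp [reach, hf, hS₀]
  have hS₀m : ∀ x, x ∈ S₀ ↔ x = v ∧ x ∈ B := by simp [hS₀]
  have hsub : ∀ S, S ⊆ f S := fun S x hx => (hmem S x).2 (Or.inl hx)
  have hfix := iterate_eq_of_subset f hsub S₀
  rw [hval]
  constructor
  · have : ∀ i x, x ∈ f^[i] S₀ → v ∈ B ∧ LinkedIn (fun a b => (adj a b).val = true) B v x := by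
      intro i
      induction i with
      | zero =>
        intro x hx
        obtain ⟨rfl, h⟩ := (hS₀m x).1 hx
        exact ⟨h, .refl⟩
      | succ i ih =>
        intro x hx
        rw [Function.iterate_succ_apply', hmem] at hx
        rcases hx with hx | ⟨hxB, w, hw, hwS⟩
        · exact ih x hx
        · exact ⟨(ih w hwS).1, (ih w hwS).2.tail ⟨hw, hxB⟩⟩
    exact this n u
  · rintro ⟨hv, h⟩
    induction h with
    | refl =>
      have : ∀ i, v ∈ f^[i] S₀ := by
        intro i
        induction i with
        | zero => exact (hS₀m v).2 ⟨rfl, hv⟩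
        | succ i ih => rw [Function.iterate_succ_apply']; exact hsub _ ih
      exact this n
    | tail _ hstep ih =>
      rw [← hfix, hmem]
      exact Or.inr ⟨hstep.2, _, hstep.1, ih⟩

theorem mem_reach_graphAdj {n : ℕ} (G : SimpleGraph (Fin n)) (B : Finset (Fin n)) (v u : Fin n) :
    u ∈ (reach (graphAdj G) B v).val ↔ v ∈ B ∧ LinkedIn G.Adj B v u := by
  rw [mem_reach]
  simp [graphAdj]

/-- Links connectedness of the induced graph to `LinkedIn`, the relation that the searches compute.
It is enough that the targets of the steps lie in `X`, since the start `root` does. -/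
theorem isRootedConnected_iff {n : ℕ} (G : SimpleGraph (Fin n)) (root : Fin n)
    (X : Finset (Fin n)) :
    IsRootedConnected G root X ↔ root ∈ X ∧ ∀ v ∈ X, LinkedIn G.Adj X root v := by
  constructor
  · rintro ⟨hr, hc⟩
    refine ⟨hr, fun v hv => ?_⟩
    have h := hc.preconnected ⟨root, hr⟩ ⟨v, hv⟩
    rw [SimpleGraph.reachable_iff_reflTransGen] at h
    exact Relation.ReflTransGen.lift Subtype.val (fun a b hab => ⟨hab, b.2⟩) _ _ h
  · rintro ⟨hr, h⟩
    refine ⟨hr, ?_⟩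
    have key : ∀ v (hv : v ∈ X), (G.induce (X : Set (Fin n))).Reachable ⟨root, hr⟩ ⟨v, hv⟩ := by
      intro v hv
      have := h v hv
      induction this with
      | refl => exact SimpleGraph.Reachable.refl _
      | @tail b c hb hc ih =>
        have hbX : b ∈ X := LinkedIn.mem hb hr
        refine (ih hbX).trans (SimpleGraph.Adj.reachable ?_)
        exact hc.1
    have : Nonempty (X : Set (Fin n)) := ⟨⟨root, hr⟩⟩
    exact ⟨fun a b => (key a.1 a.2).symm.trans (key b.1 b.2)⟩

/-- A rooted connected vertex set leaves every proper subset that contains the root. -/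
theorem IsRootedConnected.exists_adj {n : ℕ} {G : SimpleGraph (Fin n)} {root : Fin n}
    {X S : Finset (Fin n)} (hX : IsRootedConnected G root X) (hr : root ∈ S) {v : Fin n}
    (hv : v ∈ X) (hvS : v ∉ S) : ∃ a b, a ∈ S ∧ a ∈ X ∧ b ∈ X ∧ b ∉ S ∧ G.Adj a b := by
  obtain ⟨hrX, h⟩ := (isRootedConnected_iff _ _ _).1 hX
  have := h v hv
  induction this with
  | refl => exact absurd hr hvS
  | @tail b c hb hc ih =>
    by_cases hbS : b ∈ S
    · exact ⟨b, c, hbS, LinkedIn.mem hb hrX, hv, hvS, hc.1⟩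
    · exact ih (LinkedIn.mem hb hrX) hbS

theorem mem_components {n : ℕ} {G : SimpleGraph (Fin n)} {B S : Finset (Fin n)}
    (h : S ∈ (components G B).val) :
    ∃ v ∈ B, ∀ u, u ∈ S ↔ LinkedIn G.Adj B v u := by
  simp only [components, Timed.val_bind, Timed.val_mapList, Timed.val_filterList,
    List.mem_map, List.mem_filter] at h
  obtain ⟨v, ⟨-, hv⟩, rfl⟩ := h
  have hvB : v ∈ B := by
    by_contra hh
    simp [hh] at hv
  refine ⟨v, hvB, fun u => ?_⟩
  simp only [Timed.val_op, Timed.val_tabulate, mem_reach_graphAdj]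
  simp [hvB]

theorem components_subset {n : ℕ} {G : SimpleGraph (Fin n)} {B S : Finset (Fin n)}
    (h : S ∈ (components G B).val) : S ⊆ B := by
  obtain ⟨v, hv, hS⟩ := mem_components h
  intro u hu
  exact ((hS u).1 hu).mem hv

/-- The running minimum kept by `keepBetter`. -/
theorem keepBetter_val {n : ℕ} (G : SimpleGraph (Fin n)) (cost : Fin n → ℝ) (root : Fin n) (k : ℕ)
    (best : Option (Finset (Fin n) × ℝ)) (T : Finset (Fin n)) :
    (keepBetter G cost root k best T).val =
      if IsKSolution G root k T ∧ ∀ b ∈ best, ∑ v ∈ T, cost v < b.2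
        then some (T, ∑ v ∈ T, cost v) else best := by
  have hsum : ∑ v, (if v ∈ T then cost v else 0) = ∑ v ∈ T, cost v := by
    rw [Finset.sum_ite_mem, Finset.univ_inter]
  have hiff : (decide (∀ v, (Timed.test (v ∈ T → v ∈ (reach (graphAdj G) T root).val)).val = true)
      && decide (root ∈ T ∧ k ≤ T.card)) = true ↔ IsKSolution G root k T := by
    simp only [Bool.and_eq_true, decide_eq_true_eq, Timed.val_test, mem_reach_graphAdj,
      IsKSolution, isRootedConnected_iff]
    constructor
    · rintro ⟨h1, h2, h3⟩
      exact ⟨⟨h2, fun v hv => (h1 v hv).2⟩, h3⟩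
    · rintro ⟨⟨h2, h1⟩, h3⟩
      exact ⟨fun v hv => ⟨h2, h1 v hv⟩, h2, h3⟩
  simp only [keepBetter, Timed.val_bind, Timed.val_pure, Timed.val_allVertices,
    Timed.val_sumVertices, Timed.val_op, Timed.val_card, hsum]
  congr 1
  rw [← hiff]
  simp [and_assoc]

/-- The second claim uses thresholds `c` instead of a minimum, so that the induction need not
distinguish whether a feasible candidate has been seen already. -/
theorem foldl_keepBetter {n : ℕ} (G : SimpleGraph (Fin n)) (cost : Fin n → ℝ) (root : Fin n)
    (k : ℕ) (l : List (Finset (Fin n))) (best : Option (Finset (Fin n) × ℝ))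
    (hbest : ∀ b ∈ best, IsKSolution G root k b.1 ∧ b.2 = ∑ v ∈ b.1, cost v) :
    (∀ b ∈ l.foldl (fun s a => (keepBetter G cost root k s a).val) best,
      IsKSolution G root k b.1 ∧ b.2 = ∑ v ∈ b.1, cost v) ∧
    (∀ c : ℝ, ((∃ b ∈ best, b.2 ≤ c) ∨ ∃ T ∈ l, IsKSolution G root k T ∧ ∑ v ∈ T, cost v ≤ c) →
      ∃ b ∈ l.foldl (fun s a => (keepBetter G cost root k s a).val) best, b.2 ≤ c) := by
  induction l generalizing best with
  | nil => exact ⟨hbest, fun c h => by simpa using h⟩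
  | cons T l ih =>
    have hstep : ∀ b ∈ (keepBetter G cost root k best T).val,
        IsKSolution G root k b.1 ∧ b.2 = ∑ v ∈ b.1, cost v := by
      intro b hb
      rw [keepBetter_val] at hb
      split_ifs at hb with h
      · obtain rfl := Option.mem_some_iff.1 hb
        exact ⟨h.1, rfl⟩
      · exact hbest b hb
    obtain ⟨h1, h2⟩ := ih _ hstep
    refine ⟨h1, fun c hc => h2 c ?_⟩
    have hold : ∀ b ∈ best, b.2 ≤ c → ∃ b ∈ (keepBetter G cost root k best T).val, b.2 ≤ c := by
      intro b hb hbc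
      rw [keepBetter_val]
      split_ifs with h
      · exact ⟨_, rfl, ((h.2 b hb).le.trans hbc)⟩
      · exact ⟨b, hb, hbc⟩
    rcases hc with ⟨b, hb, hbc⟩ | ⟨T', hT', hs, hc⟩
    · exact Or.inl (hold b hb hbc)
    · rcases List.mem_cons.1 hT' with rfl | hT'
      · left
        by_cases h : ∀ b ∈ best, ∑ v ∈ T', cost v < b.2
        · refine ⟨(T', ∑ v ∈ T', cost v), ?_, hc⟩
          rw [keepBetter_val, if_pos ⟨hs, h⟩]; rfl
        · push Not at h
          obtain ⟨b, hb, hbc⟩ := h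
          exact hold b hb (hbc.trans hc)
      · exact Or.inr ⟨T', hT', hs, hc⟩

end

/-! ### Infinite penalties and deleted vertices, simulated by a plain instance. -/

section

open Filter

namespace List

theorem argmin_map {α β : Type*} (f : β → ℝ) (g : α → β) (l : List α) :
    (l.map g).argmin f = (l.argmin (f ∘ g)).map g := by
  induction l with
  | nil => rfl
  | cons a l ih =>
    rw [List.map_cons, List.argmin_cons, List.argmin_cons, ih]
    cases h : l.argmin (f ∘ g) with
    | none => rfl
    | some c =>
      simp only [Option.map_some, Function.comp_apply]
      split_ifs <;> rfl

theorem argmin_congr {α : Type*} {f g : α → ℝ} {l : List α} (h : ∀ a ∈ l, f a = g a) :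
    l.argmin f = l.argmin g := by
  induction l with
  | nil => rfl
  | cons a l ih =>
    rw [List.argmin_cons, List.argmin_cons, ih fun b hb => h b (List.mem_cons_of_mem _ hb)]
    cases hc : l.argmin g with
    | none => rfl
    | some c =>
      simp only [h a List.mem_cons_self, h c (List.mem_cons_of_mem _ (List.argmin_mem hc))]

/-- Entries with large keys do not influence the first minimum. -/
theorem argmin_eq_of_filter {α : Type*} {f : α → ℝ} {p : α → Bool} {l : List α}
    (h : ∀ a ∈ l, p a = true → ∀ b ∈ l, p b = false → f a < f b) {c : α}
    (hc : (l.filter p).argmin f = some c) : l.argmin f = some c := by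
  induction l generalizing c with
  | nil => exact hc
  | cons a l ih =>
    have ih' : ∀ {c}, (l.filter p).argmin f = some c → l.argmin f = some c := ih fun x hx hpx y hy hpy =>
      h x (List.mem_cons_of_mem _ hx) hpx y (List.mem_cons_of_mem _ hy) hpy
    rw [List.argmin_cons]
    cases hp : p a with
    | false =>
      rw [List.filter_cons_of_neg (by simp [hp])] at hc
      rw [ih' hc]
      have hm := List.mem_filter.1 (List.argmin_mem hc)
      have := h c (List.mem_cons_of_mem _ hm.1) hm.2 a List.mem_cons_self hp
      simp [this]
    | true =>
      rw [List.filter_cons_of_pos hp, List.argmin_cons] at hc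
      cases hd : (l.filter p).argmin f with
      | some d => rw [hd] at hc; rw [ih' hd]; exact hc
      | none =>
        rw [hd] at hc
        cases he : l.argmin f with
        | none => exact hc
        | some e =>
          have hel := List.argmin_mem he
          have hpe : p e = false := by
            by_contra hpe
            have : e ∈ l.filter p := List.mem_filter.2 ⟨hel, by simpa using hpe⟩
            rw [List.argmin_eq_none] at hd
            simp [hd] at this
          have := h a List.mem_cons_self hp e (List.mem_cons_of_mem _ hel) hpe
          simp only [not_lt.2 this.le, if_false]
          exact hc

end List

variable {n : ℕ}

theorem mem_boughtSet (l : List (Fin n × ℝ)) (v : Fin n) :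
    v ∈ (boughtSet l).val ↔ ∃ e ∈ l, e.1 = v := by
  simp [boughtSet]

namespace PrizeInstance

/-- The plain instance that simulates `I`: vertices that are not alive get cost `N` and no
penalty, forced vertices get penalty `N`. -/
def simulate (I : PrizeInstance n) (N : ℝ) : PrizeInstance n where
  graph := I.graph
  alive := Finset.univ
  forced := ∅
  cost := fun v => if v ∈ I.alive then I.cost v else N
  penalty := fun v => if v ∈ I.forced then N else if v ∈ I.alive then I.penalty v else 0
  root := I.root

variable (I : PrizeInstance n)

theorem redPenalty_nonneg (v : Fin n) : 0 ≤ I.redPenalty v :=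
  sub_nonneg.2 (min_le_right _ _)

/-- The lower bounds on `N` for which `I.simulate N` has the reduced costs of `I`. -/
def Suffices (N : ℝ) : Prop := 0 < N ∧ ∀ v, I.cost v ≤ N

theorem eventually_suffices : ∀ᶠ N in atTop, I.Suffices N :=
  (eventually_gt_atTop 0).and (eventually_all.2 fun v => eventually_ge_atTop (I.cost v))

variable {I}

/-- `0 < N` prevents a deleted vertex, of cost `N` and penalty `0`, from being a terminal; `cost ≤
N` makes every forced vertex one. -/
theorem isTerminal_simulate (hF : I.forced ⊆ I.alive) {N : ℝ} (hN : I.Suffices N) (v : Fin n) :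
    (I.simulate N).IsTerminal v ↔ I.IsTerminal v := by
  by_cases hA : v ∈ I.alive
  · by_cases hv : v ∈ I.forced
    · simp [IsTerminal, simulate, hA, hv, hN.2 v]
    · simp [IsTerminal, simulate, hA, hv]
  · have hv : v ∉ I.forced := fun h => hA (hF h)
    simp [IsTerminal, simulate, hA, hv, hN.1]

theorem redCost_simulate {N : ℝ} (hN : I.Suffices N) {v : Fin n}
    (hA : v ∈ I.alive) : (I.simulate N).redCost v = I.redCost v := by
  by_cases hv : v ∈ I.forced
  · simp [redCost, simulate, hA, hv, hN.2 v]
  · simp [redCost, simulate, hA, hv]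

theorem redCost_simulate_of_notMem (hF : I.forced ⊆ I.alive) {N : ℝ} (hN : I.Suffices N)
    {v : Fin n} (hA : v ∉ I.alive) : (I.simulate N).redCost v = N := by
  have hv : v ∉ I.forced := fun h => hA (hF h)
  simp [redCost, simulate, hA, hv, hN.1.le]

theorem redPenalty_simulate {N : ℝ} {v : Fin n} (hA : v ∈ I.alive) (hv : v ∉ I.forced) :
    (I.simulate N).redPenalty v = I.redPenalty v := by
  simp [redPenalty, simulate, hA, hv]

theorem redPenalty_simulate_of_mem (hF : I.forced ⊆ I.alive) {N : ℝ} (hN : I.Suffices N)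
    {v : Fin n} (hv : v ∈ I.forced) : (I.simulate N).redPenalty v = N - I.cost v := by
  simp [redPenalty, simulate, hF hv, hv, hN.2 v]

end PrizeInstance

open PrizeInstance

variable {I : PrizeInstance n}

theorem hasForced_val (S : Finset (Fin n)) :
    (hasForced I S).val = decide (∃ u ∈ S, u ∈ I.forced) := by
  simp [hasForced]

theorem hasForced_simulate (N : ℝ) (S : Finset (Fin n)) :
    (hasForced (I.simulate N) S).val = false := by
  simp [hasForced, simulate]

/-- The part of the dual variables that is charged to `S`. -/
noncomputable def spentOn (y : List (Finset (Fin n) × ℝ)) (S : Finset (Fin n)) : ℝ :=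
  (Timed.sumList y fun e => do
    let sub ← Timed.allVertices fun u => Timed.test (u ∈ e.1 → u ∈ S)
    return if sub then e.2 else 0).val

theorem potential_val (y : List (Finset (Fin n) × ℝ)) (S : Finset (Fin n)) :
    (potential I y S).val = ∑ v ∈ S, I.redPenalty v - spentOn y S := by
  have : ∑ v, (if v ∈ S then I.redPenalty v else 0) = ∑ v ∈ S, I.redPenalty v := by
    rw [Finset.sum_ite_mem, Finset.univ_inter]
  simp only [potential, Timed.val_bind, Timed.val_op, Timed.val_sumVertices, this]
  rfl

theorem potential_simulate {N : ℝ} (y : List (Finset (Fin n) × ℝ)) {S : Finset (Fin n)}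
    (hS : S ⊆ I.alive) (h : ¬ ∃ u ∈ S, u ∈ I.forced) :
    (potential (I.simulate N) y S).val = (potential I y S).val := by
  rw [potential_val, potential_val]
  congr 1
  refine Finset.sum_congr rfl fun v hv => redPenalty_simulate (hS hv) fun hf => h ⟨v, hv, hf⟩

/-- A forced vertex alone contributes `N - cost` to the potential, while the duals raised so far do
not depend on `N`. There are finitely many sets `S`, so one threshold serves all of them. -/
theorem eventually_lt_potential_simulate (hF : I.forced ⊆ I.alive)
    (y : List (Finset (Fin n) × ℝ)) (C : ℝ) :
    ∀ᶠ N in atTop, ∀ S, (∃ u ∈ S, u ∈ I.forced) → C < (potential (I.simulate N) y S).val := by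
  rw [eventually_all]
  intro S
  by_cases h : ∃ u ∈ S, u ∈ I.forced
  · obtain ⟨u, hu, huF⟩ := h
    filter_upwards [I.eventually_suffices, eventually_gt_atTop (C + I.cost u + spentOn y S)]
      with N hN hN' _
    rw [potential_val]
    have h1 := Finset.single_le_sum
      (fun v _ => (I.simulate N).redPenalty_nonneg v) hu
    rw [redPenalty_simulate_of_mem hF hN huF] at h1
    linarith
  · exact Eventually.of_forall fun N h' => absurd h' h

theorem eventually_isActive_simulate (hF : I.forced ⊆ I.alive) (y : List (Finset (Fin n) × ℝ)) :
    ∀ᶠ N in atTop, ∀ S ⊆ I.alive, (isActive (I.simulate N) y S).val = (isActive I y S).val := by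
  filter_upwards [eventually_lt_potential_simulate hF y 0] with N hN S hS
  have hroot : (I.simulate N).root = I.root := rfl
  simp only [isActive, Timed.val_bind, Timed.val_test, Timed.val_pure, hasForced_simulate, hroot]
  rw [hasForced_val]
  by_cases h : ∃ u ∈ S, u ∈ I.forced
  · simp [hN S h, h]
  · rw [potential_simulate y hS h]
    simp [h]

/-- The moats that have run out of potential. -/
noncomputable def deadMoats (I : PrizeInstance n) (s : MoatState n) : List (Finset (Fin n)) :=
  (components I.graph (boughtSet s.bought).val).val.filter fun S =>
    (Timed.test (I.root ∉ S)).val && !(hasForced I S).val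
      && (Timed.test ((potential I s.dual S).val ≤ 0)).val

theorem markDead_val (s : MoatState n) : (markDead I s).val =
    { s with
      mark := fun v => if ((Timed.anyList (deadMoats I s) fun S => Timed.test (v ∈ S)).val &&
        (Timed.test (I.IsTerminal v ∧ s.mark v = none)).val) then some s.time else s.mark v } := rfl

theorem eventually_markDead_simulate (hF : I.forced ⊆ I.alive) (s : MoatState n)
    (hs : ∀ e ∈ s.bought, e.1 ∈ I.alive) :
    ∀ᶠ N in atTop, (markDead (I.simulate N) s).val = (markDead I s).val := by
  filter_upwards [eventually_lt_potential_simulate hF s.dual 0, I.eventually_suffices]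
    with N hN hN'
  have hB : (boughtSet s.bought).val ⊆ I.alive := by
    intro v hv
    obtain ⟨e, he, rfl⟩ := (mem_boughtSet _ _).1 hv
    exact hs e he
  have : deadMoats (I.simulate N) s = deadMoats I s := by
    refine List.filter_congr fun S hS => ?_
    have hSA : S ⊆ I.alive := (components_subset hS).trans hB
    have hroot : (I.simulate N).root = I.root := rfl
    rw [hasForced_simulate, hasForced_val, hroot]
    by_cases h : ∃ u ∈ S, u ∈ I.forced
    · simp [h, hN S h]
    · rw [potential_simulate s.dual hSA h]
      simp [h]
  simp only [markDead_val, this, isTerminal_simulate hF hN']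

/-- The active moats of a state. -/
noncomputable def activeMoats (I : PrizeInstance n) (s : MoatState n) : List (Finset (Fin n)) :=
  (components I.graph (boughtSet s.bought).val).val.filter fun S => (isActive I s.dual S).val

/-- Rate at which the load of a vertex grows. -/
noncomputable def growthRate (I : PrizeInstance n) (s : MoatState n) (v : Fin n) : ℝ :=
  ((activeMoats I s).map fun S => if (inBoundary I.graph S v).val then (1 : ℝ) else 0).sum

/-- Time until a vertex goes tight. -/
noncomputable def timeToTight (I : PrizeInstance n) (s : MoatState n) (v : Fin n) : ℝ :=
  (I.redCost v - (load I s.dual v).val) / growthRate I s v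

/-- The vertices that may go tight next. -/
noncomputable def growing (I : PrizeInstance n) (s : MoatState n) : List (Fin n) :=
  (List.finRange n).filter fun v =>
    (Timed.test (v ∈ I.alive ∧ v ∉ (boughtSet s.bought).val)).val &&
      (activeMoats I s).any fun S => (inBoundary I.graph S v).val

noncomputable def nextTight (I : PrizeInstance n) (s : MoatState n) : Option (Fin n × ℝ) :=
  ((growing I s).argmin (timeToTight I s)).map fun v => (v, timeToTight I s v)

noncomputable def nextDead (I : PrizeInstance n) (s : MoatState n) : Option ℝ :=
  (((activeMoats I s).filter fun S => !(hasForced I S).val).argmin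
    fun S => (potential I s.dual S).val).map fun S => (potential I s.dual S).val

/-- An event is determined by the active moats, the next vertex to go tight and the next moat to
die. To compare two instances it therefore suffices to compare these, and then the resulting
updates. -/
theorem moatStep_val (s : MoatState n) :
    (moatStep I s).val = match nextTight I s, nextDead I s with
      | none, none => s
      | some (v, Δ), none => (advance I s (activeMoats I s) Δ (some v)).val
      | none, some Δ => (advance I s (activeMoats I s) Δ none).val
      | some (v, Δ), some Δ' =>
        if Δ ≤ Δ' then (advance I s (activeMoats I s) Δ (some v)).val
        else (advance I s (activeMoats I s) Δ' none).val := by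
  have h1 : ((growing I s).map fun v => (v, timeToTight I s v)).argmin Prod.snd =
      nextTight I s := by
    rw [List.argmin_map]; rfl
  have h2 : (((activeMoats I s).filter fun S => !(hasForced I S).val).map
      fun S => ((), (potential I s.dual S).val)).argmin Prod.snd =
      (nextDead I s).map fun x => ((), x) := by
    rw [List.argmin_map, nextDead, Option.map_map]; rfl
  have h3 : (moatStep I s).val =
      (match ((growing I s).map fun v => (v, timeToTight I s v)).argmin Prod.snd,
        (((activeMoats I s).filter fun S => !(hasForced I S).val).map
      fun S => ((), (potential I s.dual S).val)).argmin Prod.snd with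
      | none, none => pure s
      | some (v, Δ), none => advance I s (activeMoats I s) Δ (some v)
      | none, some (_, Δ) => advance I s (activeMoats I s) Δ none
      | some (v, Δ), some (_, Δ') => do
        let vertexFirst ← Timed.test (Δ ≤ Δ')
        if vertexFirst then advance I s (activeMoats I s) Δ (some v)
          else advance I s (activeMoats I s) Δ' none : Timed (MoatState n)).val := rfl
  rw [h3, h1, h2]
  cases nextTight I s with
  | none => cases nextDead I s <;> rfl
  | some a =>
    cases nextDead I s with
    | none => rfl
    | some b =>
      simp only [Option.map_some, Timed.val_bind, Timed.val_test, decide_eq_true_eq]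
      split_ifs <;> rfl

theorem inBoundary_val (G : SimpleGraph (Fin n)) (S : Finset (Fin n)) (v : Fin n) :
    (inBoundary G S v).val = decide ((∃ u ∈ S, G.Adj u v) ∧ v ∉ S) := by
  simp [inBoundary]

theorem growthRate_pos {s : MoatState n} {v : Fin n}
    (h : ((activeMoats I s).any fun S => (inBoundary I.graph S v).val) = true) :
    0 < growthRate I s v := by
  obtain ⟨S, hS, hv⟩ := List.any_eq_true.1 h
  refine lt_of_lt_of_le one_pos ?_
  have hnn : ∀ x ∈ (activeMoats I s).map
      fun S => if (inBoundary I.graph S v).val then (1 : ℝ) else 0, 0 ≤ x := by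
    intro x hx
    obtain ⟨S, -, rfl⟩ := List.mem_map.1 hx
    split_ifs <;> norm_num
  exact List.single_le_sum hnn 1 (List.mem_map.2 ⟨S, hS, by simp [hv]⟩)

/-- If the alive vertices are connected, an active moat can always grow. -/
theorem growing_ne_nil (hA : IsRootedConnected I.graph I.root I.alive) {s : MoatState n}
    (hs : ∀ e ∈ s.bought, e.1 ∈ I.alive) (h : activeMoats I s ≠ []) : growing I s ≠ [] := by
  obtain ⟨S, hS⟩ := List.exists_mem_of_ne_nil _ h
  have hS' := List.mem_filter.1 hS
  obtain ⟨v, hv, hSv⟩ := mem_components hS'.1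
  have hvS : v ∈ S := (hSv v).2 .refl
  have hroot : I.root ∉ S := by
    have := hS'.2
    simp only [isActive, Timed.val_bind, Timed.val_test, Timed.val_pure, Bool.and_eq_true,
      decide_eq_true_eq] at this
    exact this.1
  have hvA : v ∈ I.alive := by
    obtain ⟨e, he, rfl⟩ := (mem_boughtSet _ _).1 hv
    exact hs e he
  obtain ⟨a, b, ha, haA, hbA, hbS, hab⟩ :=
    hA.exists_adj (S := Sᶜ) (by simpa using hroot) hvA (by simpa using hvS)
  have haS : a ∉ S := by simpa using ha
  have hbS : b ∈ S := by simpa using hbS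
  refine List.ne_nil_of_mem (a := a) (List.mem_filter.2 ⟨List.mem_finRange a, ?_⟩)
  simp only [Bool.and_eq_true, Timed.val_test, decide_eq_true_eq, List.any_eq_true]
  -- If the neighbour `a` of `S` were bought, it would belong to the component `S`.
  refine ⟨⟨haA, fun haB => haS ((hSv a).2 (((hSv b).1 hbS).tail ⟨hab.symm, haB⟩))⟩, S, hS, ?_⟩
  rw [inBoundary_val, decide_eq_true_eq]
  exact ⟨⟨b, hbS, hab.symm⟩, haS⟩

theorem markDead_bought (s : MoatState n) : (markDead I s).val.bought = s.bought := rfl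

theorem eventually_advance_simulate (hF : I.forced ⊆ I.alive) (s : MoatState n)
    (hs : ∀ e ∈ s.bought, e.1 ∈ I.alive) (active : List (Finset (Fin n))) (Δ : ℝ)
    (buy : Option (Fin n)) (hb : ∀ v ∈ buy, v ∈ I.alive) :
    ∀ᶠ N in atTop,
      (advance (I.simulate N) s active Δ buy).val = (advance I s active Δ buy).val := by
  refine eventually_markDead_simulate hF _ ?_
  cases buy with
  | none => exact hs
  | some v =>
    intro e he
    rcases List.mem_cons.1 he with rfl | he
    · exact hb v rfl
    · exact hs e he

theorem advance_bought (s : MoatState n) (hs : ∀ e ∈ s.bought, e.1 ∈ I.alive)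
    (active : List (Finset (Fin n))) (Δ : ℝ) (buy : Option (Fin n))
    (hb : ∀ v ∈ buy, v ∈ I.alive) : ∀ e ∈ (advance I s active Δ buy).val.bought, e.1 ∈ I.alive := by
  cases buy with
  | none => exact hs
  | some v =>
    intro e he
    rcases List.mem_cons.1 he with rfl | he
    · exact hb v rfl
    · exact hs e he

theorem nextTight_alive {s : MoatState n} {v : Fin n} {Δ : ℝ} (h : nextTight I s = some (v, Δ)) :
    v ∈ I.alive := by
  obtain ⟨u, hu, he⟩ := Option.map_eq_some_iff.1 h
  have := List.mem_filter.1 (List.argmin_mem hu)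
  obtain ⟨rfl, -⟩ := Prod.mk.inj he
  simp only [Bool.and_eq_true, Timed.val_test, decide_eq_true_eq] at this
  exact this.2.1.1

theorem moatStep_bought (s : MoatState n) (hs : ∀ e ∈ s.bought, e.1 ∈ I.alive) :
    ∀ e ∈ (moatStep I s).val.bought, e.1 ∈ I.alive := by
  rw [moatStep_val]
  cases h1 : nextTight I s with
  | none =>
    cases nextDead I s with
    | none => exact hs
    | some Δ => exact advance_bought s hs _ _ _ (by simp)
  | some a =>
    obtain ⟨v, Δ⟩ := a
    have hv := nextTight_alive h1
    cases nextDead I s with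
    | none => exact advance_bought s hs _ _ _ (by simpa using hv)
    | some Δ' =>
      dsimp only
      split_ifs
      · exact advance_bought s hs _ _ _ (by simpa using hv)
      · exact advance_bought s hs _ _ _ (by simp)

/-- For large `N`, the events that exist only in the simulation, namely deleted vertices going tight
and moats with a forced vertex dying, occur later than a bound `C` on all true times. They are never
the next event, because by `growing_ne_nil` some true vertex goes tight by time `C` whenever a moat
is active. This is where connectedness of the alive vertices is needed. -/
theorem eventually_moatStep_simulate (hF : I.forced ⊆ I.alive)
    (hA : IsRootedConnected I.graph I.root I.alive) (s : MoatState n)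
    (hs : ∀ e ∈ s.bought, e.1 ∈ I.alive) :
    ∀ᶠ N in atTop, (moatStep (I.simulate N) s).val = (moatStep I s).val := by
  -- a number above all times and potentials that occur
  obtain ⟨C, hC1, hC2⟩ : ∃ C : ℝ, (∀ v, timeToTight I s v ≤ C) ∧
      ∀ S : Finset (Fin n), (potential I s.dual S).val ≤ C := by
    refine ⟨∑ v, |timeToTight I s v| + ∑ S : Finset (Fin n), |(potential I s.dual S).val|,
      fun v => ?_, fun S => ?_⟩
    · have h1 := Finset.single_le_sum (f := fun v => |timeToTight I s v|)
        (fun v _ => abs_nonneg _) (Finset.mem_univ v)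
      have h2 : 0 ≤ ∑ S : Finset (Fin n), |(potential I s.dual S).val| :=
        Finset.sum_nonneg fun _ _ => abs_nonneg _
      have := le_abs_self (timeToTight I s v)
      linarith
    · have h1 := Finset.single_le_sum (f := fun S : Finset (Fin n) => |(potential I s.dual S).val|)
        (fun v _ => abs_nonneg _) (Finset.mem_univ S)
      have h2 : 0 ≤ ∑ v, |timeToTight I s v| := Finset.sum_nonneg fun _ _ => abs_nonneg _
      have := le_abs_self (potential I s.dual S).val
      linarith
  have hB : (boughtSet s.bought).val ⊆ I.alive := by
    intro v hv
    obtain ⟨e, he, rfl⟩ := (mem_boughtSet _ _).1 hv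
    exact hs e he
  have hslack : ∀ᶠ N in atTop, ∀ v, 0 < growthRate I s v →
      C < (N - (load I s.dual v).val) / growthRate I s v := by
    rw [eventually_all]
    intro v
    filter_upwards [eventually_gt_atTop (C * growthRate I s v + (load I s.dual v).val)]
      with N hN hr
    rw [lt_div_iff₀ hr]
    linarith
  have hadvT : ∀ᶠ N in atTop, ∀ v Δ, nextTight I s = some (v, Δ) →
      (advance (I.simulate N) s (activeMoats I s) Δ (some v)).val =
        (advance I s (activeMoats I s) Δ (some v)).val := by
    cases h : nextTight I s with
    | none => exact Eventually.of_forall fun N v Δ h => by simp at h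
    | some a =>
      obtain ⟨v, Δ⟩ := a
      filter_upwards [eventually_advance_simulate hF s hs (activeMoats I s) Δ (some v)
        (by simpa using nextTight_alive h)] with N hN v' Δ' h'
      obtain ⟨rfl, rfl⟩ := Prod.mk.inj (Option.some.inj h')
      exact hN
  have hadvD : ∀ᶠ N in atTop, ∀ Δ, nextDead I s = some Δ →
      (advance (I.simulate N) s (activeMoats I s) Δ none).val =
        (advance I s (activeMoats I s) Δ none).val := by
    cases h : nextDead I s with
    | none => exact Eventually.of_forall fun N Δ h => by simp at h
    | some Δ =>
      filter_upwards [eventually_advance_simulate hF s hs (activeMoats I s) Δ none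
        (by simp)] with N hN Δ' h'
      obtain rfl := Option.some.inj h'
      exact hN
  filter_upwards [I.eventually_suffices, eventually_isActive_simulate hF s.dual, hslack, hadvT,
    hadvD, eventually_lt_potential_simulate hF s.dual C] with N hN hact hslack hadvT hadvD hpot
  have hsub : ∀ S ∈ activeMoats I s, S ⊆ I.alive := fun S hS =>
    (components_subset (List.mem_filter.1 hS).1).trans hB
  have hactive : activeMoats (I.simulate N) s = activeMoats I s :=
    List.filter_congr fun S hS => hact S ((components_subset hS).trans hB)
  have hrate : ∀ v, growthRate (I.simulate N) s v = growthRate I s v := by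
    intro v
    simp only [growthRate, hactive]
    rfl
  have htime : ∀ v ∈ I.alive, timeToTight (I.simulate N) s v = timeToTight I s v := by
    intro v hv
    simp only [timeToTight, hrate, redCost_simulate hN hv]
    rfl
  have hgrow : growing I s = (growing (I.simulate N) s).filter fun v => decide (v ∈ I.alive) := by
    simp only [growing, List.filter_filter, hactive]
    refine List.filter_congr fun v _ => ?_
    have : (I.simulate N).graph = I.graph := rfl
    have h2 : v ∈ (I.simulate N).alive := Finset.mem_univ v
    rw [this]
    simp [h2, Bool.and_assoc]
  have htime' : ∀ v ∈ growing (I.simulate N) s, v ∉ I.alive →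
      C < timeToTight (I.simulate N) s v := by
    intro v hv hvA
    have hv' := (List.mem_filter.1 hv).2
    rw [Bool.and_eq_true, hactive] at hv'
    have := hslack v (growthRate_pos hv'.2)
    simp only [timeToTight, hrate, redCost_simulate_of_notMem hF hN hvA]
    exact this
  rw [moatStep_val, moatStep_val, hactive]
  by_cases hnil : activeMoats I s = []
  · have e1 : nextTight I s = none := by simp [nextTight, growing, hnil]
    have e2 : nextDead I s = none := by simp [nextDead, hnil]
    have e3 : nextTight (I.simulate N) s = none := by simp [nextTight, growing, hactive, hnil]
    have e4 : nextDead (I.simulate N) s = none := by simp [nextDead, hactive, hnil]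
    rw [e1, e2, e3, e4]
  have hgne := growing_ne_nil hA hs hnil
  obtain ⟨v, hv⟩ : ∃ v, (growing I s).argmin (timeToTight I s) = some v := by
    cases h : (growing I s).argmin (timeToTight I s) with
    | none => exact absurd (List.argmin_eq_none.1 h) hgne
    | some v => exact ⟨v, rfl⟩
  have hvA : v ∈ I.alive := by
    have := List.argmin_mem hv
    rw [hgrow] at this
    simpa using (List.mem_filter.1 this).2
  have hT : nextTight I s = some (v, timeToTight I s v) := by rw [nextTight, hv]; rfl
  have hT' : nextTight (I.simulate N) s = some (v, timeToTight I s v) := by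
    have : (growing (I.simulate N) s).argmin (timeToTight (I.simulate N) s) = some v := by
      refine List.argmin_eq_of_filter (p := fun v => decide (v ∈ I.alive)) ?_ ?_
      · intro a ha hpa b hb hpb
        have hpa : a ∈ I.alive := by simpa using hpa
        have hpb : b ∉ I.alive := by simpa using hpb
        rw [htime a hpa]
        exact (hC1 a).trans_lt (htime' b hb hpb)
      · rw [← hgrow, ← hv]
        refine List.argmin_congr fun a ha => htime a ?_
        rw [hgrow] at ha
        simpa using (List.mem_filter.1 ha).2
    rw [nextTight, this, Option.map_some, htime v hvA]
  have hmort : ((activeMoats I s).filter fun S => !(hasForced (I.simulate N) S).val) =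
      activeMoats I s := by
    rw [List.filter_eq_self]
    intro S _
    rw [hasForced_simulate]; rfl
  have hpoteq : ∀ S ∈ (activeMoats I s).filter fun S => !(hasForced I S).val,
      (potential (I.simulate N) s.dual S).val = (potential I s.dual S).val := by
    intro S hS
    obtain ⟨h1, h2⟩ := List.mem_filter.1 hS
    refine potential_simulate s.dual (hsub S h1) ?_
    simpa [hasForced_val] using h2
  rw [hT, hT']
  cases hD : nextDead I s with
  | some Δ' =>
    obtain ⟨S, hS, hSΔ⟩ := Option.map_eq_some_iff.1 hD
    have hD' : nextDead (I.simulate N) s = some Δ' := by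
      have : (activeMoats I s).argmin (fun S => (potential (I.simulate N) s.dual S).val) =
          some S := by
        refine List.argmin_eq_of_filter (p := fun S => !(hasForced I S).val) ?_ ?_
        · intro a ha hpa b hb hpb
          rw [hpoteq a (List.mem_filter.2 ⟨ha, hpa⟩)]
          refine (hC2 a).trans_lt (hpot b ?_)
          simpa [hasForced_val] using hpb
        · rw [← hS]
          exact List.argmin_congr hpoteq
      rw [nextDead, hactive, hmort, this, Option.map_some, hpoteq S (List.argmin_mem hS), hSΔ]
    rw [hD']
    dsimp only
    rw [hadvT _ _ hT, hadvD _ hD]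
  | none =>
    have hnone : ((activeMoats I s).filter fun S => !(hasForced I S).val) = [] := by
      rw [nextDead, Option.map_eq_none_iff, List.argmin_eq_none] at hD
      exact hD
    -- Here all active moats have infinite potential. Their simulated counterparts do die, but only
    -- later than `C`, so the vertex event still comes first.
    cases hD' : nextDead (I.simulate N) s with
    | none => exact hadvT _ _ hT
    | some Δ' =>
      have hle : timeToTight I s v ≤ Δ' := by
        obtain ⟨S, hS, rfl⟩ := Option.map_eq_some_iff.1 hD'
        rw [hactive, hmort] at hS
        refine (hC1 v).trans (hpot S ?_).le
        have := List.filter_eq_nil_iff.1 hnone S (List.argmin_mem hS)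
        simpa [hasForced_val] using this
      dsimp only
      rw [if_pos hle]
      exact hadvT _ _ hT

theorem moatInit_bought (hr : I.root ∈ I.alive) :
    ∀ e ∈ (moatInit I).val.bought, e.1 ∈ I.alive := by
  intro e he
  simp only [moatInit, Timed.val_bind, Timed.val_filterList, Timed.val_mapList, Timed.val_test,
    Timed.val_op, markDead_bought, List.mem_map, List.mem_filter, decide_eq_true_eq] at he
  obtain ⟨v, ⟨-, hv⟩, rfl⟩ := he
  rcases hv with rfl | hv
  · exact hr
  · exact hv.1

theorem eventually_moatInit_simulate (hF : I.forced ⊆ I.alive) (hr : I.root ∈ I.alive) :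
    ∀ᶠ N in atTop, (moatInit (I.simulate N)).val = (moatInit I).val := by
  have h := eventually_markDead_simulate (I := I) hF
    { time := 0
      bought := ((List.finRange n).filter fun v =>
        (Timed.test (v = I.root ∨ I.IsTerminal v)).val).map fun v => (v, (0 : ℝ))
      dual := []
      mark := fun _ => none } (moatInit_bought (I := I) hr)
  filter_upwards [h, I.eventually_suffices] with N h hN
  have hroot : (I.simulate N).root = I.root := rfl
  simp only [moatInit, Timed.val_bind, Timed.val_filterList, Timed.val_mapList,
    Timed.val_op, Timed.val_tabulate, isTerminal_simulate hF hN, hroot]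
  exact h

theorem pruneStep_simulate (hF : I.forced ⊆ I.alive) {N : ℝ} (hN : I.Suffices N)
    (mark : Fin n → Option ℝ) (X : Finset (Fin n)) (e : Fin n × ℝ) :
    (pruneStep (I.simulate N) mark X e).val = (pruneStep I mark X e).val := by
  have hroot : (I.simulate N).root = I.root := rfl
  have hgraph : (I.simulate N).graph = I.graph := rfl
  simp only [pruneStep, Timed.val_bind, Timed.val_allVertices, Timed.val_test,
    isTerminal_simulate hF hN, hroot, hgraph]

/-- Each of the finitely many steps of the true run imposes a lower bound on `N`; beyond all of them
both runs pass through the same states. -/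
theorem eventually_moatGrowing_simulate (hF : I.forced ⊆ I.alive)
    (hA : IsRootedConnected I.graph I.root I.alive) :
    ∀ᶠ N in atTop, (moatGrowing (I.simulate N)).val = (moatGrowing I).val := by
  have key : ∀ m, (∀ e ∈ ((fun s => (moatStep I s).val)^[m] (moatInit I).val).bought,
        e.1 ∈ I.alive) ∧
      ∀ᶠ N in atTop, (fun s => (moatStep (I.simulate N) s).val)^[m] (moatInit (I.simulate N)).val =
        (fun s => (moatStep I s).val)^[m] (moatInit I).val := by
    intro m
    induction m with
    | zero => exact ⟨moatInit_bought hA.1, eventually_moatInit_simulate hF hA.1⟩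
    | succ m ih =>
      refine ⟨?_, ?_⟩
      · rw [Function.iterate_succ_apply']
        exact moatStep_bought _ ih.1
      · filter_upwards [ih.2, eventually_moatStep_simulate hF hA _ ih.1] with N h1 h2
        rw [Function.iterate_succ_apply', Function.iterate_succ_apply', h1, h2]
  filter_upwards [(key (2 * n)).2, I.eventually_suffices] with N h hN
  simp only [moatGrowing, Timed.val_bind, Timed.val_iterate, Timed.val_foldList, h,
    pruneStep_simulate hF hN]

/-- A Lagrangian multiplier preserving algorithm on a class with a nonempty graph has ratio at
least one. -/
theorem HasLMPRatio.one_le {𝒢 : ∀ n : ℕ, Set (SimpleGraph (Fin n))} {r : ℝ}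
    (h : HasLMPRatio 𝒢 r) {G : SimpleGraph (Fin n)} (hG : G ∈ 𝒢 n) (root : Fin n) : 1 ≤ r := by
  -- For unit costs and zero penalties, comparing the output with itself gives `|T| ≤ r |T|`.
  obtain ⟨h1, h2⟩ := h n G hG (fun _ => 1) (fun _ => 0) root (fun _ => zero_le_one) fun _ => le_rfl
  have h3 := h2 _ h1
  simp only [Finset.sum_const_zero, mul_zero, add_zero, Finset.sum_const, nsmul_eq_mul,
    mul_one] at h3
  have hpos : (0 : ℝ) < (prizeCollecting G (fun _ => 1) (fun _ => 0) root).val.card := by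
    exact_mod_cast Finset.card_pos.2 ⟨root, h1.1⟩
  by_contra hr
  push Not at hr
  nlinarith

/-- The guarantee of the moat-growing algorithm carries over to instances with dead and forced
vertices. -/
theorem HasLMPRatio.moatGrowing {𝒢 : ∀ n : ℕ, Set (SimpleGraph (Fin n))} {r : ℝ}
    (h : HasLMPRatio 𝒢 r) (hG : I.graph ∈ 𝒢 n) (hc : ∀ v, 0 ≤ I.cost v)
    (hp : ∀ v, 0 ≤ I.penalty v) (hF : I.forced ⊆ I.alive)
    (hA : IsRootedConnected I.graph I.root I.alive) :
    IsRootedConnected I.graph I.root (moatGrowing I).val ∧ I.forced ⊆ (moatGrowing I).val ∧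
      (moatGrowing I).val ⊆ I.alive ∧
      ∀ X, IsRootedConnected I.graph I.root X → I.forced ⊆ X → X ⊆ I.alive →
        ∑ v ∈ (moatGrowing I).val, I.cost v + r * ∑ v ∈ I.alive \ (moatGrowing I).val, I.penalty v ≤
          r * (∑ v ∈ X, I.cost v + ∑ v ∈ I.alive \ X, I.penalty v) := by
  have hr := h.one_le hG I.root
  -- Besides simulating the run, `N` exceeds `r` times the cost of all alive vertices. These form a
  -- solution without penalty, so the output can afford neither to contain a deleted vertex nor to
  -- omit a forced one.
  obtain ⟨N, hN, hN1, hN2⟩ := ((eventually_moatGrowing_simulate hF hA).and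
    (I.eventually_suffices.and (eventually_gt_atTop (r * ∑ v ∈ I.alive, I.cost v)))).exists
  have hsumA : 0 ≤ ∑ v ∈ I.alive, I.cost v := Finset.sum_nonneg fun v _ => hc v
  have hc' : ∀ v, 0 ≤ (I.simulate N).cost v := by
    intro v; simp only [simulate]; split_ifs; exacts [hc v, hN1.1.le]
  have hp' : ∀ v, 0 ≤ (I.simulate N).penalty v := by
    intro v; simp only [simulate]; split_ifs; exacts [hN1.1.le, hp v, le_rfl]
  obtain ⟨h1, h2⟩ := h n I.graph hG (I.simulate N).cost (I.simulate N).penalty I.root hc' hp'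
  change IsRootedConnected I.graph I.root (_root_.moatGrowing (I.simulate N)).val at h1
  change ∀ X, IsRootedConnected I.graph I.root X →
    ∑ v ∈ (_root_.moatGrowing (I.simulate N)).val, _ +
      r * ∑ v ∈ (_root_.moatGrowing (I.simulate N)).valᶜ, _ ≤ _ at h2
  rw [hN] at h1 h2
  set T := (_root_.moatGrowing I).val with hT
  have hcost : ∀ X ⊆ I.alive, ∑ v ∈ X, (I.simulate N).cost v = ∑ v ∈ X, I.cost v :=
    fun X hX => Finset.sum_congr rfl fun v hv => if_pos (hX hv)
  have hpen : ∀ X, I.forced ⊆ X →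
      ∑ v ∈ Xᶜ, (I.simulate N).penalty v = ∑ v ∈ I.alive \ X, I.penalty v := by
    intro X hX
    rw [← Finset.sum_filter_add_sum_filter_not Xᶜ (fun v => v ∈ I.alive)]
    have e1 : ∑ v ∈ Xᶜ with v ∉ I.alive, (I.simulate N).penalty v = 0 := by
      refine Finset.sum_eq_zero fun v hv => ?_
      obtain ⟨h3, h4⟩ := Finset.mem_filter.1 hv
      have : v ∉ I.forced := fun h5 => h4 (hF h5)
      simp [simulate, this, h4]
    rw [e1, add_zero]
    have e2 : (Xᶜ.filter fun v => v ∈ I.alive) = I.alive \ X := by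
      ext v; simp [and_comm]
    rw [e2]
    refine Finset.sum_congr rfl fun v hv => ?_
    obtain ⟨h3, h4⟩ := Finset.mem_sdiff.1 hv
    have : v ∉ I.forced := fun h5 => h4 (hX h5)
    simp [simulate, this, h3]
  have hall := h2 I.alive hA
  rw [hcost _ le_rfl, hpen _ hF, Finset.sdiff_self, Finset.sum_empty, add_zero] at hall
  have hT0 : 0 ≤ ∑ v ∈ T, (I.simulate N).cost v := Finset.sum_nonneg fun v _ => hc' v
  have hP0 : 0 ≤ ∑ v ∈ Tᶜ, (I.simulate N).penalty v := Finset.sum_nonneg fun v _ => hp' v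
  have hP1 : ∑ v ∈ Tᶜ, (I.simulate N).penalty v ≤ r * ∑ v ∈ Tᶜ, (I.simulate N).penalty v := by
    nlinarith
  have hTA : T ⊆ I.alive := by
    intro v hv
    by_contra hvA
    have := Finset.single_le_sum (fun v _ => hc' v) hv
    simp only [simulate, if_neg hvA] at this
    simp only [simulate] at hall hP0 hP1
    linarith
  have hFT : I.forced ⊆ T := by
    intro v hv
    by_contra hvT
    have := Finset.single_le_sum (fun v _ => hp' v) (Finset.mem_compl.2 hvT)
    simp only [simulate, if_pos hv] at this
    simp only [simulate] at hall hP1 hT0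
    linarith
  refine ⟨h1, hFT, hTA, fun X hX hFX hXA => ?_⟩
  have := h2 X hX
  rwa [hcost _ hTA, hcost _ hXA, hpen _ hFT, hpen _ hFX] at this

end

/-! ### Cheapest walks, and the existence of a small skeleton. -/

section

variable {n : ℕ}

/-- `P` is a walk with `i` edges from `v` to `U`, and `d` is its weight without the last vertex. -/
inductive WalkTo (G : SimpleGraph (Fin n)) (cost : Fin n → ℝ) (U : Finset (Fin n)) :
    ℕ → Fin n → List (Fin n) → ℝ → Prop
  | base {v : Fin n} (h : v ∈ U) : WalkTo G cost U 0 v [v] 0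
  | step {v u : Fin n} {i : ℕ} {P : List (Fin n)} {d : ℝ} (h : G.Adj v u)
      (hw : WalkTo G cost U i u P d) : WalkTo G cost U (i + 1) v (v :: P) (cost v + d)

namespace WalkTo

variable {G : SimpleGraph (Fin n)} {cost : Fin n → ℝ} {U U' : Finset (Fin n)} {i : ℕ} {v : Fin n}
  {P : List (Fin n)} {d : ℝ}

theorem mono (hU : U ⊆ U') (h : WalkTo G cost U i v P d) : WalkTo G cost U' i v P d := by
  induction h with
  | base h => exact .base (hU h)
  | step h _ ih => exact .step h ih

theorem nonneg (hc : ∀ v, 0 ≤ cost v) (h : WalkTo G cost U i v P d) : 0 ≤ d := by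
  induction h with
  | base => exact le_rfl
  | step _ _ ih => exact add_nonneg (hc _) ih

theorem head_mem (h : WalkTo G cost U i v P d) : v ∈ P := by
  cases h <;> simp

theorem length_eq (h : WalkTo G cost U i v P d) : P.length = i + 1 := by
  induction h with
  | base => rfl
  | step _ _ ih => simp [ih]

/-- Each vertex of a walk inherits the rest of the walk, which is no longer and no heavier. Hence
the walks that witness nearness stay among near vertices. -/
theorem suffix (hc : ∀ v, 0 ≤ cost v) (h : WalkTo G cost U i v P d) {w : Fin n} (hw : w ∈ P) :
    ∃ j P' d', j ≤ i ∧ d' ≤ d ∧ WalkTo G cost U j w P' d' := by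
  induction h with
  | base h =>
    obtain rfl := List.mem_singleton.1 hw
    exact ⟨0, _, _, le_rfl, le_rfl, .base h⟩
  | @step v u i P d h hP ih =>
    rcases List.mem_cons.1 hw with rfl | hw
    · exact ⟨_, _, _, le_rfl, le_rfl, .step h hP⟩
    · obtain ⟨j, P', d', h1, h2, h3⟩ := ih hw
      exact ⟨j, P', d', by omega, by linarith [hc v], h3⟩

/-- If `U` is linked to the root in a set that contains the walk, then so is the whole walk. -/
theorem linkedIn (h : WalkTo G cost U i v P d) {F : Finset (Fin n)} {root : Fin n}
    (hU : ∀ u ∈ U, LinkedIn G.Adj F root u) (hP : ∀ w ∈ P, w ∈ F) :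
    ∀ w ∈ P, LinkedIn G.Adj F root w := by
  induction h with
  | base h =>
    intro w hw
    obtain rfl := List.mem_singleton.1 hw
    exact hU _ h
  | @step v u i P d h hw ih =>
    have ih' := ih fun w hw => hP w (List.mem_cons_of_mem _ hw)
    intro w hwP
    rcases List.mem_cons.1 hwP with rfl | hwP
    · exact (ih' u hw.head_mem).tail ⟨h.symm, hP w List.mem_cons_self⟩
    · exact ih' w hwP

/-- The last vertex lies in `U` and is already paid for in `Y`; this is why the weight `d` does not
count it. -/
theorem sum_sdiff_le (hc : ∀ v, 0 ≤ cost v) (h : WalkTo G cost U i v P d) {Y : Finset (Fin n)}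
    (hY : U ⊆ Y) : ∑ w ∈ P.toFinset \ Y, cost w ≤ d := by
  induction h with
  | @base v h =>
    have : ([v] : List (Fin n)).toFinset \ Y = ∅ := by
      rw [Finset.sdiff_eq_empty_iff_subset]
      intro w hw
      simp only [List.mem_toFinset, List.mem_singleton] at hw
      exact hw ▸ hY h
    rw [this, Finset.sum_empty]
  | @step v u i P d h hw ih =>
    have : (v :: P).toFinset \ Y ⊆ insert v (P.toFinset \ Y) := by
      intro w hw
      simp only [List.toFinset_cons, Finset.mem_sdiff, Finset.mem_insert] at hw ⊢
      tauto
    refine (Finset.sum_le_sum_of_subset_of_nonneg this fun w _ _ => hc w).trans ?_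
    refine le_trans ?_ (add_le_add_right ih (cost v))
    by_cases hv : v ∈ P.toFinset \ Y
    · rw [Finset.insert_eq_of_mem hv]
      linarith [hc v]
    · rw [Finset.sum_insert hv]

end WalkTo

theorem pathsTo_val (G : SimpleGraph (Fin n)) (cost : Fin n → ℝ) (U : Finset (Fin n)) :
    (pathsTo G cost U).val =
      (fun (lab : Fin n → Option (List (Fin n) × ℝ)) v =>
        ((lab v).toList ++ ((List.finRange n).filter fun u =>
          (Timed.test (G.Adj v u ∧ lab u ≠ none)).val).map fun u =>
            match lab u with
            | none => ([], 0)
            | some (P, d) => (v :: P, cost v + d)).argmin Prod.snd)^[n]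
        (fun v => if v ∈ U then some ([v], (0 : ℝ)) else none) := by
  simp only [pathsTo, Timed.val_bind, Timed.val_iterate, Timed.val_tabulate, Timed.val_filterList,
    Timed.val_mapList, Timed.val_op, Timed.val_minList]

/-- Bellman-Ford: after `k` rounds the labels are walks with at most `k` edges, and no such walk is
lighter than the label of its first vertex. The limit of `n` edges is harmless, as the walks to the
skeleton have fewer than `|X|` edges. -/
theorem pathsTo_spec (G : SimpleGraph (Fin n)) (cost : Fin n → ℝ) (U : Finset (Fin n)) :
    (∀ v P d, (pathsTo G cost U).val v = some (P, d) → ∃ i ≤ n, WalkTo G cost U i v P d) ∧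
    ∀ i v P d, i ≤ n → WalkTo G cost U i v P d →
      ∃ P' d', (pathsTo G cost U).val v = some (P', d') ∧ d' ≤ d := by
  rw [pathsTo_val]
  generalize n = m at *
  have key : ∀ (k : ℕ) (lab : Fin m → Option (List (Fin m) × ℝ)),
      lab = (fun (lab : Fin m → Option (List (Fin m) × ℝ)) v =>
        ((lab v).toList ++ ((List.finRange m).filter fun u =>
          (Timed.test (G.Adj v u ∧ lab u ≠ none)).val).map fun u =>
            match lab u with
            | none => ([], 0)
            | some (P, d) => (v :: P, cost v + d)).argmin Prod.snd)^[k]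
        (fun v => if v ∈ U then some ([v], (0 : ℝ)) else none) →
      (∀ v P d, lab v = some (P, d) → ∃ i ≤ k, WalkTo G cost U i v P d) ∧
      ∀ i v P d, i ≤ k → WalkTo G cost U i v P d → ∃ P' d', lab v = some (P', d') ∧ d' ≤ d := by
    intro k
    induction k with
    | zero =>
      rintro lab rfl
      simp only [Function.iterate_zero, id_eq]
      refine ⟨fun v P d h => ?_, fun i v P d hi h => ?_⟩
      · split_ifs at h with hv
        obtain ⟨rfl, rfl⟩ := Prod.mk.inj (Option.some.inj h)
        exact ⟨0, le_rfl, .base hv⟩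
      · cases h with
        | base h => exact ⟨[v], 0, by simp [h], le_rfl⟩
        | step => omega
    | succ k ih =>
      intro lab hlab
      rw [Function.iterate_succ_apply'] at hlab
      obtain ⟨ih1, ih2⟩ := ih _ rfl
      set old := (fun (lab : Fin m → Option (List (Fin m) × ℝ)) v =>
        ((lab v).toList ++ ((List.finRange m).filter fun u =>
          (Timed.test (G.Adj v u ∧ lab u ≠ none)).val).map fun u =>
            match lab u with
            | none => ([], 0)
            | some (P, d) => (v :: P, cost v + d)).argmin Prod.snd)^[k]
        (fun v => if v ∈ U then some ([v], (0 : ℝ)) else none) with hold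
      have hmem : ∀ v x, x ∈ ((old v).toList ++ ((List.finRange m).filter fun u =>
          (Timed.test (G.Adj v u ∧ old u ≠ none)).val).map fun u =>
            match old u with
            | none => ([], 0)
            | some (P, d) => (v :: P, cost v + d)) ↔
          old v = some x ∨ ∃ u P d, G.Adj v u ∧ old u = some (P, d) ∧ x = (v :: P, cost v + d) := by
        intro v x
        rw [List.mem_append, Option.mem_toList, List.mem_map]
        refine or_congr Iff.rfl ⟨?_, ?_⟩
        · rintro ⟨u, hu, rfl⟩
          have := (List.mem_filter.1 hu).2
          simp only [Timed.val_test, decide_eq_true_eq] at this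
          obtain ⟨⟨P, d⟩, h⟩ := Option.ne_none_iff_exists'.1 this.2
          exact ⟨u, P, d, this.1, h, by rw [h]⟩
        · rintro ⟨u, P, d, h1, h2, rfl⟩
          refine ⟨u, List.mem_filter.2 ⟨List.mem_finRange u, ?_⟩, by rw [h2]⟩
          simp [h1, h2]
      have hge : ∀ v x, (old v = some x ∨
          ∃ u P d, G.Adj v u ∧ old u = some (P, d) ∧ x = (v :: P, cost v + d)) →
          ∃ P' d', lab v = some (P', d') ∧ d' ≤ x.2 := by
        intro v x hx
        have hx' := (hmem v x).2 hx
        have hl : lab v = _ := congrFun hlab v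
        cases h : lab v with
        | none =>
          rw [h] at hl
          have := List.argmin_eq_none.1 hl.symm
          rw [this] at hx'
          simp at hx'
        | some y =>
          refine ⟨y.1, y.2, rfl, ?_⟩
          rw [h] at hl
          exact List.le_of_mem_argmin (f := Prod.snd) hx' hl.symm
      refine ⟨fun v P d h => ?_, fun i v P d hi h => ?_⟩
      · rw [hlab] at h
        rcases (hmem v (P, d)).1 (List.argmin_mem h) with h | ⟨u, P', d', hu, hP', he⟩
        · obtain ⟨i, hi, hw⟩ := ih1 v P d h
          exact ⟨i, by omega, hw⟩
        · obtain ⟨rfl, rfl⟩ := Prod.mk.inj he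
          obtain ⟨i, hi, hw⟩ := ih1 u P' d' hP'
          exact ⟨i + 1, by omega, .step hu hw⟩
      · cases h with
        | base h =>
          obtain ⟨P', d', h1, h2⟩ := ih2 0 v _ _ (Nat.zero_le _) (.base h)
          obtain ⟨P'', d'', h3, h4⟩ := hge v _ (Or.inl h1)
          exact ⟨P'', d'', h3, h4.trans h2⟩
        | @step _ u i P d h hw =>
          obtain ⟨P', d', h1, h2⟩ := ih2 i u _ _ (by omega) hw
          obtain ⟨P'', d'', h3, h4⟩ := hge v _ (Or.inr ⟨u, P', d', h, h1, rfl⟩)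
          exact ⟨P'', d'', h3, h4.trans (by simpa using h2)⟩
  exact key m _ rfl

theorem isRootedConnected_singleton (G : SimpleGraph (Fin n)) (root : Fin n) :
    IsRootedConnected G root {root} := by
  rw [isRootedConnected_iff]
  refine ⟨Finset.mem_singleton_self _, fun v hv => ?_⟩
  obtain rfl := Finset.mem_singleton.1 hv
  exact .refl

theorem IsRootedConnected.insert {G : SimpleGraph (Fin n)} {root : Fin n} {X : Finset (Fin n)}
    (h : IsRootedConnected G root X) {a b : Fin n} (ha : a ∈ X) (hab : G.Adj a b) :
    IsRootedConnected G root (insert b X) := by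
  rw [isRootedConnected_iff] at h ⊢
  refine ⟨Finset.mem_insert_of_mem h.1, fun v hv => ?_⟩
  have hX : ∀ v ∈ X, LinkedIn G.Adj (Insert.insert b X) root v := fun v hv =>
    (h.2 v hv).mono (fun _ _ hr _ => hr) (Finset.subset_insert _ _)
  rcases Finset.mem_insert.1 hv with rfl | hv
  · exact (hX a ha).tail ⟨hab, Finset.mem_insert_self _ _⟩
  · exact hX v hv

/-- A rooted connected set with more than one vertex has a vertex that can be removed. -/
theorem IsRootedConnected.exists_erase {G : SimpleGraph (Fin n)} {root : Fin n}
    {X : Finset (Fin n)} (h : IsRootedConnected G root X) (hX : X ≠ {root}) :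
    ∃ S v p, v ∉ S ∧ p ∈ S ∧ X = Insert.insert v S ∧ G.Adj v p ∧ IsRootedConnected G root S := by
  have hss : ({root} : Finset (Fin n)) ⊂ X :=
    (Finset.singleton_subset_iff.2 h.1).ssubset_of_ne (Ne.symm hX)
  -- A maximal proper rooted connected subset misses exactly one vertex, since a crossing edge
  -- allows it to be enlarged.
  obtain ⟨S, hS, hmax⟩ := Finset.exists_max_image
    (Finset.univ.filter fun S => IsRootedConnected G root S ∧ S ⊂ X) Finset.card
    ⟨{root}, by simp [isRootedConnected_singleton, hss]⟩
  simp only [Finset.mem_filter, Finset.mem_univ, true_and] at hS hmax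
  obtain ⟨v, hvX, hvS⟩ := Finset.exists_of_ssubset hS.2
  obtain ⟨a, b, haS, -, hbX, hbS, hab⟩ := h.exists_adj hS.1.1 hvX hvS
  refine ⟨S, b, a, hbS, haS, ?_, hab.symm, hS.1⟩
  by_contra hne
  have hsub : Insert.insert b S ⊆ X := Finset.insert_subset hbX hS.2.subset
  have := hmax (Insert.insert b S) ⟨hS.1.insert haS hab, hsub.ssubset_of_ne (Ne.symm hne)⟩
  rw [Finset.card_insert_of_notMem hbS] at this
  omega

/-- Every rooted connected set `X` contains a small skeleton `W` such that all vertices of `X` are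
close to the root or the skeleton. The heights `h` stand for parts of `X` that have already
been removed. -/
theorem exists_skeleton_of_heights (G : SimpleGraph (Fin n)) (root : Fin n) (cost : Fin n → ℝ)
    (hc : ∀ v, 0 ≤ cost v) (D : ℝ) (m : ℕ) :
    ∀ (X : Finset (Fin n)) (h : Fin n → ℝ), X.card = m → IsRootedConnected G root X →
      (∀ v, 0 ≤ h v) → (∀ v, h v ≤ D) →
      ∃ W ⊆ X, D * W.card ≤ ∑ v ∈ X, (cost v + h v) ∧
        (∑ v ∈ X, (cost v + h v) = 0 → W = ∅) ∧
        ∀ v ∈ X, ∃ i P d, i < X.card ∧ WalkTo G cost (insert root W) i v P d ∧ d + h v ≤ D := by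
  induction m with
  | zero =>
    intro X h hm hX
    exact absurd hX.1 (by simp [Finset.card_eq_zero.1 hm])
  | succ m ih =>
    intro X h hm hX h0 hD
    have hsum0 : ∀ (X : Finset (Fin n)) (h : Fin n → ℝ), (∀ v, 0 ≤ h v) →
        0 ≤ ∑ v ∈ X, (cost v + h v) := fun X h h0 =>
      Finset.sum_nonneg fun v _ => add_nonneg (hc v) (h0 v)
    by_cases hne : X = {root}
    · refine ⟨∅, Finset.empty_subset _, by simpa using hsum0 X h h0, fun _ => rfl, fun v hv => ?_⟩
      refine ⟨0, [v], 0, Finset.card_pos.2 ⟨v, hv⟩, .base ?_, by simpa using hD v⟩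
      rw [hne, Finset.mem_singleton] at hv
      simp [hv]
    obtain ⟨S, v, p, hvS, hpS, rfl, hvp, hS⟩ := hX.exists_erase hne
    rw [Finset.card_insert_of_notMem hvS] at hm
    rw [Finset.sum_insert hvS, Finset.card_insert_of_notMem hvS]
    -- The height `h v` is the weight of the heaviest branch folded into `v` so far. If `cost v + h
    -- v` exceeds `D`, then `v` enters the skeleton and is paid for by this amount, which is not
    -- used again.
    by_cases hbig : D < cost v + h v
    · obtain ⟨W, hWS, hW, hW0, hwalk⟩ := ih S h (by omega) hS h0 hD
      have hsub : insert root W ⊆ insert root (insert v W) :=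
        Finset.insert_subset_insert _ (Finset.subset_insert _ _)
      refine ⟨insert v W, Finset.insert_subset_insert _ hWS, ?_, fun hz => ?_, fun w hw => ?_⟩
      · rw [Finset.card_insert_of_notMem fun hv => hvS (hWS hv)]
        push_cast
        linarith
      · have := (h0 v).trans (hD v)
        have := hsum0 S h h0
        linarith
      · rcases Finset.mem_insert.1 hw with rfl | hw
        · exact ⟨0, [w], 0, by omega, .base (by simp), by simpa using hD w⟩
        · obtain ⟨i, P, d, hi, hP, hd⟩ := hwalk w hw
          exact ⟨i, P, d, by omega, hP.mono hsub, hd⟩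
    · push Not at hbig
      -- Otherwise `v` is folded into its neighbour `p`. Taking the maximum of the branches suffices
      -- for distances, and as it is at most their sum, the total weight does not grow.
      set h' : Fin n → ℝ := Function.update h p (max (h p) (cost v + h v)) with hh'
      have hp' : h' p = max (h p) (cost v + h v) := by simp [hh']
      have hq' : ∀ w, w ≠ p → h' w = h w := fun w hw => by simp [hh', hw]
      have h0' : ∀ v, 0 ≤ h' v := by
        intro w
        by_cases hw : w = p
        · subst hw; rw [hp']; exact (h0 w).trans (le_max_left _ _)
        · rw [hq' w hw]; exact h0 w
      have hle : ∀ w, h w ≤ h' w := by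
        intro w
        by_cases hw : w = p
        · subst hw; rw [hp']; exact le_max_left _ _
        · rw [hq' w hw]
      have hsum : ∑ w ∈ S, (cost w + h' w) ≤ cost v + h v + ∑ w ∈ S, (cost w + h w) := by
        rw [← Finset.add_sum_erase _ _ hpS, ← Finset.add_sum_erase S (fun w => cost w + h w) hpS]
        have : ∑ w ∈ S.erase p, (cost w + h' w) = ∑ w ∈ S.erase p, (cost w + h w) :=
          Finset.sum_congr rfl fun w hw => by rw [hq' w (Finset.ne_of_mem_erase hw)]
        rw [this, hp']
        have : max (h p) (cost v + h v) ≤ h p + (cost v + h v) :=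
          max_le (by linarith [hc v, h0 v]) (by linarith [h0 p])
        linarith
      obtain ⟨W, hWS, hW, hW0, hwalk⟩ := ih S h' (by omega) hS h0' (by
        intro w
        by_cases hw : w = p
        · subst hw; rw [hp']; exact max_le (hD w) hbig
        · rw [hq' w hw]; exact hD w)
      refine ⟨W, hWS.trans (Finset.subset_insert _ _), hW.trans hsum, fun hz => hW0 ?_,
        fun w hw => ?_⟩
      · exact le_antisymm (hsum.trans hz.le) (hsum0 S h' h0')
      · rcases Finset.mem_insert.1 hw with rfl | hw
        -- The walk of `p` is prolonged by `w`. Its slack covers `h' p ≥ cost w + h w`, which is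
        -- exactly what the extension needs.
        · obtain ⟨i, P, d, hi, hP, hd⟩ := hwalk p hpS
          refine ⟨i + 1, _, _, by omega, .step hvp hP, ?_⟩
          rw [hp'] at hd
          have := le_max_right (h p) (cost w + h w)
          linarith
        · obtain ⟨i, P, d, hi, hP, hd⟩ := hwalk w hw
          exact ⟨i, P, d, by omega, hP, by linarith [hle w]⟩

/-- The clause for total cost zero matters because `D` may be zero, and then the inequality does not
bound the size of `W`. -/
theorem IsRootedConnected.exists_skeleton {G : SimpleGraph (Fin n)} {root : Fin n}
    {X : Finset (Fin n)} (hX : IsRootedConnected G root X) {cost : Fin n → ℝ}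
    (hc : ∀ v, 0 ≤ cost v) {D : ℝ} (hD : 0 ≤ D) :
    ∃ W ⊆ X, D * W.card ≤ ∑ v ∈ X, cost v ∧ (∑ v ∈ X, cost v = 0 → W = ∅) ∧
      ∀ v ∈ X, ∃ i P d, i ≤ n ∧ WalkTo G cost (Insert.insert root W) i v P d ∧ d ≤ D := by
  obtain ⟨W, h1, h2, h3, h4⟩ := exists_skeleton_of_heights G root cost hc D X.card X (fun _ => 0)
    rfl hX (fun _ => le_rfl) fun _ => hD
  simp only [add_zero] at h2 h3 h4
  refine ⟨W, h1, h2, h3, fun v hv => ?_⟩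
  obtain ⟨i, P, d, hi, hP, hd⟩ := h4 v hv
  have := Finset.card_le_univ X
  rw [Fintype.card_fin] at this
  exact ⟨i, P, d, by omega, hP, hd⟩

end

/-! ### Trees as edge sets, and the spanning tree of a connected set. -/

section

variable {n : ℕ}

/-- `u` and `v` are the ends of an edge in `E`. -/
def EdgeJoined (E : Set (Fin n × Fin n)) (u v : Fin n) : Prop := (u, v) ∈ E ∨ (v, u) ∈ E

/-- `u` and `v` are in the same component of the edge set `E`. -/
def EdgeReach (E : Set (Fin n × Fin n)) : Fin n → Fin n → Prop := Relation.ReflTransGen (EdgeJoined E)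

/-- No edge of `E` lies on a cycle. -/
def EdgeAcyclic (E : Set (Fin n × Fin n)) : Prop := ∀ e ∈ E, ¬ EdgeReach (E \ {e}) e.1 e.2

/-- All edges of `E` have both ends in `V`. -/
def EdgesIn (E : Set (Fin n × Fin n)) (V : Finset (Fin n)) : Prop := ∀ e ∈ E, e.1 ∈ V ∧ e.2 ∈ V

theorem EdgeJoined.symm {E : Set (Fin n × Fin n)} {u v : Fin n} (h : EdgeJoined E u v) : EdgeJoined E v u :=
  Or.symm h

theorem EdgeJoined.mono {E E' : Set (Fin n × Fin n)} (hE : E ⊆ E') {u v : Fin n}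
    (h : EdgeJoined E u v) : EdgeJoined E' u v :=
  h.imp (fun h => hE h) fun h => hE h

theorem edgeJoined_of_mem {E : Set (Fin n × Fin n)} {e : Fin n × Fin n} (h : e ∈ E) :
    EdgeJoined E e.1 e.2 := Or.inl h

namespace EdgeReach

variable {E E' : Set (Fin n × Fin n)} {u v w : Fin n}

theorem refl (E : Set (Fin n × Fin n)) (u : Fin n) : EdgeReach E u u := Relation.ReflTransGen.refl

theorem trans (h : EdgeReach E u v) (h' : EdgeReach E v w) : EdgeReach E u w :=
  Relation.ReflTransGen.trans h h'

theorem symm (h : EdgeReach E u v) : EdgeReach E v u := by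
  induction h with
  | refl => exact .refl E _
  | tail _ h ih => exact .trans (Relation.ReflTransGen.single h.symm) ih

theorem of_joined (h : EdgeJoined E u v) : EdgeReach E u v := Relation.ReflTransGen.single h

theorem mono (hE : E ⊆ E') (h : EdgeReach E u v) : EdgeReach E' u v :=
  Relation.ReflTransGen.mono (fun _ _ h => EdgeJoined.mono hE h) _ _ h

/-- A property that is passed along edges is passed along walks. -/
theorem closed {P : Fin n → Prop} (hP : ∀ a b, EdgeJoined E a b → P a → P b) (h : EdgeReach E u v)
    (hu : P u) : P v := by
  induction h with
  | refl => exact hu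
  | tail _ h ih => exact hP _ _ h ih

/-- A walk that starts in a set closed under `E` only uses edges inside the set. -/
theorem restrict {X : Set (Fin n)} (hX : ∀ a b, EdgeJoined E a b → a ∈ X → b ∈ X)
    (hE : ∀ e ∈ E, e.1 ∈ X → e.2 ∈ X → e ∈ E') (h : EdgeReach E u v) (hu : u ∈ X) :
    EdgeReach E' u v := by
  have : v ∈ X ∧ EdgeReach E' u v := by
    refine closed (P := fun v => v ∈ X ∧ EdgeReach E' u v) ?_ h ⟨hu, .refl _ _⟩
    rintro a b hab ⟨ha, hr⟩
    have hb := hX a b hab ha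
    refine ⟨hb, hr.trans (of_joined ?_)⟩
    rcases hab with hab | hab
    · exact Or.inl (hE _ hab ha hb)
    · exact Or.inr (hE _ hab hb ha)
  exact this.2

theorem mem {V : Finset (Fin n)} (hV : EdgesIn E V) (h : EdgeReach E u v) (hu : u ∈ V) :
    v ∈ V :=
  closed (P := fun v => v ∈ V) (fun a b hab _ => by
    rcases hab with hab | hab
    · exact (hV _ hab).2
    · exact (hV _ hab).1) h hu

end EdgeReach

theorem EdgeAcyclic.mono {E E' : Set (Fin n × Fin n)} (hE : E ⊆ E') (h : EdgeAcyclic E') :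
    EdgeAcyclic E :=
  fun e he hr => h e (hE he) (hr.mono (Set.sdiff_subset_sdiff_left hE))

/-- Hanging a new vertex on an acyclic edge set. -/
theorem EdgeAcyclic.insert {E : Set (Fin n × Fin n)} (h : EdgeAcyclic E) {e : Fin n × Fin n}
    (hne : e.1 ≠ e.2) (he : ∀ f ∈ E, f.1 ≠ e.2 ∧ f.2 ≠ e.2) : EdgeAcyclic (Insert.insert e E) := by
  have hiso : ∀ (F : Set (Fin n × Fin n)), F ⊆ E → ∀ u, EdgeReach F e.2 u → u = e.2 := by
    intro F hF u hu
    refine EdgeReach.closed (P := fun u => u = e.2) ?_ hu rfl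
    rintro a b (hab | hab) rfl
    · exact absurd rfl (he _ (hF hab)).1
    · exact absurd rfl (he _ (hF hab)).2
  intro f hf hr
  by_cases hfe : f = e
  · subst hfe
    have hsub : Insert.insert f E \ {f} ⊆ E := by
      rintro g ⟨hg, hgf⟩
      exact hg.resolve_left hgf
    exact hne (hiso _ hsub _ hr.symm)
  · have hfE : f ∈ E := hf.resolve_left hfe
    obtain ⟨h1, h2⟩ := he f hfE
    -- replace the new vertex by its neighbour
    have key : ∀ u, EdgeReach (Insert.insert e E \ {f}) f.1 u →
        EdgeReach (E \ {f}) f.1 (if u = e.2 then e.1 else u) := by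
      intro u hu
      refine EdgeReach.closed
        (P := fun u => EdgeReach (E \ {f}) f.1 (if u = e.2 then e.1 else u)) ?_ hu ?_
      · intro a b hab ha
        have hcase : ∀ a b, (a, b) ∈ Insert.insert e E \ {f} →
            EdgeReach (E \ {f}) (if a = e.2 then e.1 else a) (if b = e.2 then e.1 else b) := by
          rintro a b ⟨hab | hab, habf⟩
          · subst hab
            simp only [hne, if_false, if_true]
            exact .refl _ _
          · rw [if_neg (he _ hab).1, if_neg (he _ hab).2]
            exact .of_joined (Or.inl ⟨hab, habf⟩)
        rcases hab with hab | hab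
        · exact ha.trans (hcase a b hab)
        · exact ha.trans (hcase b a hab).symm
      · rw [if_neg h1]; exact .refl _ _
    have := key f.2 hr
    rw [if_neg h2] at this
    exact h f hfE this

@[simp] theorem edgeAdj_val (E : List (Fin n × Fin n)) (u v : Fin n) :
    (edgeAdj E u v).val = true ↔ EdgeJoined {e | e ∈ E} u v := by
  simp only [edgeAdj, Timed.val_anyList, Timed.val_test, List.any_eq_true, decide_eq_true_eq,
    EdgeJoined, Set.mem_ofPred_eq]
  constructor
  · rintro ⟨e, he, rfl | rfl⟩
    exacts [Or.inl he, Or.inr he]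
  · rintro (h | h)
    exacts [⟨_, h, Or.inl rfl⟩, ⟨_, h, Or.inr rfl⟩]

theorem mem_reach_edgeAdj {E : List (Fin n × Fin n)} {V : Finset (Fin n)}
    (hE : EdgesIn {e | e ∈ E} V) {x : Fin n} (hx : x ∈ V) (u : Fin n) :
    u ∈ (reach (edgeAdj E) V x).val ↔ EdgeReach {e | e ∈ E} x u := by
  rw [mem_reach]
  simp only [edgeAdj_val, hx, true_and]
  constructor
  · intro h
    exact Relation.ReflTransGen.mono (fun _ _ h => h.1) _ _ h
  · intro h
    refine Relation.ReflTransGen.mono (fun a b h => ⟨h, ?_⟩) _ _ h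
    rcases h with h | h
    · exact (hE _ h).2
    · exact (hE _ h).1

/-- What `spanningTree` guarantees if `B` is connected. -/
structure IsSpanningTree (r : Fin n → Fin n → Prop) (B : Finset (Fin n))
    (E : List (Fin n × Fin n)) : Prop where
  nodup : E.Nodup
  edgesIn : EdgesIn {e | e ∈ E} B
  adj : ∀ e ∈ E, r e.1 e.2
  acyclic : EdgeAcyclic {e | e ∈ E}
  conn : ∀ u ∈ B, ∀ v ∈ B, EdgeReach {e | e ∈ E} u v

/-- One round of `spanningTree`. -/
noncomputable def growTree (adj : Fin n → Fin n → Timed Bool) (B : Finset (Fin n))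
    (s : Finset (Fin n) × List (Fin n × Fin n)) : Timed (Finset (Fin n) × List (Fin n × Fin n)) := do
  let new ← Timed.filterList ((List.finRange n).product (List.finRange n)) fun e => do
    let a ← adj e.1 e.2
    let b ← Timed.test (e.1 ∈ s.1 ∧ e.2 ∈ B ∧ e.2 ∉ s.1)
    return a && b
  match new.head? with
  | none => pure s
  | some e => Timed.op (insert e.2 s.1, e :: s.2)

theorem spanningTree_val (adj : Fin n → Fin n → Timed Bool) (B : Finset (Fin n)) (root : Fin n) :
    (spanningTree adj B root).val = ((fun s => (growTree adj B s).val)^[n] ({root}, [])).2 := by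
  have h : (Timed.vertexSet fun v => Timed.test (v = root)).val = {root} := by
    ext v; simp
  have : (spanningTree adj B root).val = ((Timed.iterate n (growTree adj B)
      ((Timed.vertexSet fun v => Timed.test (v = root)).val, [])).val).2 := rfl
  rw [this, Timed.val_iterate, h]

theorem growTree_cases (adj : Fin n → Fin n → Timed Bool) (B : Finset (Fin n))
    (s : Finset (Fin n) × List (Fin n × Fin n)) :
    ((growTree adj B s).val = s ∧
      ∀ a b, (adj a b).val = true → a ∈ s.1 → b ∈ B → b ∈ s.1) ∨
    ∃ e : Fin n × Fin n, (adj e.1 e.2).val = true ∧ e.1 ∈ s.1 ∧ e.2 ∈ B ∧ e.2 ∉ s.1 ∧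
      (growTree adj B s).val = (insert e.2 s.1, e :: s.2) := by
  set new := ((List.finRange n).product (List.finRange n)).filter fun e =>
    (adj e.1 e.2).val && (Timed.test (e.1 ∈ s.1 ∧ e.2 ∈ B ∧ e.2 ∉ s.1)).val with hnew
  have hval : (growTree adj B s).val = (match new.head? with
    | none => pure s
    | some e => Timed.op (insert e.2 s.1, e :: s.2) :
      Timed (Finset (Fin n) × List (Fin n × Fin n))).val := rfl
  have hmem : ∀ e, e ∈ new ↔ (adj e.1 e.2).val = true ∧ e.1 ∈ s.1 ∧ e.2 ∈ B ∧ e.2 ∉ s.1 := by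
    rintro ⟨a, b⟩
    simp only [hnew, List.mem_filter, Bool.and_eq_true, Timed.val_test, decide_eq_true_eq]
    have : (a, b) ∈ (List.finRange n).product (List.finRange n) :=
      List.mem_product.2 ⟨List.mem_finRange a, List.mem_finRange b⟩
    simp only [this, true_and]
  cases h : new with
  | nil =>
    left
    refine ⟨by rw [hval, h]; rfl, fun a b hab ha hb => ?_⟩
    by_contra hbs
    have := (hmem (a, b)).2 ⟨hab, ha, hb, hbs⟩
    rw [h] at this
    simp at this
  | cons e l =>
    right
    obtain ⟨h1, h2, h3, h4⟩ := (hmem e).1 (by rw [h]; exact List.mem_cons_self)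
    exact ⟨e, h1, h2, h3, h4, by rw [hval, h]; rfl⟩

/-- A round either hangs a new vertex on the tree, which preserves acyclicity by
`EdgeAcyclic.insert`, or finds the vertex set closed under adjacency in `B`. As `n + 1` vertices are
impossible, the set is closed after `n` rounds and therefore contains `B`. -/
theorem spanningTree_spec (adj : Fin n → Fin n → Timed Bool) (B : Finset (Fin n)) (root : Fin n)
    (hroot : root ∈ B) (hconn : ∀ v ∈ B, LinkedIn (fun a b => (adj a b).val = true) B root v) :
    IsSpanningTree (fun a b => (adj a b).val = true) B (spanningTree adj B root).val := by
  rw [spanningTree_val]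
  have key : ∀ m, let s := (fun s => (growTree adj B s).val)^[m] ({root}, [])
      (root ∈ s.1 ∧ s.1 ⊆ B ∧ s.2.Nodup ∧ EdgesIn {e | e ∈ s.2} s.1 ∧
        (∀ e ∈ s.2, (adj e.1 e.2).val = true) ∧ EdgeAcyclic {e | e ∈ s.2} ∧
        ∀ v ∈ s.1, EdgeReach {e | e ∈ s.2} root v) ∧
      (m + 1 ≤ s.1.card ∨ ∀ a b, (adj a b).val = true → a ∈ s.1 → b ∈ B → b ∈ s.1) := by
    intro m
    induction m with
    | zero =>
      dsimp only [Function.iterate_zero, id_eq]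
      refine ⟨⟨by simp, by simpa using hroot, List.nodup_nil, ?_, ?_, ?_, ?_⟩, Or.inl (by simp)⟩
      · intro e he; simp at he
      · intro e he; simp at he
      · intro e he; simp at he
      · intro v hv
        rw [Finset.mem_singleton] at hv
        subst hv
        exact .refl _ _
    | succ m ih =>
      dsimp only at ih ⊢
      rw [Function.iterate_succ_apply']
      set s := (fun s => (growTree adj B s).val)^[m] ({root}, []) with hs
      obtain ⟨⟨h1, h2, h3, h4, h5, h6, h7⟩, h8⟩ := ih
      rcases growTree_cases adj B s with ⟨hfix, hcl⟩ | ⟨e, he1, he2, he3, he4, heq⟩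
      · rw [hfix]
        exact ⟨⟨h1, h2, h3, h4, h5, h6, h7⟩, Or.inr hcl⟩
      · rw [heq]
        dsimp only
        have hset : {f | f ∈ e :: s.2} = Insert.insert e {f | f ∈ s.2} := by
          ext f; simp
        rw [hset]
        refine ⟨⟨Finset.mem_insert_of_mem h1, Finset.insert_subset he3 h2, ?_, ?_, ?_, ?_, ?_⟩, ?_⟩
        · exact List.nodup_cons.2 ⟨fun he => he4 (h4 e he).2, h3⟩
        · rintro f (rfl | hf)
          · exact ⟨Finset.mem_insert_of_mem he2, Finset.mem_insert_self _ _⟩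
          · exact ⟨Finset.mem_insert_of_mem (h4 f hf).1, Finset.mem_insert_of_mem (h4 f hf).2⟩
        · intro f hf
          rcases List.mem_cons.1 hf with rfl | hf
          exacts [he1, h5 f hf]
        · refine h6.insert (fun h => he4 (h ▸ he2)) fun f hf => ⟨fun h => ?_, fun h => ?_⟩
          · exact he4 (h ▸ (h4 f hf).1)
          · exact he4 (h ▸ (h4 f hf).2)
        · intro v hv
          rcases Finset.mem_insert.1 hv with rfl | hv
          · exact ((h7 _ he2).mono (Set.subset_insert _ _)).trans
              (.of_joined (edgeJoined_of_mem (Set.mem_insert _ _)))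
          · exact (h7 v hv).mono (Set.subset_insert _ _)
        · rcases h8 with h8 | h8
          · left
            rw [Finset.card_insert_of_notMem he4]
            omega
          · exact absurd (h8 _ _ he1 he2 he3) he4
  obtain ⟨⟨h1, h2, h3, h4, h5, h6, h7⟩, h8⟩ := key n
  set s := (fun s => (growTree adj B s).val)^[n] ({root}, []) with hs
  have hcl := h8.resolve_left (by
    have := Finset.card_le_univ s.1
    rw [Fintype.card_fin] at this
    omega)
  have hall : ∀ v ∈ B, v ∈ s.1 := by
    intro v hv
    have := hconn v hv
    clear hv
    induction this with
    | refl => exact h1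
    | tail _ hbc ih => exact hcl _ _ hbc.1 ih hbc.2
  refine ⟨h3, fun e he => ⟨h2 (h4 e he).1, h2 (h4 e he).2⟩, h5, h6, fun u hu v hv => ?_⟩
  exact (h7 u (hall u hu)).symm.trans (h7 v (hall v hv))

end

/-! ### The contraction phase and its invariant. -/

section

variable {n : ℕ}

namespace PickData

variable (D : PickData n)

/-- Cardinality of a set, not counting the contracted vertex. -/
def size (X : Finset (Fin n)) : ℕ := (X.erase D.root).card

/-- Cost of a set, not counting the contracted vertex. -/
def weight (X : Finset (Fin n)) : ℝ := ∑ v ∈ X.erase D.root, D.cost v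

/-- Cost-effectiveness. -/
def Effective (X : Finset (Fin n)) : Prop := D.weight X * D.totalSize ≤ D.totalCost * D.size X

variable {D}

theorem size_union {X Y : Finset (Fin n)} (h : Disjoint X Y) :
    D.size (X ∪ Y) = D.size X + D.size Y := by
  rw [size, Finset.erase_union_distrib, Finset.card_union_of_disjoint]
  · rfl
  · exact h.mono (Finset.erase_subset _ _) (Finset.erase_subset _ _)

theorem weight_union {X Y : Finset (Fin n)} (h : Disjoint X Y) :
    D.weight (X ∪ Y) = D.weight X + D.weight Y := by
  rw [weight, Finset.erase_union_distrib, Finset.sum_union]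
  · rfl
  · exact h.mono (Finset.erase_subset _ _) (Finset.erase_subset _ _)

theorem size_mono {X Y : Finset (Fin n)} (h : X ⊆ Y) : D.size X ≤ D.size Y :=
  Finset.card_le_card (Finset.erase_subset_erase _ h)

theorem size_singleton_le (x : Fin n) : D.size {x} ≤ 1 :=
  (Finset.card_le_card (Finset.erase_subset _ _)).trans (by simp)

/-- Of two sets whose union is cost-effective, one is cost-effective. -/
theorem Effective.or {X Y : Finset (Fin n)} (h : Disjoint X Y) (hXY : D.Effective (X ∪ Y)) :
    D.Effective X ∨ D.Effective Y := by
  by_contra hne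
  simp only [Effective, not_or, not_le] at hne
  rw [Effective, size_union h, weight_union h] at hXY
  push_cast at hXY
  nlinarith [hne.1, hne.2]

end PickData

@[simp] theorem superSize_val (D : PickData n) (X : Finset (Fin n)) :
    (superSize D X).val = D.size X := by
  simp only [superSize, Timed.val_bind, Timed.val_card, PickData.size]
  congr 1
  ext v
  simp [and_comm]

@[simp] theorem costEffective_val (D : PickData n) (X : Finset (Fin n)) :
    (costEffective D X).val = decide (D.Effective X) := by
  have : ∑ v, (if v ∈ X ∧ v ≠ D.root then D.cost v else 0) = D.weight X := by
    rw [← Finset.sum_filter, PickData.weight]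
    congr 1
    ext v
    simp [and_comm]
  simp only [costEffective, Timed.val_bind, superSize_val, Timed.val_sumVertices, Timed.val_op,
    Timed.val_test, this]
  rfl

@[simp] theorem mem_edgesInside (X : Finset (Fin n)) (E : List (Fin n × Fin n))
    (e : Fin n × Fin n) : e ∈ (edgesInside X E).val ↔ e ∈ E ∧ e.1 ∈ X ∧ e.2 ∈ X := by
  simp [edgesInside]

@[simp] theorem mem_edgesNotInside (X : Finset (Fin n)) (E : List (Fin n × Fin n))
    (e : Fin n × Fin n) : e ∈ (edgesNotInside X E).val ↔ e ∈ E ∧ ¬ (e.1 ∈ X ∧ e.2 ∈ X) := by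
  simp [edgesNotInside]
  tauto

theorem edgesInside_sublist (X : Finset (Fin n)) (E : List (Fin n × Fin n)) :
    (edgesInside X E).val.Sublist E := List.filter_sublist

theorem edgesNotInside_sublist (X : Finset (Fin n)) (E : List (Fin n × Fin n)) :
    (edgesNotInside X E).val.Sublist E := List.filter_sublist

theorem length_edgesInside_add (X : Finset (Fin n)) (E : List (Fin n × Fin n)) :
    (edgesInside X E).val.length + (edgesNotInside X E).val.length = E.length := by
  simp only [edgesInside, edgesNotInside, Timed.val_filterList, Timed.val_test]
  induction E with
  | nil => rfl
  | cons e E ih =>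
    by_cases h : e.1 ∈ X ∧ e.2 ∈ X
    · rw [List.filter_cons_of_pos (by simpa using h), List.filter_cons_of_neg
        (by simp only [decide_eq_true_eq, not_not]; exact h)]
      simp only [List.length_cons]
      omega
    · rw [List.filter_cons_of_neg (by simpa using h), List.filter_cons_of_pos
        (by simp only [decide_eq_true_eq]; exact h)]
      simp only [List.length_cons]
      omega

namespace ContractedTree

variable (H : ContractedTree n)

/-- All edges of the tree before contraction. -/
def all : Set (Fin n × Fin n) := {e | e ∈ H.edges ∨ e ∈ H.contracted}

/-- The edges that have been contracted. -/
def inner : Set (Fin n × Fin n) := {e | e ∈ H.contracted}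

/-- The node of the contracted tree that contains `x`. -/
noncomputable def node (x : Fin n) : Finset (Fin n) := Finset.univ.filter (EdgeReach H.inner x)

/-- `e` has an end in `X`. -/
def Touches (e : Fin n × Fin n) (X : Finset (Fin n)) : Prop := e.1 ∈ X ∨ e.2 ∈ X

/-- `X` is one of the two components that arise by removing the edge `e`. -/
structure IsSide (e : Fin n × Fin n) (X : Finset (Fin n)) : Prop where
  mem_edges : e ∈ H.edges
  subset : X ⊆ H.vertices
  closed : ∀ a b, EdgeJoined (H.all \ {e}) a b → a ∈ X → b ∈ X
  conn : ∀ a ∈ X, ∀ b ∈ X, EdgeReach (H.all \ {e}) a b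
  cross : ¬ (e.1 ∈ X ∧ e.2 ∈ X)
  touch : Touches e X

/-- The invariant of the contraction phase for the tree with edges `E` and the target `q`. -/
structure Valid (D : PickData n) (q : ℕ) (E : List (Fin n × Fin n)) : Prop where
  nodup : H.edges.Nodup
  sub : ∀ e ∈ H.all, e ∈ E
  disj : ∀ e ∈ H.edges, e ∉ H.contracted
  edgesIn : EdgesIn H.all H.vertices
  conn : ∀ u ∈ H.vertices, ∀ v ∈ H.vertices, EdgeReach H.all u v
  nonempty : H.vertices.Nonempty
  effective : D.Effective H.vertices
  large : q ≤ D.size H.vertices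
  nodes : ∀ x ∈ H.vertices, ∀ y ∈ H.node x, y ≠ x → D.Effective (H.node x) ∧
    D.size (H.node x) < q ∧
    ∀ e ∈ H.edges, ∀ f ∈ H.edges, Touches e (H.node x) → Touches f (H.node x) → e = f

/-- No side can be used for a further contraction or deletion. -/
def Stable (D : PickData n) (q : ℕ) : Prop := ∀ e X, H.IsSide e X → D.Effective X →
  D.size X < q ∧ ∀ f ∈ H.edges, ¬ (f.1 ∈ X ∧ f.2 ∈ X)

variable {H}

@[simp] theorem mem_node {x y : Fin n} : y ∈ H.node x ↔ EdgeReach H.inner x y := by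
  simp [node]

theorem self_mem_node (x : Fin n) : x ∈ H.node x := mem_node.2 (.refl _ _)

theorem node_eq_of_mem {x y : Fin n} (h : y ∈ H.node x) : H.node y = H.node x := by
  rw [mem_node] at h
  ext z
  rw [mem_node, mem_node]
  exact ⟨fun hz => h.trans hz, fun hz => h.symm.trans hz⟩

variable {D : PickData n} {q : ℕ} {E : List (Fin n × Fin n)}

theorem Valid.inner_subset (hH : H.Valid D q E) {e : Fin n × Fin n} (he : e ∈ H.edges) :
    H.inner ⊆ H.all \ {e} := by
  intro f hf
  exact ⟨Or.inr hf, fun h => hH.disj e he (h ▸ hf)⟩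

theorem Valid.all_acyclic (hH : H.Valid D q E) (hE : EdgeAcyclic {e | e ∈ E}) :
    EdgeAcyclic H.all :=
  hE.mono hH.sub

theorem Valid.node_subset (hH : H.Valid D q E) {x : Fin n} (hx : x ∈ H.vertices) :
    H.node x ⊆ H.vertices := by
  intro y hy
  exact (mem_node.1 hy).mem (fun e he => hH.edgesIn e (Or.inr he)) hx

/-- Together with contracted edges, such an edge would close a cycle. -/
theorem Valid.not_inside_node (hH : H.Valid D q E) (hE : EdgeAcyclic {e | e ∈ E})
    {e : Fin n × Fin n} (he : e ∈ H.edges) {x : Fin n} (h1 : e.1 ∈ H.node x)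
    (h2 : e.2 ∈ H.node x) : False :=
  hH.all_acyclic hE e (Or.inl he)
    (((mem_node.1 h1).symm.trans (mem_node.1 h2)).mono (hH.inner_subset he))

theorem mem_sideOf (hH : H.Valid D q E) {e : Fin n × Fin n} (he : e ∈ H.edges) {x : Fin n}
    (hx : x ∈ H.vertices) (u : Fin n) :
    u ∈ (sideOf H e x).val ↔ EdgeReach (H.all \ {e}) x u := by
  have hset : {f | f ∈ (H.edges.filter fun f => (Timed.test (f ≠ e)).val) ++ H.contracted} =
      H.all \ {e} := by
    ext f
    have := hH.disj e he
    simp only [Set.mem_ofPred_eq, List.mem_append, List.mem_filter, Timed.val_test,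
      decide_eq_true_eq, all, Set.mem_sdiff, Set.mem_singleton_iff]
    constructor
    · rintro (⟨h1, h2⟩ | h)
      · exact ⟨Or.inl h1, h2⟩
      · exact ⟨Or.inr h, fun h' => this (h' ▸ h)⟩
    · rintro ⟨h1 | h1, h2⟩
      · exact Or.inl ⟨h1, h2⟩
      · exact Or.inr h1
  have := mem_reach_edgeAdj (V := H.vertices)
    (E := (H.edges.filter fun f => (Timed.test (f ≠ e)).val) ++ H.contracted)
    (by rw [hset]; exact fun f hf => hH.edgesIn f hf.1) hx u
  rw [hset] at this
  exact this

theorem Valid.isSide (hH : H.Valid D q E) (hE : EdgeAcyclic {e | e ∈ E}) {e : Fin n × Fin n}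
    (he : e ∈ H.edges) {x : Fin n} (hx : x = e.1 ∨ x = e.2) :
    H.IsSide e (sideOf H e x).val := by
  have hV := hH.edgesIn e (Or.inl he)
  have hxV : x ∈ H.vertices := by rcases hx with rfl | rfl; exacts [hV.1, hV.2]
  have hac := hH.all_acyclic hE e (Or.inl he)
  refine ⟨he, fun u hu => ?_, fun a b hab ha => ?_, fun a ha b hb => ?_, fun hc => ?_, ?_⟩
  · rw [mem_sideOf hH he hxV] at hu
    exact hu.mem (fun f hf => hH.edgesIn f hf.1) hxV
  · rw [mem_sideOf hH he hxV] at ha ⊢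
    exact ha.trans (.of_joined hab)
  · rw [mem_sideOf hH he hxV] at ha hb
    exact ha.symm.trans hb
  · rw [mem_sideOf hH he hxV, mem_sideOf hH he hxV] at hc
    exact hac (hc.1.symm.trans hc.2)
  · rw [Touches, mem_sideOf hH he hxV, mem_sideOf hH he hxV]
    rcases hx with rfl | rfl
    · exact Or.inl (.refl _ _)
    · exact Or.inr (.refl _ _)

theorem IsSide.eq_sideOf (hH : H.Valid D q E) {e : Fin n × Fin n} {X : Finset (Fin n)}
    (hX : H.IsSide e X) {x : Fin n} (hxX : x ∈ X) : X = (sideOf H e x).val := by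
  ext u
  rw [mem_sideOf hH hX.mem_edges (hX.subset hxX)]
  exact ⟨fun hu => hX.conn x hxX u hu, fun hu => hu.closed hX.closed hxX⟩

/-- The complement of a side is a side. -/
theorem IsSide.compl (hH : H.Valid D q E) (hE : EdgeAcyclic {e | e ∈ E}) {e : Fin n × Fin n}
    {X : Finset (Fin n)} (hX : H.IsSide e X) : H.IsSide e (H.vertices \ X) := by
  have hV := hH.edgesIn e (Or.inl hX.mem_edges)
  obtain ⟨x, y, hxX, hyX, hy, hxy⟩ : ∃ x y, x ∈ X ∧ y ∉ X ∧ (y = e.1 ∨ y = e.2) ∧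
      ((x, y) = e ∨ (y, x) = e) := by
    rcases hX.touch with h | h
    · exact ⟨e.1, e.2, h, fun h' => hX.cross ⟨h, h'⟩, Or.inr rfl, Or.inl rfl⟩
    · exact ⟨e.2, e.1, h, fun h' => hX.cross ⟨h', h⟩, Or.inl rfl, Or.inr rfl⟩
  have hyV : y ∈ H.vertices := by rcases hy with rfl | rfl; exacts [hV.1, hV.2]
  have : H.vertices \ X = (sideOf H e y).val := by
    ext u
    rw [mem_sideOf hH hX.mem_edges hyV, Finset.mem_sdiff]
    constructor
    · rintro ⟨huV, huX⟩
      have h := hH.conn y hyV u huV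
      -- Follow a walk from `y` to `u`: steps along other edges preserve the alternative, and a step
      -- along `e` ends at `x ∈ X` or at `y`.
      have : u ∈ X ∨ EdgeReach (H.all \ {e}) y u := by
        refine h.closed (P := fun u => u ∈ X ∨ EdgeReach (H.all \ {e}) y u) ?_ (Or.inr (.refl _ _))
        intro a b hab ha
        by_cases hab' : EdgeJoined (H.all \ {e}) a b
        · rcases ha with ha | ha
          · exact Or.inl (hX.closed a b hab' ha)
          · exact Or.inr (ha.trans (.of_joined hab'))
        · have hb : b = x ∨ b = y := by
            rcases hab with hab | hab
            · have : (a, b) = e := by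
                by_contra hne; exact hab' (Or.inl ⟨hab, hne⟩)
              rw [← this] at hxy
              simp only [Prod.mk.injEq] at hxy
              rcases hxy with h | h
              exacts [Or.inr h.2.symm, Or.inl h.2.symm]
            · have : (b, a) = e := by
                by_contra hne; exact hab' (Or.inr ⟨hab, hne⟩)
              rw [← this] at hxy
              simp only [Prod.mk.injEq] at hxy
              rcases hxy with h | h
              exacts [Or.inl h.1.symm, Or.inr h.1.symm]
          rcases hb with rfl | rfl
          exacts [Or.inl hxX, Or.inr (.refl _ _)]
      exact this.resolve_left huX
    · intro hu
      refine ⟨hu.mem (fun f hf => hH.edgesIn f hf.1) hyV, fun huX => hyX ?_⟩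
      exact hu.symm.closed hX.closed huX
  rw [this]
  exact hH.isSide hE hX.mem_edges hy

/-- The tree as a whole is cost-effective and is the disjoint union of the two sides, which cannot
both be worse than average. -/
theorem Valid.exists_effective_side (hH : H.Valid D q E) (hE : EdgeAcyclic {e | e ∈ E})
    {e : Fin n × Fin n} (he : e ∈ H.edges) : ∃ X, H.IsSide e X ∧ D.Effective X := by
  have hX := hH.isSide hE he (Or.inl rfl)
  have hXc := hX.compl hH hE
  have := hH.effective
  rw [← Finset.union_sdiff_of_subset hX.subset] at this
  rcases this.or Finset.disjoint_sdiff with h | h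
  exacts [⟨_, hX, h⟩, ⟨_, hXc, h⟩]

/-- Deleting everything outside `X`. -/
noncomputable def restrict (H : ContractedTree n) (X : Finset (Fin n)) : ContractedTree n :=
  { vertices := X
    edges := (edgesInside X H.edges).val
    contracted := (edgesInside X H.contracted).val }

/-- Contracting `X` to a node. -/
noncomputable def contract (H : ContractedTree n) (X : Finset (Fin n)) : ContractedTree n :=
  { vertices := H.vertices
    edges := (edgesNotInside X H.edges).val
    contracted := (edgesInside X H.edges).val ++ H.contracted }

theorem IsSide.inner_closed (hH : H.Valid D q E) {e : Fin n × Fin n} {X : Finset (Fin n)}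
    (hX : H.IsSide e X) (a b : Fin n) (hab : EdgeJoined H.inner a b) (ha : a ∈ X) : b ∈ X :=
  hX.closed a b (hab.mono (hH.inner_subset hX.mem_edges)) ha

/-- A side is closed under contracted edges, so it contains each node entirely or not at all, and
the nodes inside survive unchanged. -/
theorem IsSide.restrict_valid (hH : H.Valid D q E) {e : Fin n × Fin n} {X : Finset (Fin n)}
    (hX : H.IsSide e X) (heff : D.Effective X) (hq : q ≤ D.size X) :
    (H.restrict X).Valid D q E := by
  have hnode : ∀ x ∈ X, (H.restrict X).node x = H.node x := by
    intro x hx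
    ext y
    rw [mem_node, mem_node]
    constructor
    · exact fun h => h.mono fun f hf => ((mem_edgesInside _ _ _).1 hf).1
    · intro h
      exact h.restrict (X := X) (hX.inner_closed hH)
        (fun f hf h1 h2 => (mem_edgesInside _ _ _).2 ⟨hf, h1, h2⟩) hx
  refine ⟨hH.nodup.sublist (edgesInside_sublist _ _), ?_, ?_, ?_, ?_, ?_, heff, hq, ?_⟩
  · rintro f (hf | hf)
    · exact hH.sub f (Or.inl ((mem_edgesInside _ _ _).1 hf).1)
    · exact hH.sub f (Or.inr ((mem_edgesInside _ _ _).1 hf).1)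
  · intro f hf hf'
    exact hH.disj f ((mem_edgesInside _ _ _).1 hf).1 ((mem_edgesInside _ _ _).1 hf').1
  · rintro f (hf | hf)
    · exact ((mem_edgesInside _ _ _).1 hf).2
    · exact ((mem_edgesInside _ _ _).1 hf).2
  · intro u hu v hv
    refine (hX.conn u hu v hv).restrict (X := X) hX.closed (fun f hf h1 h2 => ?_) hu
    rcases hf.1 with h | h
    · exact Or.inl ((mem_edgesInside _ _ _).2 ⟨h, h1, h2⟩)
    · exact Or.inr ((mem_edgesInside _ _ _).2 ⟨h, h1, h2⟩)
  · rcases hX.touch with h | h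
    exacts [⟨_, h⟩, ⟨_, h⟩]
  · intro x hx
    rw [hnode x hx]
    intro y hy hyx
    obtain ⟨h1, h2, h3⟩ := hH.nodes x (hX.subset hx) y hy hyx
    exact ⟨h1, h2, fun f hf g hg => h3 f ((mem_edgesInside _ _ _).1 hf).1 g
      ((mem_edgesInside _ _ _).1 hg).1⟩

theorem contract_all (H : ContractedTree n) (X : Finset (Fin n)) :
    (H.contract X).all = H.all := by
  ext f
  simp only [all, contract, Set.mem_ofPred_eq, mem_edgesNotInside, List.mem_append,
    mem_edgesInside]
  tauto

/-- All edges inside the side `X` become contracted, so `X` turns into a single node, and the only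
edge left at this node is `e`. This maintains the invariant that a node with more than one vertex
has at most one edge. Nodes outside `X` do not change. -/
theorem IsSide.contract_valid (hH : H.Valid D q E) {e : Fin n × Fin n} {X : Finset (Fin n)}
    (hX : H.IsSide e X) (heff : D.Effective X) (hq : D.size X < q) :
    (H.contract X).Valid D q E := by
  have hinner : ∀ f, f ∈ (H.contract X).inner ↔
      (f ∈ H.edges ∧ f.1 ∈ X ∧ f.2 ∈ X) ∨ f ∈ H.contracted := by
    intro f
    simp [inner, contract]
  have hsub : (H.contract X).inner ⊆ H.all \ {e} := by
    intro f hf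
    rcases (hinner f).1 hf with h | h
    · exact ⟨Or.inl h.1, fun h' => hX.cross (h' ▸ h.2)⟩
    · exact hH.inner_subset hX.mem_edges h
  have hnodeX : ∀ x ∈ X, (H.contract X).node x = X := by
    intro x hx
    ext y
    rw [mem_node]
    constructor
    · exact fun h => (h.mono hsub).closed hX.closed hx
    · intro hy
      refine (hX.conn x hx y hy).restrict (X := X) hX.closed (fun f hf h1 h2 => ?_) hx
      rw [hinner]
      rcases hf.1 with h | h
      exacts [Or.inl ⟨h, h1, h2⟩, Or.inr h]
  have hnode : ∀ x ∉ X, (H.contract X).node x = H.node x := by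
    intro x hx
    ext y
    rw [mem_node, mem_node]
    constructor
    · intro h
      refine h.restrict (X := {y | y ∉ X}) (fun a b hab ha hb => ha ?_) (fun f hf h1 h2 => ?_) hx
      · exact hX.closed b a (hab.symm.mono hsub) hb
      · rcases (hinner f).1 hf with h | h
        · exact absurd h.2.1 h1
        · exact h
    · exact fun h => h.mono fun f hf => (hinner f).2 (Or.inr hf)
  refine ⟨hH.nodup.sublist (edgesNotInside_sublist _ _), ?_, ?_, ?_, ?_, hH.nonempty, hH.effective,
    hH.large, ?_⟩
  · rw [contract_all]; exact hH.sub
  · intro f hf hf'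
    obtain ⟨h1, h2⟩ := (mem_edgesNotInside _ _ _).1 hf
    rcases (hinner f).1 hf' with h | h
    exacts [h2 h.2, hH.disj f h1 h]
  · rw [contract_all]; exact hH.edgesIn
  · rw [contract_all]; exact hH.conn
  · intro x hx
    by_cases hxX : x ∈ X
    · rw [hnodeX x hxX]
      intro y hy hyx
      have huniq : ∀ f ∈ (H.contract X).edges, Touches f X → f = e := by
        intro f hf ht
        obtain ⟨h1, h2⟩ := (mem_edgesNotInside _ _ _).1 hf
        by_contra hne
        have hj : EdgeJoined (H.all \ {e}) f.1 f.2 := Or.inl ⟨Or.inl h1, hne⟩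
        rcases ht with h | h
        · exact h2 ⟨h, hX.closed _ _ hj h⟩
        · exact h2 ⟨hX.closed _ _ hj.symm h, h⟩
      exact ⟨heff, hq, fun f hf g hg hft hgt => (huniq f hf hft).trans (huniq g hg hgt).symm⟩
    · rw [hnode x hxX]
      intro y hy hyx
      obtain ⟨h1, h2, h3⟩ := hH.nodes x hx y hy hyx
      exact ⟨h1, h2, fun f hf g hg => h3 f ((mem_edgesNotInside _ _ _).1 hf).1 g
        ((mem_edgesNotInside _ _ _).1 hg).1⟩

end ContractedTree

open ContractedTree

variable {D : PickData n} {q : ℕ} {E : List (Fin n × Fin n)} {H : ContractedTree n}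

/-- All sides of all edges are tried, so failure to find a suitable one is precisely stability.
Otherwise the number of uncontracted edges drops: a deletion loses the edge `e` that defines the
side, and a contraction absorbs an edge inside it. -/
theorem contractStep_cases (hH : H.Valid D q E) (hE : EdgeAcyclic {e | e ∈ E}) :
    ((contractStep D q H).val = H ∧ H.Stable D q) ∨
    ((contractStep D q H).val.Valid D q E ∧
      (contractStep D q H).val.edges.length < H.edges.length ∧
      (contractStep D q H).val.vertices ⊆ H.vertices) := by
  set good := ((H.edges.map fun e => (sideOf H e e.1).val) ++
    (H.edges.map fun e => (sideOf H e e.2).val)).filter fun X =>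
      (costEffective D X).val && ((Timed.test (q ≤ (superSize D X).val)).val ||
        (Timed.test ((edgesInside X H.edges).val ≠ [])).val) with hgood
  have hval : (contractStep D q H).val = (match good.head? with
    | none => pure H
    | some X => pure (if (Timed.test (q ≤ (superSize D X).val)).val then H.restrict X
      else H.contract X) : Timed (ContractedTree n)).val := by
    have : (contractStep D q H).val = (match good.head? with
      | none => pure H
      | some X => do
        let s ← superSize D X
        let large ← Timed.test (q ≤ s)
        let inner ← edgesInside X H.edges
        let contr ← edgesInside X H.contracted
        let outer ← edgesNotInside X H.edges
        return if large then { vertices := X, edges := inner, contracted := contr }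
          else { vertices := H.vertices, edges := outer, contracted := inner ++ H.contracted } :
        Timed (ContractedTree n)).val := rfl
    rw [this]
    cases good <;> rfl
  have hmem : ∀ X, X ∈ good ↔ (∃ e ∈ H.edges, X = (sideOf H e e.1).val ∨
      X = (sideOf H e e.2).val) ∧ D.Effective X ∧
        (q ≤ D.size X ∨ ∃ f ∈ H.edges, f.1 ∈ X ∧ f.2 ∈ X) := by
    intro X
    have h1 : (edgesInside X H.edges).val ≠ [] ↔ ∃ f ∈ H.edges, f.1 ∈ X ∧ f.2 ∈ X := by
      constructor
      · intro h
        obtain ⟨f, hf⟩ := List.exists_mem_of_ne_nil _ h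
        exact ⟨f, (mem_edgesInside _ _ _).1 hf⟩
      · rintro ⟨f, hf⟩
        exact List.ne_nil_of_mem ((mem_edgesInside _ _ _).2 hf)
    simp only [hgood, List.mem_filter, List.mem_append, List.mem_map, Bool.and_eq_true,
      Bool.or_eq_true, Timed.val_test, decide_eq_true_eq, superSize_val, costEffective_val, h1]
    refine and_congr ?_ Iff.rfl
    constructor
    · rintro (⟨e, he, rfl⟩ | ⟨e, he, rfl⟩)
      exacts [⟨e, he, Or.inl rfl⟩, ⟨e, he, Or.inr rfl⟩]
    · rintro ⟨e, he, rfl | rfl⟩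
      exacts [Or.inl ⟨e, he, rfl⟩, Or.inr ⟨e, he, rfl⟩]
  cases hg : good with
  | nil =>
    left
    refine ⟨by rw [hval, hg]; rfl, fun e X hX heff => ?_⟩
    have hside : X = (sideOf H e e.1).val ∨ X = (sideOf H e e.2).val :=
      hX.touch.imp (hX.eq_sideOf hH) (hX.eq_sideOf hH)
    have hno : ¬ (q ≤ D.size X ∨ ∃ f ∈ H.edges, f.1 ∈ X ∧ f.2 ∈ X) := by
      intro h
      have := (hmem X).2 ⟨⟨e, hX.mem_edges, hside⟩, heff, h⟩
      rw [hg] at this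
      simp at this
    push Not at hno
    exact ⟨hno.1, fun f hf h => hno.2 f hf h.1 h.2⟩
  | cons X l =>
    right
    obtain ⟨⟨e, he, hs⟩, heff, hlf⟩ := (hmem X).1 (by rw [hg]; exact List.mem_cons_self)
    have hX : H.IsSide e X := by
      rcases hs with rfl | rfl
      exacts [hH.isSide hE he (Or.inl rfl), hH.isSide hE he (Or.inr rfl)]
    have hval' : (contractStep D q H).val =
        if q ≤ D.size X then H.restrict X else H.contract X := by
      rw [hval, hg]
      simp
    have hlen := length_edgesInside_add X H.edges
    rw [hval']
    split_ifs with hq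
    · refine ⟨hX.restrict_valid hH heff hq, ?_, hX.subset⟩
      have : 0 < (edgesNotInside X H.edges).val.length :=
        List.length_pos_of_mem ((mem_edgesNotInside _ _ e).2 ⟨he, hX.cross⟩)
      change (edgesInside X H.edges).val.length < _
      omega
    · refine ⟨hX.contract_valid hH heff (not_le.1 hq), ?_, le_rfl⟩
      obtain ⟨f, hf, h⟩ := hlf.resolve_left hq
      have : 0 < (edgesInside X H.edges).val.length :=
        List.length_pos_of_mem ((mem_edgesInside _ _ f).2 ⟨hf, h⟩)
      change (edgesNotInside X H.edges).val.length < _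
      omega

theorem iterate_contractStep (hE : EdgeAcyclic {e | e ∈ E}) (m : ℕ) (hH : H.Valid D q E)
    (hm : H.edges.length ≤ m) :
    let H' := (fun H => (contractStep D q H).val)^[m] H
    H'.Valid D q E ∧ H'.Stable D q ∧ H'.vertices ⊆ H.vertices := by
  induction m generalizing H with
  | zero =>
    refine ⟨hH, ?_, le_rfl⟩
    rcases contractStep_cases hH hE with ⟨-, h⟩ | ⟨-, h, -⟩
    · exact h
    · omega
  | succ m ih =>
    rcases contractStep_cases hH hE with ⟨h, hst⟩ | ⟨h, hlt, hsub⟩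
    · dsimp only
      have : (fun H => (contractStep D q H).val) H = H := h
      rw [Function.iterate_fixed this]
      exact ⟨hH, hst, le_rfl⟩
    · dsimp only
      rw [Function.iterate_succ_apply]
      obtain ⟨h1, h2, h3⟩ := ih h (by omega)
      exact ⟨h1, h2, h3.trans hsub⟩

/-- The tree before the first contraction satisfies the invariant. -/
theorem valid_initial {U : Finset (Fin n)} (hnodup : E.Nodup) (hEU : EdgesIn {e | e ∈ E} U)
    (hconn : ∀ u ∈ U, ∀ v ∈ U, EdgeReach {e | e ∈ E} u v) (hU : U.Nonempty)
    (heff : D.Effective U) (hq : q ≤ D.size U) :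
    ContractedTree.Valid { vertices := U, edges := E, contracted := [] } D q E := by
  have hall : ContractedTree.all { vertices := U, edges := E, contracted := [] } =
      {e | e ∈ E} := by
    ext f; simp [ContractedTree.all]
  refine ⟨hnodup, ?_, by simp, ?_, ?_, hU, heff, hq, ?_⟩
  · rw [hall]; exact fun e he => he
  · rw [hall]; exact hEU
  · rw [hall]; exact hconn
  · intro x _ y hy hyx
    refine absurd ?_ hyx
    refine (mem_node.1 hy).closed (P := fun y => y = x) ?_ rfl
    rintro a b (h | h) <;> simp [ContractedTree.inner] at h

end

/-! ### Stable trees are stars or single edges. -/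

section

variable {n : ℕ}

namespace ContractedTree

variable {H : ContractedTree n} {D : PickData n} {q : ℕ} {E : List (Fin n × Fin n)}

/-- The node of `x` has exactly one edge. -/
def IsLeaf (H : ContractedTree n) (x : Fin n) : Prop :=
  ∃ e ∈ H.edges, Touches e (H.node x) ∧ ∀ f ∈ H.edges, Touches f (H.node x) → f = e

theorem IsLeaf.congr {x y : Fin n} (h : H.IsLeaf x) (hy : y ∈ H.node x) : H.IsLeaf y := by
  rwa [IsLeaf, node_eq_of_mem hy]

theorem IsLeaf.edge_eq {x : Fin n} (h : H.IsLeaf x) {e f : Fin n × Fin n} (he : e ∈ H.edges)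
    (hf : f ∈ H.edges) (hex : Touches e (H.node x)) (hfx : Touches f (H.node x)) : e = f := by
  obtain ⟨g, -, -, hg⟩ := h
  rw [hg e he hex, hg f hf hfx]

/-- In a stable tree, a cost-effective side is a leaf. -/
theorem Stable.side_eq_node (hst : H.Stable D q) (hH : H.Valid D q E) {e : Fin n × Fin n}
    {X : Finset (Fin n)} (hX : H.IsSide e X) (heff : D.Effective X) {x : Fin n} (hx : x ∈ X) :
    X = H.node x ∧ H.IsLeaf x := by
  obtain ⟨-, hno⟩ := hst e X hX heff
  have hXx : X = H.node x := by
    ext y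
    rw [mem_node]
    constructor
    · intro hy
      refine (hX.conn x hx y hy).restrict (X := X) hX.closed (fun f hf h1 h2 => ?_) hx
      rcases hf.1 with h | h
      · exact absurd ⟨h1, h2⟩ (hno f h)
      · exact h
    · exact fun h => h.closed (hX.inner_closed hH) hx
  refine ⟨hXx, e, hX.mem_edges, hXx ▸ hX.touch, fun f hf ht => ?_⟩
  rw [← hXx] at ht
  by_contra hne
  have hj : EdgeJoined (H.all \ {e}) f.1 f.2 := Or.inl ⟨Or.inl hf, hne⟩
  rcases ht with h | h
  · exact hno f hf ⟨h, hX.closed _ _ hj h⟩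
  · exact hno f hf ⟨hX.closed _ _ hj.symm h, h⟩

/-- In a stable tree, every edge has an end in a leaf. -/
theorem Stable.exists_leaf (hst : H.Stable D q) (hH : H.Valid D q E)
    (hE : EdgeAcyclic {e | e ∈ E}) {e : Fin n × Fin n} (he : e ∈ H.edges) :
    H.IsLeaf e.1 ∨ H.IsLeaf e.2 := by
  obtain ⟨X, hX, heff⟩ := hH.exists_effective_side hE he
  rcases hX.touch with h | h
  exacts [Or.inl (hst.side_eq_node hH hX heff h).2, Or.inr (hst.side_eq_node hH hX heff h).2]

/-- In a stable tree with more than `q` vertices, all leaves are cost-effective and have at most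
`q` vertices. -/
theorem Stable.leaf_effective (hst : H.Stable D q) (hH : H.Valid D q E)
    (hE : EdgeAcyclic {e | e ∈ E}) (hq : 1 ≤ q) (hbig : q < D.size H.vertices) {x : Fin n}
    (hx : x ∈ H.vertices) (hleaf : H.IsLeaf x) :
    D.Effective (H.node x) ∧ D.size (H.node x) ≤ q := by
  by_cases hsing : ∃ y ∈ H.node x, y ≠ x
  · obtain ⟨y, hy, hyx⟩ := hsing
    obtain ⟨h1, h2, -⟩ := hH.nodes x hx y hy hyx
    exact ⟨h1, h2.le⟩
  push Not at hsing
  have hnode : H.node x = {x} := by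
    ext y
    rw [Finset.mem_singleton]
    exact ⟨hsing y, by rintro rfl; exact self_mem_node y⟩
  refine ⟨?_, by rw [hnode]; exact (PickData.size_singleton_le x).trans hq⟩
  obtain ⟨e, he, ht, huniq⟩ := hleaf
  obtain ⟨X, hX, heff⟩ := hH.exists_effective_side hE he
  by_cases hxX : x ∈ X
  · rw [← (hst.side_eq_node hH hX heff hxX).1]
    exact heff
  -- Otherwise the cost-effective side is the one that misses the leaf. Its complement is just `x`,
  -- so it has at least `q` vertices, contrary to stability.
  · exfalso
    have hX' := hX.compl hH hE
    have hxX' : x ∈ H.vertices \ X := Finset.mem_sdiff.2 ⟨hx, hxX⟩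
    have hsub : H.vertices \ X ⊆ {x} := by
      intro y hy
      rw [Finset.mem_singleton]
      refine (hX'.conn x hxX' y hy).closed (P := fun y => y = x) ?_ rfl
      rintro a b hab rfl
      have : ∀ f, f ∈ H.all \ {e} → Touches f {a} → f ∈ H.inner := by
        intro f hf hfa
        rcases hf.1 with h | h
        · exact absurd (huniq f h (hnode ▸ hfa)) hf.2
        · exact h
      have hb : EdgeJoined H.inner a b := by
        rcases hab with h | h
        · exact Or.inl (this _ h (Or.inl (Finset.mem_singleton_self _)))
        · exact Or.inr (this _ h (Or.inr (Finset.mem_singleton_self _)))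
      exact hsing b (mem_node.2 (.of_joined hb))
    have h1 : D.size H.vertices = D.size X + D.size (H.vertices \ X) := by
      rw [← PickData.size_union Finset.disjoint_sdiff, Finset.union_sdiff_of_subset hX.subset]
    have h2 := (PickData.size_mono (D := D) hsub).trans (PickData.size_singleton_le x)
    have h3 := (hst e X hX heff).1
    omega

/-- A valid tree with more than `q` vertices has an edge that is not contracted. -/
theorem Valid.edges_ne_nil (hH : H.Valid D q E) (hq : 1 ≤ q) (hbig : q < D.size H.vertices) :
    H.edges ≠ [] := by
  intro hnil
  obtain ⟨x, hx⟩ := hH.nonempty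
  have hsub : H.vertices ⊆ H.node x := by
    intro v hv
    rw [mem_node]
    refine (hH.conn x hx v hv).mono fun f hf => ?_
    rcases hf with h | h
    · simp [hnil] at h
    · exact h
  have h1 := PickData.size_mono (D := D) hsub
  by_cases hsing : ∃ y ∈ H.node x, y ≠ x
  · obtain ⟨y, hy, hyx⟩ := hsing
    have := (hH.nodes x hx y hy hyx).2.1
    omega
  · push Not at hsing
    have : H.node x ⊆ {x} := fun y hy => Finset.mem_singleton.2 (hsing y hy)
    have h2 := (PickData.size_mono (D := D) this).trans (PickData.size_singleton_le x)
    omega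

/-- A stable tree with a node that is not a leaf is a star. -/
theorem Stable.star (hst : H.Stable D q) (hH : H.Valid D q E) (hE : EdgeAcyclic {e | e ∈ E})
    {c : Fin n} (hc : c ∈ H.vertices) (hleaf : ¬ H.IsLeaf c) {e : Fin n × Fin n}
    (he : e ∈ H.edges) (hce : c = e.1 ∨ c = e.2) :
    H.node c = {c} ∧ ∀ v ∈ H.vertices, v = c ∨
      H.IsLeaf v ∧ ∃ a ∈ H.node v, EdgeJoined {e | e ∈ H.edges} a c := by
  -- A node with more than one vertex has at most one edge; with the edge `e` it would be a leaf.
  have hsing : ∀ y ∈ H.node c, y = c := by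
    intro y hy
    by_contra hyc
    have ht : Touches e (H.node c) := by
      rcases hce with rfl | rfl
      exacts [Or.inl (self_mem_node _), Or.inr (self_mem_node _)]
    exact hleaf ⟨e, he, ht, fun f hf hft => (hH.nodes c hc y hy hyc).2.2 f hf e he hft ht⟩
  refine ⟨by ext y; rw [Finset.mem_singleton]; exact ⟨hsing y, by rintro rfl; exact self_mem_node y⟩,
    fun v hv => ?_⟩
  refine (hH.conn c hc v hv).closed (P := fun v => v = c ∨
      H.IsLeaf v ∧ ∃ a ∈ H.node v, EdgeJoined {e | e ∈ H.edges} a c) ?_ (Or.inl rfl)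
  intro a b hab ha
  have hcase : EdgeJoined H.inner a b ∨ EdgeJoined {e | e ∈ H.edges} a b := by
    rcases hab with (h | h) | (h | h)
    exacts [Or.inr (Or.inl h), Or.inl (Or.inl h), Or.inr (Or.inr h), Or.inl (Or.inr h)]
  rcases hcase with hab | hab
  · have hba : b ∈ H.node a := mem_node.2 (.of_joined hab)
    rcases ha with rfl | ⟨hl, a', ha', hj⟩
    · exact Or.inl (hsing b hba)
    · exact Or.inr ⟨hl.congr hba, a', by rwa [node_eq_of_mem hba], hj⟩
  · rcases ha with rfl | ⟨hl, a', ha', hj⟩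
    · refine Or.inr ⟨?_, b, self_mem_node b, hab.symm⟩
      rcases hab with h | h
      · exact (hst.exists_leaf hH hE h).resolve_left hleaf
      · exact (hst.exists_leaf hH hE h).resolve_right hleaf
    -- A step from a leaf uses its only edge, which is the one to `c`.
    · left
      have hac : a ≠ c := fun h => hleaf (h ▸ hl)
      have haa := self_mem_node (H := H) a
      rcases hab with h | h <;> rcases hj with h' | h'
      · have := hl.edge_eq h h' (Or.inl haa) (Or.inl ha')
        exact (Prod.mk.inj this).2
      · have := hl.edge_eq h h' (Or.inl haa) (Or.inr ha')
        exact absurd (Prod.mk.inj this).1 hac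
      · have := hl.edge_eq h h' (Or.inr haa) (Or.inl ha')
        exact absurd (Prod.mk.inj this).2 hac
      · have := hl.edge_eq h h' (Or.inr haa) (Or.inr ha')
        exact (Prod.mk.inj this).1

/-- A valid tree all nodes of which are leaves is a single edge. -/
theorem Valid.single_edge (hH : H.Valid D q E)
    (hleaf : ∀ e ∈ H.edges, H.IsLeaf e.1 ∧ H.IsLeaf e.2) {e : Fin n × Fin n} (he : e ∈ H.edges)
    {x : Fin n} (hx : x = e.1 ∨ x = e.2) {v : Fin n} (hv : v ∈ H.vertices) :
    H.IsLeaf v ∧ (v ∈ H.node x ∨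
      ∃ a ∈ H.node v, ∃ b ∈ H.node x, EdgeJoined {e | e ∈ H.edges} a b) := by
  obtain ⟨y, hy, hxy⟩ : ∃ y, (y = e.1 ∨ y = e.2) ∧ EdgeJoined {e | e ∈ H.edges} y x ∧
      (∀ z, z = e.1 ∨ z = e.2 → z = x ∨ z = y) := by
    rcases hx with rfl | rfl
    · exact ⟨e.2, Or.inr rfl, Or.inr he, fun z hz => hz⟩
    · exact ⟨e.1, Or.inl rfl, Or.inl he, fun z hz => hz.symm⟩
  have hxl : H.IsLeaf x := by rcases hx with rfl | rfl; exacts [(hleaf e he).1, (hleaf e he).2]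
  have hyl : H.IsLeaf y := by rcases hy with rfl | rfl; exacts [(hleaf e he).1, (hleaf e he).2]
  have hxV : x ∈ H.vertices := by
    have := hH.edgesIn e (Or.inl he)
    rcases hx with rfl | rfl; exacts [this.1, this.2]
  have hx' : Touches e (H.node x) := by
    rcases hx with h | h
    exacts [Or.inl (h ▸ self_mem_node _), Or.inr (h ▸ self_mem_node _)]
  have hy' : Touches e (H.node y) := by
    rcases hy with h | h
    exacts [Or.inl (h ▸ self_mem_node _), Or.inr (h ▸ self_mem_node _)]
  have hmem : v ∈ H.node x ∨ v ∈ H.node y := by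
    refine (hH.conn x hxV v hv).closed (P := fun v => v ∈ H.node x ∨ v ∈ H.node y) ?_
      (Or.inl (self_mem_node x))
    intro a b hab ha
    have hcase : EdgeJoined H.inner a b ∨ ∃ f ∈ H.edges, (a = f.1 ∨ a = f.2) ∧
        (b = f.1 ∨ b = f.2) := by
      rcases hab with (h | h) | (h | h)
      exacts [Or.inr ⟨_, h, Or.inl rfl, Or.inr rfl⟩, Or.inl (Or.inl h),
        Or.inr ⟨_, h, Or.inr rfl, Or.inl rfl⟩, Or.inl (Or.inr h)]
    rcases hcase with hab | ⟨f, hf, haf, hbf⟩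
    · have := EdgeReach.of_joined hab
      simp only [mem_node] at ha ⊢
      exact ha.imp (fun h => h.trans this) fun h => h.trans this
    · have hfe : f = e := by
        have htf : ∀ z, a ∈ H.node z → Touches f (H.node z) := by
          intro z haz
          rcases haf with h | h
          exacts [Or.inl (h ▸ haz), Or.inr (h ▸ haz)]
        rcases ha with ha | ha
        · exact hxl.edge_eq hf he (htf x ha) hx'
        · exact hyl.edge_eq hf he (htf y ha) hy'
      subst hfe
      rcases hxy.2 b hbf with rfl | rfl
      exacts [Or.inl (self_mem_node _), Or.inr (self_mem_node _)]
  rcases hmem with h | h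
  · exact ⟨hxl.congr h, Or.inl h⟩
  · refine ⟨hyl.congr h, Or.inr ⟨y, ?_, x, self_mem_node x, hxy.1⟩⟩
    rw [node_eq_of_mem h]
    exact self_mem_node y

end ContractedTree

open ContractedTree

variable {H : ContractedTree n} {D : PickData n} {q : ℕ} {E : List (Fin n × Fin n)}

theorem block_val (hH : H.Valid D q E) {x : Fin n} (hx : x ∈ H.vertices) :
    (block H x).val = H.node x := by
  ext u
  rw [block, mem_reach_edgeAdj (fun e he => hH.edgesIn e (Or.inr he)) hx, mem_node]
  rfl

theorem blockDegree_eq_one (hH : H.Valid D q E) (x : Fin n) :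
    (blockDegree H (H.node x)).val = 1 ↔ H.IsLeaf x := by
  simp only [blockDegree, Timed.val_bind, Timed.val_filterList, Timed.val_op, Timed.val_test,
    List.length_eq_one_iff]
  constructor
  · rintro ⟨e, he⟩
    have hmem : ∀ f, f ∈ H.edges ∧ Touches f (H.node x) ↔ f = e := by
      intro f
      have := congrArg (fun l => f ∈ l) he
      simpa [Touches] using this
    have h := (hmem e).2 rfl
    exact ⟨e, h.1, h.2, fun f hf ht => (hmem f).1 ⟨hf, ht⟩⟩
  · rintro ⟨e, he, ht, huniq⟩
    refine ⟨e, ?_⟩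
    refine List.perm_singleton.1 ((List.perm_ext_iff_of_nodup (hH.nodup.filter _) (List.nodup_singleton e)).2 ?_)
    intro f
    simp only [List.mem_filter, decide_eq_true_eq, List.mem_singleton]
    refine ⟨fun h => huniq f h.1 h.2, ?_⟩
    rintro rfl
    exact ⟨he, ht⟩

end

/-! ### Picking vertices at about the average price. -/

section

variable {n : ℕ}

open ContractedTree

variable {H : ContractedTree n} {D : PickData n} {q : ℕ} {E : List (Fin n × Fin n)}

/-- The result of the contraction phase. -/
noncomputable def stableTree (D : PickData n) (q : ℕ) (U : Finset (Fin n))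
    (E : List (Fin n × Fin n)) : ContractedTree n :=
  (fun H => (contractStep D q H).val)^[2 * n] { vertices := U, edges := E, contracted := [] }

/-- The ends of the edges with their nodes, and the degrees and sizes of these. -/
noncomputable def nodeList (D : PickData n) (H : ContractedTree n) :
    List (Fin n × Finset (Fin n) × ℕ × ℕ) :=
  (H.edges.map Prod.fst ++ H.edges.map Prod.snd).map fun x =>
    (x, (block H x).val, (blockDegree H (block H x).val).val, (superSize D (block H x).val).val)

/-- The leaves in the order in which they are picked. -/
noncomputable def leafList (D : PickData n) (H : ContractedTree n) : List (Finset (Fin n) × ℕ) :=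
  (Timed.sortDesc (((nodeList D H).filter fun b => (Timed.test (b.2.2.1 = 1)).val).map
    fun b => (b.2.1, b.2.2.2))).val

/-- The vertex from which a path is bought. -/
noncomputable def centerList (D : PickData n) (H : ContractedTree n) : List (Fin n) :=
  (((nodeList D H).filter fun b => (Timed.test (b.2.2.1 ≠ 1)).val).map Prod.fst ++
    (List.finRange n).filter fun v =>
      (Timed.test (∃ L ∈ (leafList D H).head?, v ∈ L.1)).val).take 1

theorem vertexSet_or (S T : Finset (Fin n)) :
    (Timed.vertexSet fun v => Timed.test (v ∈ S ∨ v ∈ T)).val = S ∪ T := by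
  ext v; simp

theorem Timed.bind_congr {α β : Type} {x : Timed α} {f g : α → Timed β} (h : ∀ a, f a = g a) :
    (x >>= f) = (x >>= g) := by
  rw [funext h]

/-- A recursive call of `pick`, if one is allowed. -/
abbrev PickCall (n : ℕ) : Type :=
  Option (ℕ → Finset (Fin n) → List (Fin n × Fin n) → Timed (Finset (Fin n) × List (Fin n)))

open Timed in
/-- The last part of `pick`. -/
noncomputable def pickTail (next : PickCall n) (q : ℕ) (E : List (Fin n × Fin n))
    (center : List (Fin n)) (x : Finset (Fin n) × ℕ × Option (Finset (Fin n))) :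
    Timed (Finset (Fin n) × List (Fin n)) :=
  match x.2.2, next with
  | none, _ => pure (x.1, center)
  | some L, none => do
    let S' ← vertexSet fun v => test (v ∈ x.1 ∨ v ∈ L)
    return (S', center)
  | some L, some f => do
    let EL ← edgesInside L E
    let y ← f (q - x.2.1) L EL
    let S'' ← vertexSet fun v => test (v ∈ x.1 ∨ v ∈ y.1)
    return (S'', center ++ y.2)

open Timed in
/-- `pick` with the recursive call as a parameter. -/
noncomputable def pickWith (D : PickData n) (next : PickCall n) (q : ℕ) (U : Finset (Fin n))
    (E : List (Fin n × Fin n)) : Timed (Finset (Fin n) × List (Fin n)) := do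
  let H ← iterate (2 * n) (contractStep D q) { vertices := U, edges := E, contracted := [] }
  let blocks ← mapList (H.edges.map Prod.fst ++ H.edges.map Prod.snd) fun x => do
    let X ← block H x
    let d ← blockDegree H X
    let s ← superSize D X
    return (x, X, d, s)
  let leaves ← filterList blocks fun b => test (b.2.2.1 = 1)
  let inner ← filterList blocks fun b => test (b.2.2.1 ≠ 1)
  let size ← superSize D H.vertices
  let small ← test (size ≤ q)
  if small then do
    let verts ← filterList (List.finRange n) fun v => test (v ∈ H.vertices)
    return (H.vertices, verts.take 1)
  else do
    let sorted ← sortDesc (leaves.map fun b => (b.2.1, b.2.2.2))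
    let first ← filterList (List.finRange n) fun v => test (∃ L ∈ sorted.head?, v ∈ L.1)
    let x ← takeLeaves q ∅ 0 sorted
    pickTail next q E ((inner.map Prod.fst ++ first).take 1) x

/-- With `pick_succ`, this exhibits every level of the recursion as the same program `pickWith`, so
that its value and running time are analysed only once. -/
theorem pick_zero (D : PickData n) (q : ℕ) (U : Finset (Fin n)) (E : List (Fin n × Fin n)) :
    pick D 0 q U E = pickWith D none q U E := by
  delta pick pickWith
  with_unfolding_all change (Bind.bind _ _ : Timed _) = _
  refine Timed.bind_congr fun H => ?_
  refine Timed.bind_congr fun blocks => ?_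
  refine Timed.bind_congr fun leaves => ?_
  refine Timed.bind_congr fun inner => ?_
  refine Timed.bind_congr fun size => ?_
  refine Timed.bind_congr fun small => ?_
  cases small
  · refine Timed.bind_congr fun sorted => ?_
    refine Timed.bind_congr fun first => ?_
    refine Timed.bind_congr fun x => ?_
    obtain ⟨S, t, _ | L⟩ := x <;> rfl
  · rfl

theorem pick_succ (D : PickData n) (depth q : ℕ) (U : Finset (Fin n)) (E : List (Fin n × Fin n)) :
    pick D (depth + 1) q U E = pickWith D (some (pick D depth)) q U E := by
  delta pick pickWith
  with_unfolding_all change (Bind.bind _ _ : Timed _) = _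
  refine Timed.bind_congr fun H => ?_
  refine Timed.bind_congr fun blocks => ?_
  refine Timed.bind_congr fun leaves => ?_
  refine Timed.bind_congr fun inner => ?_
  refine Timed.bind_congr fun size => ?_
  refine Timed.bind_congr fun small => ?_
  cases small
  · refine Timed.bind_congr fun sorted => ?_
    refine Timed.bind_congr fun first => ?_
    refine Timed.bind_congr fun x => ?_
    obtain ⟨S, t, _ | L⟩ := x <;> rfl
  · rfl

theorem pickTail_val (next : PickCall n) (q : ℕ) (E : List (Fin n × Fin n))
    (center : List (Fin n)) (x : Finset (Fin n) × ℕ × Option (Finset (Fin n))) :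
    (pickTail next q E center x).val = match x.2.2, next with
      | none, _ => (x.1, center)
      | some L, none => (x.1 ∪ L, center)
      | some L, some f => (x.1 ∪ (f (q - x.2.1) L (edgesInside L E).val).val.1,
          center ++ (f (q - x.2.1) L (edgesInside L E).val).val.2) := by
  obtain ⟨S, t, _ | L⟩ := x
  · rfl
  · cases next with
    | none => exact congrArg (fun X => (X, center)) (vertexSet_or S L)
    | some f =>
      exact congrArg (fun X => (X, center ++ (f (q - t) L (edgesInside L E).val).val.2))
        (vertexSet_or S _)

theorem pickWith_val (D : PickData n) (next : PickCall n) (q : ℕ) (U : Finset (Fin n))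
    (E : List (Fin n × Fin n)) :
    (pickWith D next q U E).val =
      if D.size (stableTree D q U E).vertices ≤ q then ((stableTree D q U E).vertices,
        ((List.finRange n).filter fun v =>
          (Timed.test (v ∈ (stableTree D q U E).vertices)).val).take 1)
      else (pickTail next q E (centerList D (stableTree D q U E))
        (takeLeaves q ∅ 0 (leafList D (stableTree D q U E))).val).val := by
  have hH : (Timed.iterate (2 * n) (contractStep D q)
      { vertices := U, edges := E, contracted := [] }).val = stableTree D q U E :=
    Timed.val_iterate _ _ _
  rw [pickWith, Timed.val_bind, hH]
  by_cases hs : D.size (stableTree D q U E).vertices ≤ q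
  · simp only [Timed.val_bind, superSize_val, Timed.val_test, decide_eq_true_eq, if_pos hs]
    rfl
  · simp only [Timed.val_bind, Timed.val_test, decide_eq_true_eq]
    rw [superSize_val D (stableTree D q U E).vertices, if_neg hs, if_neg hs]
    rfl

theorem takeLeaves_spec (q : ℕ) (l : List (Finset (Fin n) × ℕ)) (S : Finset (Fin n)) (t : ℕ)
    (ht : t < q) :
    ∃ p rest, l = p ++ rest ∧
      (∀ v, v ∈ (takeLeaves q S t l).val.1 ↔ v ∈ S ∨ ∃ L ∈ p, v ∈ L.1) ∧
      (takeLeaves q S t l).val.2.1 = t + (p.map Prod.snd).sum ∧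
      (((takeLeaves q S t l).val.2.2 = none ∧ t + (p.map Prod.snd).sum ≤ q ∧
          (rest = [] ∨ t + (p.map Prod.snd).sum = q)) ∨
        ∃ L s rest', rest = (L, s) :: rest' ∧ (takeLeaves q S t l).val.2.2 = some L ∧
          t + (p.map Prod.snd).sum < q ∧ q < t + (p.map Prod.snd).sum + s) := by
  induction l generalizing S t with
  | nil =>
    refine ⟨[], [], rfl, ?_, ?_, Or.inl ⟨?_, ?_, Or.inl rfl⟩⟩ <;> simp [takeLeaves, ht.le]
  | cons a l ih =>
    obtain ⟨L, s⟩ := a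
    have hval : (takeLeaves q S t ((L, s) :: l)).val =
        if q < t + s then (S, t, some L)
        else if q = t + s then (S ∪ L, t + s, none) else (takeLeaves q (S ∪ L) (t + s) l).val := by
      rw [← vertexSet_or, takeLeaves]
      simp only [Timed.val_bind, Timed.val_test, decide_eq_true_eq]
      split_ifs <;> rfl
    rw [hval]
    split_ifs with h1 h2
    · refine ⟨[], (L, s) :: l, rfl, by simp, by simp, Or.inr ⟨L, s, l, rfl, rfl, ?_, ?_⟩⟩
      · simpa using ht
      · simpa using h1
    · refine ⟨[(L, s)], l, rfl, by simp, by simp, Or.inl ⟨rfl, ?_, Or.inr ?_⟩⟩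
      · simp [h2]
      · simp [h2]
    · obtain ⟨p, rest, h3, h4, h5, h6⟩ := ih (S ∪ L) (t + s) (by omega)
      refine ⟨(L, s) :: p, rest, by rw [h3]; rfl, ?_, ?_, ?_⟩
      · intro v
        rw [h4]
        simp only [Finset.mem_union, List.mem_cons, exists_eq_or_imp]
        tauto
      · rw [h5]; simp [add_assoc]
      · simpa [add_assoc] using h6

/-- The union of a list of disjoint cost-effective sets. -/
theorem exists_union_of_pairwise (p : List (Finset (Fin n) × ℕ))
    (hdisj : p.Pairwise fun a b => Disjoint a.1 b.1) (hsize : ∀ a ∈ p, a.2 = D.size a.1)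
    (heff : ∀ a ∈ p, D.Effective a.1) :
    ∃ S : Finset (Fin n), (∀ v, v ∈ S ↔ ∃ L ∈ p, v ∈ L.1) ∧ D.size S = (p.map Prod.snd).sum ∧
      D.Effective S := by
  induction p with
  | nil => exact ⟨∅, by simp, by simp [PickData.size], by simp [PickData.Effective,
      PickData.size, PickData.weight]⟩
  | cons a p ih =>
    rw [List.pairwise_cons] at hdisj
    obtain ⟨S, h1, h2, h3⟩ := ih hdisj.2 (fun b hb => hsize b (List.mem_cons_of_mem _ hb))
      fun b hb => heff b (List.mem_cons_of_mem _ hb)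
    have hd : Disjoint a.1 S := by
      rw [Finset.disjoint_left]
      intro v hv hvS
      obtain ⟨L, hL, hvL⟩ := (h1 v).1 hvS
      exact Finset.disjoint_left.1 (hdisj.1 L hL) hv hvL
    refine ⟨a.1 ∪ S, fun v => ?_, ?_, ?_⟩
    · rw [Finset.mem_union, h1]
      simp
    · rw [PickData.size_union hd, h2, List.map_cons, List.sum_cons,
        hsize a List.mem_cons_self]
    · have ha := heff a List.mem_cons_self
      rw [PickData.Effective] at ha h3 ⊢
      rw [PickData.size_union hd, PickData.weight_union hd]
      push_cast
      linarith

theorem mem_nodeList (hH : H.Valid D q E) (b : Fin n × Finset (Fin n) × ℕ × ℕ) :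
    b ∈ nodeList D H ↔ ∃ x, (∃ e ∈ H.edges, x = e.1 ∨ x = e.2) ∧
      b = (x, H.node x, (blockDegree H (H.node x)).val, D.size (H.node x)) := by
  simp only [nodeList, List.mem_map, List.mem_append, superSize_val]
  constructor
  · rintro ⟨x, hx, rfl⟩
    have hx' : ∃ e ∈ H.edges, x = e.1 ∨ x = e.2 := by
      rcases hx with ⟨e, he, rfl⟩ | ⟨e, he, rfl⟩
      exacts [⟨e, he, Or.inl rfl⟩, ⟨e, he, Or.inr rfl⟩]
    obtain ⟨e, he, hxe⟩ := hx'
    have hxV : x ∈ H.vertices := by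
      have := hH.edgesIn e (Or.inl he)
      rcases hxe with rfl | rfl; exacts [this.1, this.2]
    exact ⟨x, ⟨e, he, hxe⟩, by rw [block_val hH hxV]⟩
  · rintro ⟨x, ⟨e, he, hxe⟩, rfl⟩
    have hxV : x ∈ H.vertices := by
      have := hH.edgesIn e (Or.inl he)
      rcases hxe with rfl | rfl; exacts [this.1, this.2]
    refine ⟨x, ?_, by rw [block_val hH hxV]⟩
    rcases hxe with rfl | rfl
    exacts [Or.inl ⟨e, he, rfl⟩, Or.inr ⟨e, he, rfl⟩]

theorem mem_leafList (hH : H.Valid D q E) (a : Finset (Fin n) × ℕ) :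
    a ∈ leafList D H ↔ ∃ x, (∃ e ∈ H.edges, x = e.1 ∨ x = e.2) ∧ H.IsLeaf x ∧
      a = (H.node x, D.size (H.node x)) := by
  rw [leafList, Timed.val_sortDesc, List.mem_insertionSort, List.mem_map]
  constructor
  · rintro ⟨b, hb, rfl⟩
    obtain ⟨h1, h2⟩ := List.mem_filter.1 hb
    obtain ⟨x, hx, rfl⟩ := (mem_nodeList hH b).1 h1
    simp only [Timed.val_test, decide_eq_true_eq, blockDegree_eq_one hH] at h2
    exact ⟨x, hx, h2, rfl⟩
  · rintro ⟨x, hx, hl, rfl⟩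
    refine ⟨_, List.mem_filter.2 ⟨(mem_nodeList hH _).2 ⟨x, hx, rfl⟩, ?_⟩, rfl⟩
    simpa [blockDegree_eq_one hH] using hl

theorem leaf_mem_leafList (hH : H.Valid D q E) {v : Fin n} (hv : H.IsLeaf v) :
    (H.node v, D.size (H.node v)) ∈ leafList D H := by
  obtain ⟨e, he, ht, -⟩ := id hv
  rw [mem_leafList hH]
  rcases ht with h | h
  · exact ⟨e.1, ⟨e, he, Or.inl rfl⟩, hv.congr h, by rw [node_eq_of_mem h]⟩
  · exact ⟨e.2, ⟨e, he, Or.inr rfl⟩, hv.congr h, by rw [node_eq_of_mem h]⟩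

theorem leafList_sorted (D : PickData n) (H : ContractedTree n) :
    (leafList D H).Pairwise fun a b => b.2 ≤ a.2 := by
  rw [leafList, Timed.val_sortDesc]
  have : Std.Total (fun a b : Finset (Fin n) × ℕ => b.2 ≤ a.2) := ⟨fun a b => le_total b.2 a.2⟩
  have : IsTrans (Finset (Fin n) × ℕ) (fun a b => b.2 ≤ a.2) :=
    ⟨fun a b c h1 h2 => le_trans h2 h1⟩
  exact List.pairwise_insertionSort _ _

/-- The list runs over ends of edges. Ends of distinct edges cannot share a leaf, since a leaf has
only one edge; the two ends of one edge cannot share a node, by acyclicity. In particular no leaf is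
listed twice. -/
theorem leafList_disjoint (hH : H.Valid D q E) (hE : EdgeAcyclic {e | e ∈ E}) :
    (leafList D H).Pairwise fun a b => Disjoint a.1 b.1 := by
  rw [leafList, Timed.val_sortDesc]
  refine ((List.perm_insertionSort _ _).pairwise_iff (fun {a b} h => h.symm)).2 ?_
  rw [List.pairwise_map, List.pairwise_filter, nodeList, List.pairwise_map]
  have key : ∀ x y e f, e ∈ H.edges → f ∈ H.edges → (x = e.1 ∨ x = e.2) → (y = f.1 ∨ y = f.2) →
      (e ≠ f ∨ (x = e.1 ∧ y = e.2)) →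
      ((Timed.test ((blockDegree H (block H x).val).val = 1)).val = true) →
      ((Timed.test ((blockDegree H (block H y).val).val = 1)).val = true) →
      Disjoint (block H x).val (block H y).val := by
    intro x y e f he hf hx hy hne hdx hdy
    have hxV : x ∈ H.vertices := by
      have := hH.edgesIn e (Or.inl he)
      rcases hx with rfl | rfl; exacts [this.1, this.2]
    have hyV : y ∈ H.vertices := by
      have := hH.edgesIn f (Or.inl hf)
      rcases hy with rfl | rfl; exacts [this.1, this.2]
    rw [block_val hH hxV] at hdx ⊢
    rw [block_val hH hyV] at hdy ⊢
    simp only [Timed.val_test, decide_eq_true_eq, blockDegree_eq_one hH] at hdx hdy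
    rw [Finset.disjoint_left]
    intro z hz hz'
    have hnode : H.node x = H.node y := by rw [← node_eq_of_mem hz, node_eq_of_mem hz']
    have htx : Touches e (H.node x) := by
      rcases hx with h | h
      exacts [Or.inl (h ▸ self_mem_node _), Or.inr (h ▸ self_mem_node _)]
    have hty : Touches f (H.node x) := by
      rw [hnode]
      rcases hy with h | h
      exacts [Or.inl (h ▸ self_mem_node _), Or.inr (h ▸ self_mem_node _)]
    rcases hne with h | ⟨h1, h2⟩
    · exact h (hdx.edge_eq he hf htx hty)
    · refine hH.not_inside_node hE he (x := x) (h1 ▸ self_mem_node _) ?_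
      rw [hnode, ← h2]
      exact self_mem_node _
  rw [List.pairwise_append, List.pairwise_map, List.pairwise_map]
  have hnd : H.edges.Pairwise (· ≠ ·) := hH.nodup
  refine ⟨hnd.imp_of_mem fun {e f} he hf hne => ?_, hnd.imp_of_mem fun {e f} he hf hne => ?_, ?_⟩
  · exact key e.1 f.1 e f he hf (Or.inl rfl) (Or.inl rfl) (Or.inl hne)
  · exact key e.2 f.2 e f he hf (Or.inr rfl) (Or.inr rfl) (Or.inl hne)
  · intro x hx y hy
    obtain ⟨e, he, rfl⟩ := List.mem_map.1 hx
    obtain ⟨f, hf, rfl⟩ := List.mem_map.1 hy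
    refine key e.1 f.2 e f he hf (Or.inl rfl) (Or.inr rfl) ?_
    by_cases h : e = f
    · subst h; exact Or.inr ⟨rfl, rfl⟩
    · exact Or.inl h

/-- The centre of a stable tree with more than `q` vertices. -/
theorem exists_center (hst : H.Stable D q) (hH : H.Valid D q E) (hE : EdgeAcyclic {e | e ∈ E})
    (hq : 1 ≤ q) (hbig : q < D.size H.vertices) :
    ∃ c ∈ H.vertices, centerList D H = [c] ∧
      (H.node c = {c} ∨ ∃ a ∈ (leafList D H).head?, a.1 = H.node c) ∧
      ∀ v ∈ H.vertices, (v = c ∨ H.IsLeaf v) ∧ (v ∈ H.node c ∨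
        ∃ a ∈ H.node v, ∃ b ∈ H.node c, EdgeJoined {e | e ∈ H.edges} a b) := by
  set nonleaf := ((nodeList D H).filter fun b => (Timed.test (b.2.2.1 ≠ 1)).val).map Prod.fst
    with hnl
  have hmem : ∀ x, x ∈ nonleaf ↔ (∃ e ∈ H.edges, x = e.1 ∨ x = e.2) ∧ ¬ H.IsLeaf x := by
    intro x
    rw [hnl, List.mem_map]
    constructor
    · rintro ⟨b, hb, rfl⟩
      obtain ⟨h1, h2⟩ := List.mem_filter.1 hb
      obtain ⟨x, hx, rfl⟩ := (mem_nodeList hH b).1 h1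
      simp only [Timed.val_test, decide_eq_true_eq, ne_eq, blockDegree_eq_one hH] at h2
      exact ⟨hx, h2⟩
    · rintro ⟨hx, hl⟩
      refine ⟨_, List.mem_filter.2 ⟨(mem_nodeList hH _).2 ⟨x, hx, rfl⟩, ?_⟩, rfl⟩
      simpa [blockDegree_eq_one hH] using hl
  cases hc : nonleaf with
  | cons c l =>
    obtain ⟨⟨e, he, hce⟩, hleaf⟩ := (hmem c).1 (by rw [hc]; exact List.mem_cons_self)
    have hcV : c ∈ H.vertices := by
      have := hH.edgesIn e (Or.inl he)
      rcases hce with rfl | rfl; exacts [this.1, this.2]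
    obtain ⟨h1, h2⟩ := hst.star hH hE hcV hleaf he hce
    refine ⟨c, hcV, ?_, Or.inl h1, fun v hv => ?_⟩
    · rw [centerList, ← hnl, hc]; simp
    · rcases h2 v hv with rfl | ⟨h3, a, ha, hj⟩
      · exact ⟨Or.inl rfl, Or.inl (self_mem_node _)⟩
      · exact ⟨Or.inr h3, Or.inr ⟨a, ha, c, self_mem_node c, hj⟩⟩
  | nil =>
    have hleaf : ∀ e ∈ H.edges, H.IsLeaf e.1 ∧ H.IsLeaf e.2 := by
      intro e he
      constructor
      · by_contra h
        have := (hmem e.1).2 ⟨⟨e, he, Or.inl rfl⟩, h⟩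
        simp [hc] at this
      · by_contra h
        have := (hmem e.2).2 ⟨⟨e, he, Or.inr rfl⟩, h⟩
        simp [hc] at this
    -- If all nodes are leaves, the tree is a single edge. The centre is then a vertex of the first
    -- leaf in the sorted order, which is always picked.
    obtain ⟨e₀, he₀⟩ := List.exists_mem_of_ne_nil _ (hH.edges_ne_nil hq hbig)
    have hne := List.ne_nil_of_mem (leaf_mem_leafList hH (hleaf e₀ he₀).1)
    obtain ⟨a, l, hal⟩ := List.exists_cons_of_ne_nil hne
    obtain ⟨x, ⟨e, he, hxe⟩, hxl, rfl⟩ :=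
      (mem_leafList hH a).1 (by rw [hal]; exact List.mem_cons_self)
    have hxV : x ∈ H.vertices := by
      have := hH.edgesIn e (Or.inl he)
      rcases hxe with rfl | rfl; exacts [this.1, this.2]
    have hfirst : ∀ v, v ∈ ((List.finRange n).filter fun v =>
        (Timed.test (∃ L ∈ (leafList D H).head?, v ∈ L.1)).val) ↔ v ∈ H.node x := by
      intro v
      simp [hal]
    obtain ⟨c, l', hcl⟩ := List.exists_cons_of_ne_nil
      (List.ne_nil_of_mem ((hfirst x).2 (self_mem_node x)))
    have hcx : c ∈ H.node x := (hfirst c).1 (by rw [hcl]; exact List.mem_cons_self)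
    have hnode := node_eq_of_mem hcx
    refine ⟨c, hH.node_subset hxV hcx, ?_, Or.inr ⟨_, by rw [hal]; rfl, hnode.symm⟩, fun v hv => ?_⟩
    · rw [centerList, ← hnl, hc, hcl]; simp
    · rw [hnode]
      have := hH.single_edge hleaf he hxe hv
      exact ⟨Or.inr this.1, this.2⟩

/-- What `pick` guarantees: at least `q` vertices at a price that is close to the average one,
linked to the centres. -/
structure PickSpec (D : PickData n) (depth q : ℕ) (U : Finset (Fin n)) (E : List (Fin n × Fin n))
    (out : Finset (Fin n) × List (Fin n)) : Prop where
  subset : out.1 ⊆ U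
  centers : ∀ c ∈ out.2, c ∈ U
  length : out.2.length ≤ depth + 1
  large : q ≤ D.size out.1
  weight : D.weight out.1 * D.totalSize ≤ D.totalCost * (q * (1 + 1 / 2 ^ depth))
  linked : ∀ v ∈ out.1, ∃ c ∈ out.2,
    LinkedIn (EdgeJoined {e | e ∈ E}) (out.1 ∪ out.2.toFinset) c v

theorem EdgeReach.linkedIn {F : Set (Fin n × Fin n)} {X : Finset (Fin n)}
    (hX : ∀ a b, EdgeJoined F a b → a ∈ X → b ∈ X) {u v : Fin n} (h : EdgeReach F u v)
    (hu : u ∈ X) : LinkedIn (EdgeJoined F) X u v := by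
  have : v ∈ X ∧ LinkedIn (EdgeJoined F) X u v :=
    h.closed (P := fun v => v ∈ X ∧ LinkedIn (EdgeJoined F) X u v)
      (fun a b hab ⟨ha, hl⟩ => ⟨hX a b hab ha, hl.tail ⟨hab, hX a b hab ha⟩⟩) ⟨hu, .refl⟩
  exact this.2

theorem ContractedTree.node_linkedIn (hsub : H.inner ⊆ {e | e ∈ E}) {x u v : Fin n}
    {F : Finset (Fin n)} (hF : H.node x ⊆ F) (hu : u ∈ H.node x) (hv : v ∈ H.node x) :
    LinkedIn (EdgeJoined {e | e ∈ E}) F u v := by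
  have h : EdgeReach H.inner u v := (mem_node.1 hu).symm.trans (mem_node.1 hv)
  refine (h.linkedIn (X := H.node x) (fun a b hab ha => ?_) hu).mono
    (fun a b hab _ => hab.mono hsub) hF
  exact mem_node.2 ((mem_node.1 ha).trans (.of_joined hab))

/-- The part of the analysis of `pick` that does not depend on the recursion. -/
theorem pick_base (hcost : 0 ≤ D.totalCost) : ∀ (q : ℕ) (U : Finset (Fin n)) (E : List (Fin n × Fin n)), 1 ≤ q → E.Nodup →
    EdgesIn {e | e ∈ E} U → EdgeAcyclic {e | e ∈ E} → E.length ≤ 2 * n →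
    (∀ u ∈ U, ∀ v ∈ U, EdgeReach {e | e ∈ E} u v) → D.Effective U → q ≤ D.size U →
    let H := stableTree D q U E
    (D.size H.vertices ≤ q → ∀ d, PickSpec D d q U E (H.vertices,
      ((List.finRange n).filter fun v => (Timed.test (v ∈ H.vertices)).val).take 1)) ∧
    (q < D.size H.vertices → ∃ (c : Fin n) (S : Finset (Fin n)) (t : ℕ), c ∈ U ∧
      centerList D H = [c] ∧ S ⊆ U ∧ D.size S = t ∧ D.Effective S ∧
      (∀ v ∈ S, LinkedIn (EdgeJoined {e | e ∈ E}) (S ∪ {c}) c v) ∧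
      ((takeLeaves q ∅ 0 (leafList D H)).val = (S, t, none) ∧ t = q ∨
        ∃ L, (takeLeaves q ∅ 0 (leafList D H)).val = (S, t, some L) ∧ L ⊆ U ∧ t < q ∧
          q < t + D.size L ∧ D.size L ≤ t ∧ D.Effective L ∧ Disjoint S L ∧
          (∀ u ∈ L, ∀ v ∈ L, EdgeReach {e | e ∈ (edgesInside L E).val} u v) ∧
          ∀ v ∈ L, LinkedIn (EdgeJoined {e | e ∈ E}) (S ∪ L ∪ {c}) c v)) := by
  intro q U E hq hnd hEU hac hlen hconn heff hsize
  have hUne : U.Nonempty := by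
    rw [Finset.nonempty_iff_ne_empty]
    rintro rfl
    simp [PickData.size] at hsize
    omega
  obtain ⟨hH, hst, hVU⟩ := iterate_contractStep hac (2 * n)
    (valid_initial hnd hEU hconn hUne heff hsize) hlen
  change (stableTree D q U E).Valid D q E at hH
  change (stableTree D q U E).Stable D q at hst
  change (stableTree D q U E).vertices ⊆ U at hVU
  set H := stableTree D q U E with hHdef
  refine ⟨fun hsmall d => ?_, fun hbig => ?_⟩
  · obtain ⟨x, hx⟩ := hH.nonempty
    have hmem : ∀ v, v ∈ ((List.finRange n).filter fun v =>
        (Timed.test (v ∈ H.vertices)).val) ↔ v ∈ H.vertices := by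
      intro v; simp
    obtain ⟨c, l, hcl⟩ := List.exists_cons_of_ne_nil (List.ne_nil_of_mem ((hmem x).2 hx))
    have hc : c ∈ H.vertices := (hmem c).1 (by rw [hcl]; exact List.mem_cons_self)
    have ht : (((List.finRange n).filter fun v =>
        (Timed.test (v ∈ H.vertices)).val).take 1) = [c] := by rw [hcl]; simp
    rw [ht]
    refine ⟨hVU, fun v hv => ?_, by simp, hH.large, ?_, fun v hv => ⟨c, by simp, ?_⟩⟩
    · rw [List.mem_singleton] at hv
      subst hv
      exact hVU hc
    · have h1 := hH.effective
      rw [PickData.Effective] at h1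
      refine h1.trans (mul_le_mul_of_nonneg_left ?_ hcost)
      have h2 : (D.size H.vertices : ℝ) ≤ q := by exact_mod_cast hsmall
      have h3 : (0 : ℝ) ≤ 1 / 2 ^ d := by positivity
      nlinarith [(Nat.cast_nonneg q : (0 : ℝ) ≤ q)]
    · refine ((hH.conn c hc v hv).linkedIn (X := H.vertices) (fun a b hab _ => ?_) hc).mono
        (fun a b hab _ => hab.mono hH.sub) Finset.subset_union_left
      rcases hab with h | h
      exacts [(hH.edgesIn _ h).2, (hH.edgesIn _ h).1]
  · obtain ⟨c, hcV, hcl, hcnode, hcover⟩ := exists_center hst hH hac hq hbig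
    have hinner : H.inner ⊆ {e | e ∈ E} := fun e he => hH.sub e (Or.inr he)
    -- facts about the leaves
    have hleafs : ∀ a ∈ leafList D H, ∃ x ∈ H.vertices, a = (H.node x, D.size (H.node x)) ∧
        D.Effective (H.node x) ∧ D.size (H.node x) ≤ q := by
      intro a ha
      obtain ⟨x, ⟨e, he, hxe⟩, hxl, rfl⟩ := (mem_leafList hH a).1 ha
      have hxV : x ∈ H.vertices := by
        have := hH.edgesIn e (Or.inl he)
        rcases hxe with rfl | rfl; exacts [this.1, this.2]
      exact ⟨x, hxV, rfl, hst.leaf_effective hH hac hq hbig hxV hxl⟩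
    have hdisj := leafList_disjoint hH hac
    have hsort := leafList_sorted D H
    have hlsize : ∀ a ∈ leafList D H, a.2 = D.size a.1 := by
      intro a ha
      obtain ⟨x, -, rfl, -⟩ := hleafs a ha
      rfl
    have hleff : ∀ a ∈ leafList D H, D.Effective a.1 := by
      intro a ha
      obtain ⟨x, -, rfl, h, -⟩ := hleafs a ha
      exact h
    -- all leaves together are large enough
    have htotal : q ≤ ((leafList D H).map Prod.snd).sum := by
      obtain ⟨S, hS, hsz, -⟩ := exists_union_of_pairwise (leafList D H) hdisj hlsize hleff
      rw [← hsz]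
      -- Every vertex other than the centre belongs to a leaf, so the leaves miss at most one of
      -- more than `q` vertices.
      have hsub : H.vertices ⊆ {c} ∪ S := by
        intro v hv
        rw [Finset.mem_union, Finset.mem_singleton]
        refine (hcover v hv).1.imp id fun hl => ?_
        exact (hS v).2 ⟨_, leaf_mem_leafList hH hl, self_mem_node v⟩
      have h1 := PickData.size_mono (D := D) hsub
      have h2 : D.size ({c} ∪ S) ≤ D.size {c} + D.size S := by
        rw [PickData.size, Finset.erase_union_distrib]
        exact Finset.card_union_le _ _
      have h3 := PickData.size_singleton_le (D := D) c
      omega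
    obtain ⟨p, rest, hl, hSmem, hSt, hout⟩ := takeLeaves_spec q (leafList D H) ∅ 0 (by omega)
    simp only [zero_add, Finset.notMem_empty, false_or] at hSmem hSt hout
    have hpl : ∀ a ∈ p, a ∈ leafList D H := fun a ha => by rw [hl]; exact List.mem_append_left _ ha
    have hpd : p.Pairwise fun a b => Disjoint a.1 b.1 := by
      rw [hl] at hdisj; exact (List.pairwise_append.1 hdisj).1
    obtain ⟨S, hS, hsz, hSeff⟩ := exists_union_of_pairwise p hpd
      (fun a ha => hlsize a (hpl a ha)) fun a ha => hleff a (hpl a ha)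
    have hSeq : (takeLeaves q ∅ 0 (leafList D H)).val.1 = S := by
      ext v; rw [hSmem, hS]
    have hSU : S ⊆ U := by
      intro v hv
      obtain ⟨a, ha, hva⟩ := (hS v).1 hv
      obtain ⟨x, hxV, rfl, -⟩ := hleafs a (hpl a ha)
      exact hVU (hH.node_subset hxV hva)
    -- the first leaf is always picked completely
    have hpne : p ≠ [] := by
      rintro rfl
      simp only [List.map_nil, List.sum_nil] at hout
      rcases hout with ⟨-, -, h | h⟩ | ⟨L, s, rest', hr, -, -, h⟩
      · rw [hl, h] at htotal
        simp at htotal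
        omega
      · omega
      · obtain ⟨x, -, hx, -, hle⟩ := hleafs (L, s) (by rw [hl, hr]; simp)
        obtain ⟨rfl, rfl⟩ := Prod.mk.inj hx
        omega
    -- A centre that is not a leaf is a single vertex; otherwise its node is the first leaf, which
    -- is part of `S`.
    have hcS : H.node c ⊆ S ∪ {c} := by
      rcases hcnode with h | ⟨a, ha, hac'⟩
      · rw [h]; exact Finset.subset_union_right
      · obtain ⟨b, p', rfl⟩ := List.exists_cons_of_ne_nil hpne
        have hab : a = b := by
          rw [hl] at ha
          simpa using ha.symm
        intro v hv
        refine Finset.mem_union_left _ ((hS v).2 ⟨b, List.mem_cons_self, ?_⟩)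
        rw [← hab, hac']
        exact hv
    -- whatever contains the node of `v` links it to the centre
    have hlink : ∀ v ∈ H.vertices, ∀ F, S ∪ {c} ⊆ F → H.node v ⊆ F →
        LinkedIn (EdgeJoined {e | e ∈ E}) F c v := by
      intro v hv F hF hvF
      rcases (hcover v hv).2 with h | ⟨a, ha, b, hb, hj⟩
      · exact node_linkedIn hinner (hcS.trans hF) (self_mem_node c) h
      · have h1 : LinkedIn (EdgeJoined {e | e ∈ E}) F c b :=
          node_linkedIn hinner (hcS.trans hF) (self_mem_node c) hb
        have h2 : LinkedIn (EdgeJoined {e | e ∈ E}) F a v :=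
          node_linkedIn hinner hvF ha (self_mem_node v)
        exact Relation.ReflTransGen.trans (h1.tail
          ⟨(hj.mono fun e he => hH.sub e (Or.inl he)).symm, hvF ha⟩) h2
    refine ⟨c, S, (p.map Prod.snd).sum, hVU hcV, hcl, hSU, hsz, hSeff, fun v hv => ?_, ?_⟩
    · obtain ⟨a, ha, hva⟩ := (hS v).1 hv
      obtain ⟨x, hxV, rfl, -⟩ := hleafs a (hpl a ha)
      refine hlink v (hH.node_subset hxV hva) _ le_rfl fun w hw => ?_
      rw [node_eq_of_mem hva] at hw
      exact Finset.mem_union_left _ ((hS w).2 ⟨_, ha, hw⟩)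
    · rcases hout with ⟨hnone, hle, hr⟩ | ⟨L, s, rest', hr, hsome, hlt, hgt⟩
      · left
        refine ⟨Prod.ext hSeq (Prod.ext hSt hnone), ?_⟩
        rcases hr with hr | hr
        · rw [hl, hr, List.append_nil] at htotal
          omega
        · exact hr
      · right
        have hLmem : (L, s) ∈ leafList D H := by rw [hl, hr]; simp
        obtain ⟨x, hxV, hx, hLeff, hLq⟩ := hleafs (L, s) hLmem
        obtain ⟨rfl, rfl⟩ := Prod.mk.inj hx
        refine ⟨H.node x, Prod.ext hSeq (Prod.ext hSt hsome), (hH.node_subset hxV).trans hVU, hlt,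
          hgt, ?_, hLeff, ?_, ?_, ?_⟩
        -- By the sorting, the overflowing leaf is no larger than the first picked one, hence no
        -- larger than `t`.
        · obtain ⟨b, p', rfl⟩ := List.exists_cons_of_ne_nil hpne
          rw [hl, hr] at hsort
          have := (List.pairwise_append.1 hsort).2.2 b List.mem_cons_self _ List.mem_cons_self
          simp only [List.map_cons, List.sum_cons]
          dsimp only at this
          omega
        · rw [Finset.disjoint_left]
          intro v hv
          obtain ⟨a, ha, hva⟩ := (hS v).1 hv
          rw [hl, hr] at hdisj
          have := (List.pairwise_append.1 hdisj).2.2 a ha _ List.mem_cons_self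
          exact Finset.disjoint_left.1 this hva
        -- A node is connected by its contracted edges, which belong to `E`. Thus the edges of `E`
        -- inside it span it, and the recursion can start from this uncontracted subtree.
        · intro u hu v hv
          refine ((mem_node.1 hu).symm.trans (mem_node.1 hv)).restrict (X := H.node x)
            (fun a b hab ha => mem_node.2 ((mem_node.1 ha).trans (.of_joined hab)))
            (fun e he h1 h2 => ?_) hu
          exact (mem_edgesInside _ _ _).2 ⟨hinner he, h1, h2⟩
        · intro v hv
          refine hlink v (hH.node_subset hxV hv) _ ?_ ?_
          · intro w hw
            simp only [Finset.mem_union] at hw ⊢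
            tauto
          · rw [node_eq_of_mem hv]
            intro w hw
            simp only [Finset.mem_union]
            tauto

theorem pickSpec_single (hcost : 0 ≤ D.totalCost) : ∀ (d q : ℕ) (U S : Finset (Fin n)) (E : List (Fin n × Fin n)) (c : Fin n), c ∈ U →
    S ⊆ U → D.size S = q → D.Effective S →
    (∀ v ∈ S, LinkedIn (EdgeJoined {e | e ∈ E}) (S ∪ {c}) c v) → PickSpec D d q U E (S, [c]) := by
  intro d q U S E c hc hSU hsz heff hlink
  refine ⟨hSU, by simpa using hc, by simp, hsz.ge, ?_, fun v hv => ⟨c, by simp, ?_⟩⟩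
  · rw [PickData.Effective, hsz] at heff
    refine heff.trans (mul_le_mul_of_nonneg_left ?_ hcost)
    have h3 : (0 : ℝ) ≤ 1 / 2 ^ d := by positivity
    nlinarith [(Nat.cast_nonneg q : (0 : ℝ) ≤ q)]
  · exact (hlink v hv).mono (fun _ _ h _ => h) (by simp)

/-- As `q ≤ 2 t`, the recursive call is responsible for at most half of the target, so its relative
excess counts only half. -/
lemma recursion_bound {q t : ℕ} (d : ℕ) (htq : t ≤ q) (hq : q ≤ 2 * t) :
    (t : ℝ) + ((q - t : ℕ) : ℝ) * (1 + 1 / 2 ^ d) ≤ q * (1 + 1 / 2 ^ (d + 1)) := by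
  have h1 : ((q - t : ℕ) : ℝ) = q - t := Nat.cast_sub htq
  have h2 : (q : ℝ) ≤ 2 * t := by exact_mod_cast hq
  have h3 : (1 : ℝ) / 2 ^ d = 2 * (1 / 2 ^ (d + 1)) := by
    rw [pow_succ]
    field_simp
  have h4 : (0 : ℝ) ≤ 1 / 2 ^ (d + 1) := by positivity
  rw [h1, h3]
  nlinarith [mul_nonneg h4 (sub_nonneg.2 h2)]

/-- The overflowing leaf `L` satisfies `|L| ≤ t < q < t + |L|`, where `t` vertices have been taken
so far, hence `q < 2 t`. At depth zero `L` is taken completely, which makes at most `2 q` vertices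
at the average price; at larger depth `recursion_bound` applies. Cost-effectiveness refers to the
whole contracted tree at all levels, so `L` meets the hypotheses of the recursive call. -/
theorem pick_spec (hcost : 0 ≤ D.totalCost) (depth : ℕ) :
    ∀ (q : ℕ) (U : Finset (Fin n)) (E : List (Fin n × Fin n)), 1 ≤ q → E.Nodup →
      EdgesIn {e | e ∈ E} U → EdgeAcyclic {e | e ∈ E} → E.length ≤ 2 * n →
      (∀ u ∈ U, ∀ v ∈ U, EdgeReach {e | e ∈ E} u v) → D.Effective U → q ≤ D.size U →
      PickSpec D depth q U E (pick D depth q U E).val := by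
  induction depth with
  | zero =>
    intro q U E hq hnd hEU hac hlen hconn heff hsize
    rw [pick_zero, pickWith_val]
    obtain ⟨h1, h2⟩ := pick_base hcost q U E hq hnd hEU hac hlen hconn heff hsize
    split_ifs with hs
    · exact h1 hs 0
    obtain ⟨c, S, t, hc, hcl, hSU, hsz, hSeff, hSl, h⟩ := h2 (not_le.1 hs)
    rcases h with ⟨htl, rfl⟩ | ⟨L, htl, hLU, htq, hqL, hLt, hLeff, hd, -, hLl⟩
    · rw [htl, hcl, pickTail_val]
      exact pickSpec_single hcost 0 t U S E c hc hSU hsz hSeff hSl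
    · rw [htl, hcl, pickTail_val]
      refine ⟨Finset.union_subset hSU hLU, by simpa using hc, by simp, ?_, ?_,
        fun v hv => ⟨c, by simp, ?_⟩⟩
      · rw [PickData.size_union hd]; omega
      · rw [PickData.Effective] at hSeff hLeff
        rw [PickData.weight_union hd]
        have h3 : (D.size S : ℝ) ≤ q := by exact_mod_cast (by omega : D.size S ≤ q)
        have h4 : (D.size L : ℝ) ≤ q := by exact_mod_cast (by omega : D.size L ≤ q)
        have h5 := mul_le_mul_of_nonneg_left h3 hcost
        have h6 := mul_le_mul_of_nonneg_left h4 hcost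
        simp only [pow_zero]
        linarith
      · rcases Finset.mem_union.1 hv with hv | hv
        · refine (hSl v hv).mono (fun _ _ h _ => h) ?_
          intro w hw
          simp only [Finset.mem_union, Finset.mem_singleton, List.toFinset_cons,
            List.toFinset_nil, Finset.mem_insert] at hw ⊢
          tauto
        · exact (hLl v hv).mono (fun _ _ h _ => h) (by simp)
  | succ depth ih =>
    intro q U E hq hnd hEU hac hlen hconn heff hsize
    rw [pick_succ, pickWith_val]
    obtain ⟨h1, h2⟩ := pick_base hcost q U E hq hnd hEU hac hlen hconn heff hsize
    split_ifs with hs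
    · exact h1 hs _
    obtain ⟨c, S, t, hc, hcl, hSU, hsz, hSeff, hSl, h⟩ := h2 (not_le.1 hs)
    rcases h with ⟨htl, rfl⟩ | ⟨L, htl, hLU, htq, hqL, hLt, hLeff, hd, hLc, -⟩
    · rw [htl, hcl, pickTail_val]
      exact pickSpec_single hcost _ t U S E c hc hSU hsz hSeff hSl
    · rw [htl, hcl, pickTail_val]
      have hELE : {e | e ∈ (edgesInside L E).val} ⊆ {e | e ∈ E} :=
        fun e he => ((mem_edgesInside _ _ _).1 he).1
      have hrec := ih (q - t) L (edgesInside L E).val (by omega)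
        (hnd.sublist (edgesInside_sublist _ _))
        (fun e he => ((mem_edgesInside _ _ _).1 he).2) (hac.mono hELE)
        ((edgesInside_sublist L E).length_le.trans hlen) hLc hLeff (by omega)
      obtain ⟨Y, hY⟩ : ∃ Y, (pick D depth (q - t) L (edgesInside L E).val).val = Y := ⟨_, rfl⟩
      rw [hY] at hrec
      dsimp only
      rw [hY]
      have hd' : Disjoint S Y.1 := hd.mono_right hrec.subset
      refine ⟨Finset.union_subset hSU (hrec.subset.trans hLU), ?_, ?_, ?_, ?_, ?_⟩
      · intro v hv
        rcases List.mem_append.1 hv with hv | hv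
        · rw [List.mem_singleton] at hv
          exact hv ▸ hc
        · exact hLU (hrec.centers v hv)
      · have := hrec.length
        simp only [List.length_append, List.length_singleton]
        omega
      · have := hrec.large
        dsimp only
        rw [PickData.size_union hd']
        omega
      · rw [PickData.Effective, hsz] at hSeff
        have h4 := hrec.weight
        dsimp only
        rw [PickData.weight_union hd', add_mul]
        refine (add_le_add hSeff h4).trans ?_
        rw [← mul_add]
        exact mul_le_mul_of_nonneg_left (recursion_bound depth htq.le (by omega)) hcost
      · intro v hv
        have hELj : ∀ a b, EdgeJoined {e | e ∈ (edgesInside L E).val} a b →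
            EdgeJoined {e | e ∈ E} a b := fun a b hab => hab.mono hELE
        rcases Finset.mem_union.1 hv with hv | hv
        · refine ⟨c, by simp, (hSl v hv).mono (fun _ _ h _ => h) ?_⟩
          intro w hw
          simp only [Finset.mem_union, Finset.mem_singleton, List.mem_toFinset,
            List.mem_append, List.mem_singleton] at hw ⊢
          tauto
        · obtain ⟨c', hc', hl⟩ := hrec.linked v hv
          refine ⟨c', by simp [hc'], hl.mono (fun a b h _ => hELj a b h) ?_⟩
          intro w hw
          simp only [Finset.mem_union, List.mem_toFinset, List.mem_append,
            List.mem_singleton] at hw ⊢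
          tauto

end

/-! ### Merging the two trees. -/

section

variable {n : ℕ}

theorem length_spanningTree_le (adj : Fin n → Fin n → Timed Bool) (B : Finset (Fin n))
    (root : Fin n) : (spanningTree adj B root).val.length ≤ n := by
  rw [spanningTree_val]
  have key : ∀ m, ((fun s => (growTree adj B s).val)^[m] ({root}, [])).2.length ≤ m := by
    intro m
    induction m with
    | zero => simp
    | succ m ih =>
      rw [Function.iterate_succ_apply']
      rcases growTree_cases adj B ((fun s => (growTree adj B s).val)^[m] ({root}, [])) with
        ⟨h, -⟩ | ⟨e, -, -, -, -, h⟩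
      · rw [h]; omega
      · rw [h, List.length_cons]; omega
  exact key n

theorem contractedAdj_val (G : SimpleGraph (Fin n)) (M : Finset (Fin n)) (root a b : Fin n) :
    (contractedAdj G M root a b).val = true ↔ (a ≠ root ∧ b ≠ root ∧ G.Adj a b) ∨
      (a = root ∧ b ≠ root ∧ ∃ u ∈ M, G.Adj u b) ∨ (b = root ∧ a ≠ root ∧ ∃ u ∈ M, G.Adj u a) := by
  simp only [contractedAdj, Timed.val_bind, Timed.val_test, Timed.val_anyVertex, Timed.val_pure,
    Bool.or_eq_true, decide_eq_true_eq, or_assoc, exists_and_left]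

theorem contractedAdj_symm {G : SimpleGraph (Fin n)} {M : Finset (Fin n)} {root a b : Fin n}
    (h : (contractedAdj G M root a b).val = true) : (contractedAdj G M root b a).val = true := by
  rw [contractedAdj_val] at h ⊢
  rcases h with ⟨h1, h2, h3⟩ | h | h
  exacts [Or.inl ⟨h2, h1, h3.symm⟩, Or.inr (Or.inr h), Or.inr (Or.inl h)]

/-- Contracting `T₁ ∩ T₂` in a connected set `T₂` leaves a connected graph. -/
theorem linkedIn_contracted {G : SimpleGraph (Fin n)} {root : Fin n} {T₁ T₂ : Finset (Fin n)}
    (h₁ : root ∈ T₁) (h₂ : IsRootedConnected G root T₂) {v : Fin n}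
    (hv : v ∈ insert root (T₂ \ T₁)) :
    LinkedIn (fun a b => (contractedAdj G (T₁ ∩ T₂) root a b).val = true)
      (insert root (T₂ \ T₁)) root v := by
  rcases Finset.mem_insert.1 hv with rfl | hv'
  · exact .refl
  have hroot : ∀ w ∈ T₂ \ T₁, w ≠ root := fun w hw h => (Finset.mem_sdiff.1 hw).2 (h ▸ h₁)
  have hl := ((isRootedConnected_iff G root T₂).1 h₂).2 v (Finset.mem_sdiff.1 hv').1
  have key : v ∈ T₂ ∧ (v ∈ T₂ \ T₁ →
      LinkedIn (fun a b => (contractedAdj G (T₁ ∩ T₂) root a b).val = true)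
        (insert root (T₂ \ T₁)) root v) := by
    clear hv hv'
    induction hl with
    | refl => exact ⟨h₂.1, fun _ => .refl⟩
    | @tail a b _ hab ih =>
      refine ⟨hab.2, fun hb => ?_⟩
      -- An edge of `T₂` that leaves `T₁` starts in `T₁ ∩ T₂`, that is, at the contracted vertex,
      -- and so does not need the walk before it.
      by_cases ha : a ∈ T₁
      · refine Relation.ReflTransGen.single ⟨(contractedAdj_val ..).2 (Or.inr (Or.inl
          ⟨rfl, hroot b hb, a, Finset.mem_inter.2 ⟨ha, ih.1⟩, hab.1⟩)), Finset.mem_insert_of_mem hb⟩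
      · have ha' := Finset.mem_sdiff.2 ⟨ih.1, ha⟩
        exact (ih.2 ha').tail ⟨(contractedAdj_val ..).2 (Or.inl
          ⟨hroot a ha', hroot b hb, hab.1⟩), Finset.mem_insert_of_mem hb⟩
  exact key.2 hv'

theorem foldList_insert_val (l : List (Fin n)) (X : Finset (Fin n)) :
    (Timed.foldList (fun Y v => Timed.op (insert v Y)) X l).val = X ∪ l.toFinset := by
  rw [Timed.val_foldList]
  induction l generalizing X with
  | nil => simp
  | cons a l ih =>
    rw [List.foldl_cons, ih]
    ext v
    simp only [Timed.val_op, Finset.mem_union, Finset.mem_insert, List.toFinset_cons]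
    tauto

/-- The vertex list that `paths` assigns to `x`. -/
def pathList (paths : Fin n → Option (List (Fin n) × ℝ)) (x : Fin n) : List (Fin n) :=
  match paths x with
  | none => []
  | some (P, _) => P

theorem mem_foldl_paths (f : Fin n → List (Fin n)) (l : List (Fin n)) (X : Finset (Fin n))
    (v : Fin n) :
    v ∈ l.foldl (fun X x => X ∪ (f x).toFinset) X ↔ v ∈ X ∨ ∃ x ∈ l, v ∈ f x := by
  induction l generalizing X with
  | nil => simp
  | cons a l ih =>
    rw [List.foldl_cons, ih]
    simp only [Finset.mem_union, List.mem_toFinset, List.mem_cons, exists_eq_or_imp, or_assoc]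

/-- The bound on a path is required relative to every `Z ⊇ Y`, because the set already bought grows
from path to path. -/
theorem sum_foldl_paths_le {cost : Fin n → ℝ} {D : ℝ} (f : Fin n → List (Fin n))
    (l : List (Fin n)) (X Y : Finset (Fin n)) (hYX : Y ⊆ X)
    (h : ∀ x ∈ l, ∀ Z, Y ⊆ Z → ∑ w ∈ (f x).toFinset \ Z, cost w ≤ D) :
    ∑ v ∈ l.foldl (fun X x => X ∪ (f x).toFinset) X, cost v ≤ ∑ v ∈ X, cost v + l.length * D := by
  induction l generalizing X with
  | nil => simp
  | cons a l ih =>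
    rw [List.foldl_cons]
    refine (ih (X ∪ (f a).toFinset) (hYX.trans Finset.subset_union_left)
      fun x hx => h x (List.mem_cons_of_mem _ hx)).trans ?_
    have h1 := h a List.mem_cons_self X hYX
    have h2 : ∑ v ∈ X ∪ (f a).toFinset, cost v =
        ∑ v ∈ X, cost v + ∑ v ∈ (f a).toFinset \ X, cost v := by
      rw [← Finset.union_sdiff_self_eq_union, Finset.sum_union Finset.disjoint_sdiff]
    rw [h2, List.length_cons]
    push_cast
    linarith

/-- The data that `mergeTrees` hands over to `pick`. -/
noncomputable def mergeData (cost : Fin n → ℝ) (root : Fin n) (R : Finset (Fin n)) : PickData n where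
  cost := cost
  root := root
  totalCost := ∑ v ∈ R, cost v
  totalSize := R.card

theorem mergeTrees_val (G : SimpleGraph (Fin n)) (cost : Fin n → ℝ) (root : Fin n) (k depth : ℕ)
    (paths : Fin n → Option (List (Fin n) × ℝ)) (T₁ T₂ : Finset (Fin n)) :
    (mergeTrees G cost root k depth paths T₁ T₂).val =
      let out := (pick (mergeData cost root (T₂ \ T₁)) depth (k - T₁.card)
        (insert root (T₂ \ T₁)) (spanningTree (contractedAdj G (T₁ ∩ T₂) root)
          (insert root (T₂ \ T₁)) root).val).val
      out.2.foldl (fun X x => X ∪ (pathList paths x).toFinset) (T₁ ∪ out.1) := by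
  have hM : (Timed.vertexSet fun v => Timed.test (v ∈ T₁ ∧ v ∈ T₂)).val = T₁ ∩ T₂ := by
    ext v; simp
  have hR : (Timed.vertexSet fun v => Timed.test (v ∈ T₂ ∧ v ∉ T₁)).val = T₂ \ T₁ := by
    ext v; simp
  have hU : (Timed.vertexSet fun v => Timed.test (v = root ∨ v ∈ T₂ \ T₁)).val =
      insert root (T₂ \ T₁) := by
    ext v
    rw [Timed.mem_vertexSet]
    simp only [Timed.val_test, decide_eq_true_eq, Finset.mem_insert]
  have hC : (Timed.sumVertices fun v => Timed.op (if v ∈ T₂ \ T₁ then cost v else 0)).val =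
      ∑ v ∈ T₂ \ T₁, cost v := by
    rw [Timed.val_sumVertices]
    simp only [Timed.val_op]
    rw [Finset.sum_ite_mem, Finset.univ_inter]
  have hS : ∀ S, (Timed.vertexSet fun v => Timed.test (v ∈ T₁ ∨ v ∈ S)).val = T₁ ∪ S := by
    intro S; ext v; simp
  simp only [mergeTrees, Timed.val_bind, hM, hR, hU, hC, hS, Timed.val_card]
  rw [Timed.val_foldList]
  simp only [foldList_insert_val]
  rfl

/-- The merged tree is a solution; its cost exceeds that of `T₁` by little more than the share
`(k - |T₁|) / |T₂ \ T₁|` of the cost of `T₂ \ T₁`, and the cost of the paths. -/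
theorem mergeTrees_spec {G : SimpleGraph (Fin n)} {cost : Fin n → ℝ} (hc : ∀ v, 0 ≤ cost v)
    {root : Fin n} {k : ℕ} (depth : ℕ) {paths : Fin n → Option (List (Fin n) × ℝ)}
    {T₁ T₂ U : Finset (Fin n)} {D : ℝ} (h₁ : IsRootedConnected G root T₁)
    (h₂ : IsRootedConnected G root T₂) (hU : U ⊆ T₁) (hD : 0 ≤ D)
    (hpaths : ∀ v ∈ T₂, ∃ i P d, paths v = some (P, d) ∧ WalkTo G cost U i v P d ∧ d ≤ D)
    (hk₁ : T₁.card < k) (hk₂ : k ≤ T₂.card) :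
    IsKSolution G root k (mergeTrees G cost root k depth paths T₁ T₂).val ∧
      ∃ p : ℝ, p * (T₂ \ T₁).card ≤
          (∑ v ∈ T₂ \ T₁, cost v) * ((k - T₁.card : ℕ) * (1 + 1 / 2 ^ depth)) ∧
        ∑ v ∈ (mergeTrees G cost root k depth paths T₁ T₂).val, cost v ≤
          ∑ v ∈ T₁, cost v + p + (depth + 1) * D := by
  have hr₁ := h₁.1
  have hmem : root ∉ T₂ \ T₁ := fun h => (Finset.mem_sdiff.1 h).2 hr₁
  have hE := spanningTree_spec (contractedAdj G (T₁ ∩ T₂) root) (insert root (T₂ \ T₁)) root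
    (Finset.mem_insert_self _ _) fun v hv => linkedIn_contracted hr₁ h₂ hv
  have hElen := length_spanningTree_le (contractedAdj G (T₁ ∩ T₂) root)
    (insert root (T₂ \ T₁)) root
  have hsize : (mergeData cost root (T₂ \ T₁)).size (insert root (T₂ \ T₁)) = (T₂ \ T₁).card := by
    change ((insert root (T₂ \ T₁)).erase root).card = _
    rw [Finset.erase_insert hmem]
  have hweight : (mergeData cost root (T₂ \ T₁)).weight (insert root (T₂ \ T₁)) =
      ∑ v ∈ T₂ \ T₁, cost v := by
    change ∑ v ∈ (insert root (T₂ \ T₁)).erase root, cost v = _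
    rw [Finset.erase_insert hmem]
  -- Thus `T₂ \ T₁` has at least `k - |T₁|` vertices, and the target is within reach.
  have hcard := Finset.le_card_sdiff T₁ T₂
  have hspec := pick_spec (D := mergeData cost root (T₂ \ T₁))
    (Finset.sum_nonneg fun v _ => hc v) depth (k - T₁.card) (insert root (T₂ \ T₁)) _
    (by omega) hE.nodup hE.edgesIn hE.acyclic (by omega) hE.conn
    (by
      rw [PickData.Effective, hsize, hweight]
      exact le_of_eq rfl) (by rw [hsize]; omega)
  rw [mergeTrees_val]
  dsimp only
  obtain ⟨Y, hY⟩ : ∃ Y, (pick (mergeData cost root (T₂ \ T₁)) depth (k - T₁.card)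
        (insert root (T₂ \ T₁)) (spanningTree (contractedAdj G (T₁ ∩ T₂) root)
          (insert root (T₂ \ T₁)) root).val).val = Y := ⟨_, rfl⟩
  rw [hY] at hspec ⊢
  obtain ⟨hsub, hcen, hlen, hlarge, hw, hlink⟩ := hspec
  set F := Y.2.foldl (fun X x => X ∪ (pathList paths x).toFinset) (T₁ ∪ Y.1) with hF
  have hmemF : ∀ v, v ∈ F ↔ v ∈ T₁ ∪ Y.1 ∨ ∃ x ∈ Y.2, v ∈ pathList paths x := fun v =>
    mem_foldl_paths _ _ _ v
  have hwalk : ∀ x ∈ Y.2, ∃ i d, WalkTo G cost U i x (pathList paths x) d ∧ d ≤ D := by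
    intro x hx
    have hx₂ : x ∈ T₂ := by
      rcases Finset.mem_insert.1 (hcen x hx) with rfl | h
      · exact h₂.1
      · exact (Finset.mem_sdiff.1 h).1
    obtain ⟨i, P, d, h, hP, hd⟩ := hpaths x hx₂
    have : pathList paths x = P := by rw [pathList, h]
    exact ⟨i, d, this ▸ hP, hd⟩
  have hTF : T₁ ⊆ F := fun v hv => (hmemF v).2 (Or.inl (Finset.mem_union_left _ hv))
  have hYF : Y.1 ⊆ F := fun v hv => (hmemF v).2 (Or.inl (Finset.mem_union_right _ hv))
  have hl₁ : ∀ v ∈ T₁, LinkedIn G.Adj F root v := fun v hv =>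
    (((isRootedConnected_iff G root T₁).1 h₁).2 v hv).mono (fun _ _ h _ => h) hTF
  have hlP : ∀ x ∈ Y.2, ∀ v ∈ pathList paths x, LinkedIn G.Adj F root v := by
    intro x hx
    obtain ⟨i, d, hP, -⟩ := hwalk x hx
    exact hP.linkedIn (fun u hu => hl₁ u (hU hu)) fun w hw => (hmemF w).2 (Or.inr ⟨x, hx, hw⟩)
  have hlc : ∀ x ∈ Y.2, LinkedIn G.Adj F root x := by
    intro x hx
    obtain ⟨i, d, hP, -⟩ := hwalk x hx
    exact hlP x hx x hP.head_mem
  have hlY : ∀ v ∈ Y.1, LinkedIn G.Adj F root v := by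
    intro v hv
    obtain ⟨c, hc', hl⟩ := hlink v hv
    clear hv
    induction hl with
    | refl => exact hlc c hc'
    | @tail a b _ hab ih =>
      have hbF : b ∈ F := by
        rcases Finset.mem_union.1 hab.2 with hb | hb
        · exact hYF hb
        · exact (hlc b (List.mem_toFinset.1 hb)).mem (hTF hr₁)
      have hadj : (contractedAdj G (T₁ ∩ T₂) root a b).val = true := by
        rcases hab.1 with h | h
        · exact hE.adj _ h
        · exact contractedAdj_symm (hE.adj _ h)
      -- A tree edge is an edge of `G`, or it leaves the contracted vertex and comes from an edge of
      -- `G` at a vertex of `T₁`, or it ends at the root. In each case its end is linked to the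
      -- root.
      rcases (contractedAdj_val ..).1 hadj with ⟨-, -, h⟩ | ⟨-, -, u, hu, h⟩ | ⟨h, -⟩
      · exact ih.tail ⟨h, hbF⟩
      · exact (hl₁ u (Finset.mem_inter.1 hu).1).tail ⟨h, hbF⟩
      · exact h ▸ .refl
  refine ⟨⟨(isRootedConnected_iff G root F).2 ⟨hTF hr₁, fun v hv => ?_⟩, ?_⟩,
    (mergeData cost root (T₂ \ T₁)).weight Y.1, hw, ?_⟩
  · rcases (hmemF v).1 hv with hv | ⟨x, hx, hv⟩
    · rcases Finset.mem_union.1 hv with hv | hv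
      exacts [hl₁ v hv, hlY v hv]
    · exact hlP x hx v hv
  -- The root stands for the contracted set; it may be picked but is not counted, so the counted
  -- vertices are new.
  · have hdisj : Disjoint T₁ (Y.1.erase root) := by
      rw [Finset.disjoint_left]
      intro v hv₁ hv
      rcases Finset.mem_insert.1 (hsub (Finset.mem_of_mem_erase hv)) with h | h
      · exact Finset.ne_of_mem_erase hv h
      · exact (Finset.mem_sdiff.1 h).2 hv₁
    have hle : (T₁ ∪ Y.1.erase root).card ≤ F.card :=
      Finset.card_le_card (Finset.union_subset hTF ((Finset.erase_subset _ _).trans hYF))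
    rw [Finset.card_union_of_disjoint hdisj] at hle
    have : k - T₁.card ≤ (Y.1.erase root).card := hlarge
    omega
  · have h := sum_foldl_paths_le (cost := cost) (D := D) (pathList paths) Y.2 (T₁ ∪ Y.1) U
      (hU.trans Finset.subset_union_left) fun x hx Z hZ => by
        obtain ⟨i, d, hP, hd⟩ := hwalk x hx
        exact (hP.sum_sdiff_le hc hZ).trans hd
    have h' : ∑ v ∈ T₁ ∪ Y.1, cost v ≤
        ∑ v ∈ T₁, cost v + (mergeData cost root (T₂ \ T₁)).weight Y.1 := by
      have : T₁ ∪ Y.1 ⊆ T₁ ∪ Y.1.erase root := by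
        intro v hv
        rw [Finset.mem_union, Finset.mem_erase]
        by_cases hvr : v = root
        · exact Or.inl (hvr ▸ hr₁)
        · exact (Finset.mem_union.1 hv).imp_right fun h => ⟨hvr, h⟩
      refine (Finset.sum_le_sum_of_subset_of_nonneg this fun v _ _ => hc v).trans ?_
      change _ ≤ ∑ v ∈ T₁, cost v + ∑ v ∈ Y.1.erase root, cost v
      rw [← Finset.sum_union_inter]
      exact le_add_of_nonneg_right (Finset.sum_nonneg fun v _ => hc v)
    have hlenR : (Y.2.length : ℝ) ≤ depth + 1 := by exact_mod_cast hlen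
    have := mul_le_mul_of_nonneg_right hlenR hD
    linarith

end

/-! ### The Lagrangian search, and the factor `4/3`. -/

section

variable {n : ℕ}

/-- The vertices with a walk of weight at most `D` to `U`. -/
noncomputable def nearSet (G : SimpleGraph (Fin n)) (cost : Fin n → ℝ) (U : Finset (Fin n)) (D : ℝ) :
    Finset (Fin n) :=
  (Timed.vertexSet fun v =>
    Timed.test (∃ P d, (pathsTo G cost U).val v = some (P, d) ∧ d ≤ D)).val

theorem mem_nearSet {G : SimpleGraph (Fin n)} {cost : Fin n → ℝ} {U : Finset (Fin n)} {D : ℝ}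
    {v : Fin n} : v ∈ nearSet G cost U D ↔
      ∃ P d, (pathsTo G cost U).val v = some (P, d) ∧ d ≤ D := by
  rw [nearSet, Timed.mem_vertexSet]
  simp only [Timed.val_test, decide_eq_true_eq]

/-- The instance to which moat growing is applied for the multiplier `lam`. -/
noncomputable def lagrangeInstance (G : SimpleGraph (Fin n)) (cost : Fin n → ℝ) (root : Fin n)
    (A W : Finset (Fin n)) (lam : ℝ) : PrizeInstance n where
  graph := G
  alive := A
  forced := W
  cost := cost
  penalty := fun _ => lam
  root := root

/-- One step of the binary search. -/
noncomputable def searchStep (G : SimpleGraph (Fin n)) (cost : Fin n → ℝ) (root : Fin n) (k : ℕ)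
    (A W : Finset (Fin n)) (s : SearchState n) : Timed (SearchState n) := do
  let sizeHi ← Timed.card s.treeHi
  let lucky ← Timed.test (sizeHi = k)
  if lucky then pure s else do
  let mid := (s.lo + s.hi) / 2
  let T ← moatGrowing (lagrangeInstance G cost root A W mid)
  let size ← Timed.card T
  let less ← Timed.test (size < k)
  return if less then { s with lo := mid, treeLo := T } else { s with hi := mid, treeHi := T }

theorem searchStep_val (G : SimpleGraph (Fin n)) (cost : Fin n → ℝ) (root : Fin n) (k : ℕ)
    (A W : Finset (Fin n)) (s : SearchState n) :
    (searchStep G cost root k A W s).val = if s.treeHi.card = k then s else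
      if (moatGrowing (lagrangeInstance G cost root A W ((s.lo + s.hi) / 2))).val.card < k then
        { s with
          lo := (s.lo + s.hi) / 2
          treeLo := (moatGrowing (lagrangeInstance G cost root A W ((s.lo + s.hi) / 2))).val }
      else
        { s with
          hi := (s.lo + s.hi) / 2
          treeHi := (moatGrowing (lagrangeInstance G cost root A W ((s.lo + s.hi) / 2))).val } := by
  simp only [searchStep, Timed.val_bind, Timed.val_card, Timed.val_test, decide_eq_true_eq]
  split_ifs with h1 h2
  · rfl
  · simp [h2]
  · simp [h2]

/-- The candidates of an undiscarded guess, after the tree for the multiplier `0`. -/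
noncomputable def searchAndMerge (δ : ℝ) (G : SimpleGraph (Fin n)) (cost : Fin n → ℝ) (root : Fin n)
    (k : ℕ) (g : ℝ) (W : Finset (Fin n)) (paths : Fin n → Option (List (Fin n) × ℝ))
    (A T₀ : Finset (Fin n)) : Timed (List (Finset (Fin n))) := do
  let top : ℝ := if g = 0 then 1 else (n + 1) * g
  let T ← moatGrowing (lagrangeInstance G cost root A W top)
  Timed.charge ⌈3 * n * (n + 1) / δ⌉₊
  let s ← Timed.iterate (Nat.clog 2 ⌈3 * n * (n + 1) / δ⌉₊) (searchStep G cost root k A W)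
    { lo := 0, hi := top, treeLo := T₀, treeHi := T }
  let sizeHi ← Timed.card s.treeHi
  let lucky ← Timed.test (sizeHi = k)
  if lucky then pure [s.treeHi] else do
  let merged ← mergeTrees G cost root k (Nat.clog 2 ⌈4 / δ⌉₊) paths s.treeLo s.treeHi
  pure [merged, s.treeHi]

theorem solveGuess_eq (δ : ℝ) (G : SimpleGraph (Fin n)) (cost : Fin n → ℝ) (root : Fin n) (k : ℕ)
    (g : ℝ) (W : Finset (Fin n)) : solveGuess δ G cost root k g W = (do
      let U ← Timed.vertexSet fun v => Timed.test (v = root ∨ v ∈ W)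
      let paths ← pathsTo G cost U
      let A ← Timed.vertexSet fun v => Timed.test (∃ P d, paths v = some (P, d) ∧ d ≤ δ * g)
      let cheap ← Timed.allVertices fun v => Timed.test (v ∈ U → cost v ≤ g)
      let comp ← reach (graphAdj G) A root
      let conn ← Timed.allVertices fun v => Timed.test (v ∈ A → v ∈ comp)
      let sizeA ← Timed.card A
      let enough ← Timed.test (k ≤ sizeA)
      if !(cheap && conn && enough) then pure [] else do
      let T₀ ← moatGrowing (lagrangeInstance G cost root A W 0)
      let size₀ ← Timed.card T₀
      let done ← Timed.test (k ≤ size₀)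
      if done then pure [T₀] else searchAndMerge δ G cost root k g W paths A T₀) := rfl

theorem solveGuess_val {δ : ℝ} {G : SimpleGraph (Fin n)} {cost : Fin n → ℝ} {root : Fin n} {k : ℕ}
    {g : ℝ} {W A : Finset (Fin n)} (hA : A = nearSet G cost (insert root W) (δ * g))
    (hcheap : ∀ v ∈ insert root W, cost v ≤ g) (hconn : IsRootedConnected G root A)
    (hk : k ≤ A.card) :
    (solveGuess δ G cost root k g W).val =
      if k ≤ (moatGrowing (lagrangeInstance G cost root A W 0)).val.card then
        [(moatGrowing (lagrangeInstance G cost root A W 0)).val]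
      else (searchAndMerge δ G cost root k g W (pathsTo G cost (insert root W)).val A
        (moatGrowing (lagrangeInstance G cost root A W 0)).val).val := by
  have hU : (Timed.vertexSet fun v => Timed.test (v = root ∨ v ∈ W)).val = insert root W := by
    ext v
    rw [Timed.mem_vertexSet]
    simp only [Timed.val_test, decide_eq_true_eq, Finset.mem_insert]
  have hN : (Timed.vertexSet fun v => Timed.test
      (∃ P d, (pathsTo G cost (insert root W)).val v = some (P, d) ∧ d ≤ δ * g)).val = A :=
    hA.symm
  have h1 : (Timed.allVertices fun v => Timed.test (v ∈ insert root W → cost v ≤ g)).val = true := by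
    simp only [Timed.val_allVertices, Timed.val_test, decide_eq_true_eq]
    exact hcheap
  have h2 : (Timed.allVertices fun v => Timed.test
      (v ∈ A → v ∈ (reach (graphAdj G) A root).val)).val = true := by
    simp only [Timed.val_allVertices, Timed.val_test, decide_eq_true_eq]
    exact fun v hv => (mem_reach_graphAdj G A root v).2
      ⟨hconn.1, ((isRootedConnected_iff G root A).1 hconn).2 v hv⟩
  have h3 : (Timed.test (k ≤ A.card)).val = true := by
    simp only [Timed.val_test, decide_eq_true_eq]
    exact hk
  rw [solveGuess_eq]
  simp only [Timed.val_bind, hU, hN, h1, h2, h3, Timed.val_card]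
  simp only [Timed.val_test, Bool.and_self, Bool.not_true, Bool.false_eq_true, if_false,
    decide_eq_true_eq, Timed.val_bind, Timed.val_card]
  split_ifs <;> rfl

theorem searchAndMerge_val (δ : ℝ) (G : SimpleGraph (Fin n)) (cost : Fin n → ℝ) (root : Fin n)
    (k : ℕ) (g : ℝ) (W : Finset (Fin n)) (paths : Fin n → Option (List (Fin n) × ℝ))
    (A T₀ : Finset (Fin n)) (top : ℝ) (htop : top = if g = 0 then 1 else (n + 1) * g) :
    (searchAndMerge δ G cost root k g W paths A T₀).val =
      let s := (fun s => (searchStep G cost root k A W s).val)^[Nat.clog 2 ⌈3 * n * (n + 1) / δ⌉₊]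
        { lo := 0, hi := top, treeLo := T₀,
          treeHi := (moatGrowing (lagrangeInstance G cost root A W top)).val }
      if s.treeHi.card = k then [s.treeHi] else
        [(mergeTrees G cost root k (Nat.clog 2 ⌈4 / δ⌉₊) paths s.treeLo s.treeHi).val, s.treeHi] := by
  subst htop
  simp only [searchAndMerge, Timed.val_bind, Timed.val_iterate, Timed.val_card, Timed.val_test,
    decide_eq_true_eq]
  split_ifs <;> rfl

/-- What the Lagrangian relaxation guarantees for the tree `T` of the multiplier `lam`, if `c` is the
cost of a solution of the `k`-MST instance. -/
structure IsLagrangeTree (G : SimpleGraph (Fin n)) (cost : Fin n → ℝ) (root : Fin n) (k : ℕ)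
    (A W : Finset (Fin n)) (r c lam : ℝ) (T : Finset (Fin n)) : Prop where
  conn : IsRootedConnected G root T
  forced : W ⊆ T
  alive : T ⊆ A
  sum_le : ∑ v ∈ T, cost v ≤ r * (c + lam * (T.card - k))

/-- For uniform penalties, `r λ |A|` cancels from the LMP inequality, which leaves `c(T) ≤ r (c(X) +
λ (|T| - |X|))`, and `|X| ≥ k`. If `λ` exceeds the cost of `A`, comparison with `A` shows that no
vertex can be omitted: its penalty alone would count `r λ > r c(A)`. -/
theorem isLagrangeTree_moatGrowing {𝒢 : ∀ n : ℕ, Set (SimpleGraph (Fin n))} {r : ℝ}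
    (h : HasLMPRatio 𝒢 r) {G : SimpleGraph (Fin n)} (hG : G ∈ 𝒢 n) {cost : Fin n → ℝ}
    (hc : ∀ v, 0 ≤ cost v) {root : Fin n} {k : ℕ} {A W X : Finset (Fin n)}
    (hA : IsRootedConnected G root A) (hX : IsKSolution G root k X) (hWX : W ⊆ X) (hXA : X ⊆ A)
    {lam : ℝ} (hlam : 0 ≤ lam) :
    IsLagrangeTree G cost root k A W r (∑ v ∈ X, cost v) lam
        (moatGrowing (lagrangeInstance G cost root A W lam)).val ∧
      (∑ v ∈ A, cost v < lam → (moatGrowing (lagrangeInstance G cost root A W lam)).val = A) := by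
  have hr := h.one_le hG root
  obtain ⟨h1, h2, h3, h4⟩ := HasLMPRatio.moatGrowing h
    (I := lagrangeInstance G cost root A W lam) hG hc (fun _ => hlam) (hWX.trans hXA) hA
  set T := (moatGrowing (lagrangeInstance G cost root A W lam)).val
  have h3' : T ⊆ A := h3
  have hsum : ∀ Y ⊆ A, ∑ v ∈ A \ Y, (lagrangeInstance G cost root A W lam).penalty v =
      lam * (A.card - Y.card) := by
    intro Y hY
    change ∑ v ∈ A \ Y, lam = _
    rw [Finset.sum_const, nsmul_eq_mul, Finset.cast_card_sdiff hY, mul_comm]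
  have key : ∀ Y, IsRootedConnected G root Y → W ⊆ Y → Y ⊆ A →
      ∑ v ∈ T, cost v + r * (lam * (A.card - T.card)) ≤
        r * (∑ v ∈ Y, cost v + lam * (A.card - Y.card)) := by
    intro Y hY1 hY2 hY3
    have := h4 Y hY1 hY2 hY3
    rwa [← hsum T h3', ← hsum Y hY3]
  refine ⟨⟨h1, h2, h3, ?_⟩, fun hlt => ?_⟩
  · have h5 := key X hX.1 hWX hXA
    have h6 : (k : ℝ) ≤ X.card := by exact_mod_cast hX.2
    have h7 : 0 ≤ r * lam * (X.card - k) :=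
      mul_nonneg (mul_nonneg (by linarith) hlam) (by linarith)
    nlinarith
  · refine Finset.Subset.antisymm h3' ?_
    rw [← Finset.sdiff_eq_empty_iff_subset]
    by_contra hne
    have h5 := key A hA (hWX.trans hXA) subset_rfl
    rw [sub_self, mul_zero, add_zero] at h5
    have h6 : (1 : ℝ) ≤ A.card - T.card := by
      rw [← Finset.cast_card_sdiff h3']
      exact_mod_cast Finset.card_pos.2 (Finset.nonempty_iff_ne_empty.2 hne)
    have h7 : 0 ≤ ∑ v ∈ T, cost v := Finset.sum_nonneg fun v _ => hc v
    have h8 : lam ≤ lam * (A.card - T.card) := le_mul_of_one_le_right hlam h6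
    have h9 : r * lam ≤ r * (lam * (A.card - T.card)) :=
      mul_le_mul_of_nonneg_left h8 (by linarith)
    have h10 : r * ∑ v ∈ A, cost v < r * lam := mul_lt_mul_of_pos_left hlt (by linarith)
    linarith

/-- The binary search keeps a small tree for the lower and a large tree for the upper multiplier, and
halves the distance of the multipliers unless a tree with `k` vertices has been found. -/
theorem iterate_searchStep {G : SimpleGraph (Fin n)} {cost : Fin n → ℝ} {root : Fin n} {k : ℕ}
    {A W : Finset (Fin n)} {P : ℝ → Finset (Fin n) → Prop}
    (hP : ∀ lam, 0 ≤ lam → P lam (moatGrowing (lagrangeInstance G cost root A W lam)).val)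
    (s : SearchState n) (h0 : 0 ≤ s.lo) (hle : s.lo ≤ s.hi) (hlo : P s.lo s.treeLo)
    (hhi : P s.hi s.treeHi) (hlok : s.treeLo.card < k) (hhik : k ≤ s.treeHi.card) (m : ℕ) :
    let t := (fun s => (searchStep G cost root k A W s).val)^[m] s
    0 ≤ t.lo ∧ t.lo ≤ t.hi ∧ P t.lo t.treeLo ∧ P t.hi t.treeHi ∧ t.treeLo.card < k ∧
      k ≤ t.treeHi.card ∧ (t.treeHi.card = k ∨ (t.hi - t.lo) * 2 ^ m ≤ s.hi - s.lo) := by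
  induction m with
  | zero => exact ⟨h0, hle, hlo, hhi, hlok, hhik, Or.inr (by simp)⟩
  | succ m ih =>
    dsimp only at ih ⊢
    rw [Function.iterate_succ_apply']
    set t := (fun s => (searchStep G cost root k A W s).val)^[m] s
    obtain ⟨h1, h2, h3, h4, h5, h6, h7⟩ := ih
    rw [searchStep_val]
    have hmid := hP ((t.lo + t.hi) / 2) (by linarith)
    split_ifs with ha hb
    · exact ⟨h1, h2, h3, h4, h5, h6, Or.inl ha⟩
    · refine ⟨by dsimp only; linarith, by dsimp only; linarith, hmid, h4, hb, h6, Or.inr ?_⟩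
      have := h7.resolve_left ha
      dsimp only
      rw [pow_succ]
      linarith
    · refine ⟨h1, by dsimp only; linarith, h3, hmid, h5, not_lt.1 hb, Or.inr ?_⟩
      have := h7.resolve_left ha
      dsimp only
      rw [pow_succ]
      linarith

/-- The better one of the merged tree and the large tree is cheap. -/
theorem merge_or_large {r c lam₁ lam₂ δ q s C₁ C₂ η p E : ℝ} (hr : 1 ≤ r) (hc : 0 ≤ c)
    (hq : 0 < q) (hs : 0 < s) (h0 : 0 ≤ lam₁) (hlam : (lam₂ - lam₁) * s ≤ δ * c) (hδ : 0 ≤ δ)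
    (hδ1 : δ ≤ 1) (hη : 0 ≤ η) (hC₁ : 0 ≤ C₁) (h1 : C₁ ≤ r * (c - lam₁ * q))
    (h2 : C₂ ≤ r * (c + lam₂ * s)) (hp : p * (q + s) ≤ C₂ * (q * (1 + η))) :
    C₁ + p + E ≤ (4 / 3 + δ + 3 * η) * (r * c) + E ∨ C₂ ≤ (4 / 3 + δ + 3 * η) * (r * c) := by
  -- The fraction of the extra vertices of the large tree that has to be bought.
  obtain ⟨α, hα⟩ : ∃ α, α = q / (q + s) := ⟨_, rfl⟩
  have hqs : 0 < q + s := by linarith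
  have hα0 : 0 < α := hα ▸ div_pos hq hqs
  have hα1 : α < 1 := by rw [hα, div_lt_one hqs]; linarith
  have hαq : α * (q + s) = q := by rw [hα]; exact div_mul_cancel₀ _ hqs.ne'
  have hu0 : 0 ≤ lam₁ * q := mul_nonneg h0 hq.le
  -- Otherwise the bound on `C₁` would be negative.
  have huc : lam₁ * q ≤ c := by
    by_contra hlt
    have : r * (c - lam₁ * q) < 0 := mul_neg_of_pos_of_neg (by linarith) (by linarith)
    linarith
  obtain ⟨u, hu⟩ : ∃ u, u = lam₁ * q := ⟨_, rfl⟩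
  have hαs : α * (lam₁ * s) = (1 - α) * u := by rw [hu]; linear_combination lam₁ * hαq
  rw [← hu] at hu0 huc h1
  have hr0 : 0 ≤ r := by linarith
  have hrc : 0 ≤ r * c := mul_nonneg hr0 hc
  have hC₂ : C₂ ≤ r * (c + lam₁ * s + δ * c) :=
    h2.trans (mul_le_mul_of_nonneg_left (by linarith) hr0)
  by_cases hcase : lam₁ * s ≤ c / 3
  · right
    have : r * (c + lam₁ * s + δ * c) ≤ r * (c + c / 3 + δ * c) :=
      mul_le_mul_of_nonneg_left (by linarith) hr0
    have := mul_nonneg hη hrc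
    linarith
  left
  -- If not, multiply `c/3 < α (c - u)` by `1 - α` and `c/3 < λ₁ s` by `α²`, and use `α λ₁ s = (1 -
  -- α) u`. The sum is `(1 - α + α²) c/3 < α (1 - α) c`, that is, `(2 α - 1)² c < 0`.
  have hcu : α * (c - u) ≤ c / 3 := by
    by_contra hlt
    have h3 : (1 - α) * (c / 3) < (1 - α) * (α * (c - u)) :=
      mul_lt_mul_of_pos_left (not_le.1 hlt) (by linarith)
    have h4 : α * (α * (c / 3)) < α * (α * (lam₁ * s)) :=
      mul_lt_mul_of_pos_left (mul_lt_mul_of_pos_left (not_le.1 hcase) hα0) hα0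
    rw [hαs] at h4
    have h5 : 0 ≤ (2 * α - 1) ^ 2 * c := mul_nonneg (sq_nonneg _) hc
    linarith
  have hp' : p ≤ α * C₂ * (1 + η) := by
    refine le_of_mul_le_mul_right (hp.trans (le_of_eq ?_)) hqs
    linear_combination (-C₂ * (1 + η)) * hαq
  -- Added to `C₁ ≤ r (c - u)`, this gives `r (c + α (c - u) + δ c)`.
  have hαC₂ : α * C₂ ≤ r * (α * c + (1 - α) * u + δ * c) := by
    refine (mul_le_mul_of_nonneg_left hC₂ hα0.le).trans ?_
    have : α * (δ * c) ≤ δ * c := mul_le_of_le_one_left (mul_nonneg hδ hc) hα1.le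
    have : r * (α * c + α * (lam₁ * s) + α * (δ * c)) ≤ r * (α * c + (1 - α) * u + δ * c) :=
      mul_le_mul_of_nonneg_left (by linarith) hr0
    linarith
  -- A crude bound is enough here, since it is used only with the small factor `η`.
  have hαC₂' : α * C₂ ≤ 2 * (r * c) := by
    refine hαC₂.trans ?_
    have h6 : (1 - α) * u ≤ (1 - α) * c := mul_le_mul_of_nonneg_left huc (by linarith)
    have h7 : δ * c ≤ c := mul_le_of_le_one_left hc hδ1
    have : r * (α * c + (1 - α) * u + δ * c) ≤ r * (2 * c) :=
      mul_le_mul_of_nonneg_left (by linarith) hr0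
    linarith
  have h8 : α * C₂ * η ≤ 2 * (r * c) * η := mul_le_mul_of_nonneg_right hαC₂' hη
  have h9 : r * (c + α * (c - u) + δ * c) ≤ r * (c + c / 3 + δ * c) :=
    mul_le_mul_of_nonneg_left (by linarith) hr0
  have := mul_nonneg hη hrc
  linarith

/-- Accuracy that is lost by the algorithm with parameter `δ`, apart from the factor `4 / 3`. -/
noncomputable def loss (δ : ℝ) : ℝ := 4 * δ + 2 * δ * (Nat.clog 2 ⌈4 / δ⌉₊ + 1)

theorem one_div_two_pow_clog_le {δ : ℝ} (hδ : 0 < δ) :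
    (1 : ℝ) / 2 ^ Nat.clog 2 ⌈4 / δ⌉₊ ≤ δ / 4 := by
  have h1 : (4 : ℝ) / δ ≤ ⌈4 / δ⌉₊ := Nat.le_ceil _
  have h2 : (⌈4 / δ⌉₊ : ℝ) ≤ 2 ^ Nat.clog 2 ⌈4 / δ⌉₊ := by
    exact_mod_cast Nat.le_pow_clog (by norm_num) _
  have h3 : 0 < 4 / δ := by positivity
  calc (1 : ℝ) / 2 ^ Nat.clog 2 ⌈4 / δ⌉₊ ≤ 1 / (4 / δ) :=
        one_div_le_one_div_of_le h3 (h1.trans h2)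
    _ = δ / 4 := one_div_div _ _

theorem sq_le_two_mul_two_pow (m : ℕ) : m ^ 2 ≤ 2 * 2 ^ m := by
  induction m with
  | zero => norm_num
  | succ m ih =>
    rcases Nat.lt_or_ge m 3 with h | h
    · interval_cases m <;> norm_num
    · rw [pow_succ 2 m]
      nlinarith

/-- Let `m` be the rounded logarithm. From `2 ^ (m - 1) < 4 / δ + 1` follows `2 ^ m δ ≤ 10`, and `m²
≤ 2 * 2 ^ m` then gives `δ m² ≤ 20`. Hence `(δ m)² ≤ 20 δ ≤ (ε / 4)²`. The loss is `6 δ + 2 δ m`,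
and each of the two terms is at most `ε / 2`. -/
theorem loss_le {ε δ : ℝ} (hδ : 0 < δ) (hδ1 : δ ≤ 1) (h1 : δ ≤ ε / 12)
    (h2 : δ ≤ ε ^ 2 / 320) : loss δ ≤ ε := by
  rw [loss]
  obtain ⟨m, hm⟩ : ∃ m, m = Nat.clog 2 ⌈4 / δ⌉₊ := ⟨_, rfl⟩
  rw [← hm]
  have hlt : (2 : ℝ) ^ m * δ ≤ 10 := by
    have h3 : 1 < ⌈4 / δ⌉₊ := by
      rw [Nat.lt_ceil, Nat.cast_one, one_lt_div hδ]
      linarith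
    have h4 : 2 ^ (m - 1) < ⌈4 / δ⌉₊ := by
      have := Nat.pow_pred_clog_lt_self (b := 2) (by norm_num) h3
      rwa [← hm] at this
    have h5 : 0 < m := hm ▸ Nat.clog_pos (by norm_num) h3
    have h6 : ((2 : ℝ) ^ (m - 1)) < 4 / δ + 1 := by
      have h7 : (⌈4 / δ⌉₊ : ℝ) < 4 / δ + 1 := Nat.ceil_lt_add_one (by positivity)
      have h8 : ((2 : ℝ) ^ (m - 1)) ≤ ⌈4 / δ⌉₊ := by exact_mod_cast h4.le
      linarith
    have h9 : (2 : ℝ) ^ m = 2 * 2 ^ (m - 1) := by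
      rw [← pow_succ', Nat.sub_add_cancel h5]
    have h10 : (2 : ℝ) ^ (m - 1) * δ < (4 / δ + 1) * δ := mul_lt_mul_of_pos_right h6 hδ
    rw [add_mul, div_mul_cancel₀ _ hδ.ne', one_mul] at h10
    rw [h9]
    linarith
  have hsq : (m : ℝ) ^ 2 ≤ 2 * 2 ^ m := by exact_mod_cast sq_le_two_mul_two_pow m
  have h3 : (δ * m) ^ 2 ≤ (ε / 4) ^ 2 := by
    have : (δ * m) ^ 2 = δ * (δ * (m : ℝ) ^ 2) := by ring
    rw [this]
    have h4 : δ * (m : ℝ) ^ 2 ≤ 20 := by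
      have := mul_le_mul_of_nonneg_left hsq hδ.le
      linarith
    have := mul_le_mul_of_nonneg_left h4 hδ.le
    linarith
  have h4 : δ * m ≤ ε / 4 := (abs_le_of_sq_le_sq' h3 (by linarith)).2
  linarith

end

/-! ### A correct guess yields a good candidate. -/

section

variable {n : ℕ}

theorem nearSet_walk {G : SimpleGraph (Fin n)} {cost : Fin n → ℝ} {U : Finset (Fin n)} {D : ℝ}
    {v : Fin n} (hv : v ∈ nearSet G cost U D) :
    ∃ i P d, (pathsTo G cost U).val v = some (P, d) ∧ i ≤ n ∧ WalkTo G cost U i v P d ∧ d ≤ D := by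
  obtain ⟨P, d, h, hd⟩ := mem_nearSet.1 hv
  obtain ⟨i, hi, hP⟩ := (pathsTo_spec G cost U).1 v P d h
  exact ⟨i, P, d, h, hi, hP, hd⟩

theorem WalkTo.mem_nearSet {G : SimpleGraph (Fin n)} {cost : Fin n → ℝ} {U : Finset (Fin n)}
    {D d : ℝ} {i : ℕ} {v : Fin n} {P : List (Fin n)} (h : WalkTo G cost U i v P d) (hi : i ≤ n)
    (hd : d ≤ D) : v ∈ nearSet G cost U D := by
  obtain ⟨P', d', h', hd'⟩ := (pathsTo_spec G cost U).2 i v P d hi h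
  exact _root_.mem_nearSet.2 ⟨P', d', h', hd'.trans hd⟩

/-- If `U` is linked to the root by vertices near `U`, then the vertices near `U` form a connected
set. -/
theorem isRootedConnected_nearSet {G : SimpleGraph (Fin n)} {cost : Fin n → ℝ}
    (hc : ∀ v, 0 ≤ cost v) {U X : Finset (Fin n)} {D : ℝ} {root : Fin n}
    (hX : IsRootedConnected G root X) (hU : U ⊆ X) (hXA : X ⊆ nearSet G cost U D) :
    IsRootedConnected G root (nearSet G cost U D) := by
  refine (isRootedConnected_iff G root _).2 ⟨hXA hX.1, fun v hv => ?_⟩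
  obtain ⟨i, P, d, -, hi, hP, hd⟩ := nearSet_walk hv
  refine hP.linkedIn (fun u hu => ?_) (fun w hw => ?_) v hP.head_mem
  · exact (((isRootedConnected_iff G root X).1 hX).2 u (hU hu)).mono (fun _ _ h _ => h) hXA
  · obtain ⟨j, P', d', hj, hd', hP'⟩ := hP.suffix hc hw
    exact hP'.mem_nearSet (by omega) (by linarith)

/-- A near vertex is in `U`, or it is the first vertex of a nontrivial walk and its cost is part of
the weight of this walk. -/
theorem cost_le_of_mem_nearSet {G : SimpleGraph (Fin n)} {cost : Fin n → ℝ}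
    (hc : ∀ v, 0 ≤ cost v) {U : Finset (Fin n)} {D g : ℝ} (hU : ∀ u ∈ U, cost u ≤ g) (hD : D ≤ g)
    {v : Fin n} (hv : v ∈ nearSet G cost U D) : cost v ≤ g := by
  obtain ⟨i, P, d, -, -, hP, hd⟩ := nearSet_walk hv
  cases hP with
  | base h => exact hU v h
  | step h hw =>
    have := hw.nonneg hc
    linarith

/-- A feasible tree for the multiplier `0`, and a tree with exactly `k` vertices for any multiplier,
cost at most `r c`. In the remaining case the search supplies the two trees for `merge_or_large`,
and `mergeTrees_spec` supplies the price of merging them. -/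
theorem solveGuess_good {𝒢 : ∀ n : ℕ, Set (SimpleGraph (Fin n))} {r : ℝ} (h : HasLMPRatio 𝒢 r)
    {G : SimpleGraph (Fin n)} (hG : G ∈ 𝒢 n) {cost : Fin n → ℝ} (hc : ∀ v, 0 ≤ cost v)
    {root : Fin n} {k : ℕ} {X W : Finset (Fin n)} {δ g : ℝ} (hδ : 0 < δ) (hδ1 : δ ≤ 1)
    (hX : IsKSolution G root k X) (hg : ∑ v ∈ X, cost v ≤ g)
    (hg' : g ≤ (1 + δ) * ∑ v ∈ X, cost v) (hWX : W ⊆ X)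
    (hwalk : ∀ v ∈ X, ∃ i P d, i ≤ n ∧ WalkTo G cost (insert root W) i v P d ∧ d ≤ δ * g) :
    ∃ T ∈ (solveGuess δ G cost root k g W).val, IsKSolution G root k T ∧
      ∑ v ∈ T, cost v ≤ (4 / 3 + loss δ) * r * ∑ v ∈ X, cost v := by
  have hr := h.one_le hG root
  have hc0 : 0 ≤ ∑ v ∈ X, cost v := Finset.sum_nonneg fun v _ => hc v
  have hUX : insert root W ⊆ X := Finset.insert_subset hX.1.1 hWX
  obtain ⟨A, hA⟩ : ∃ A, A = nearSet G cost (insert root W) (δ * g) := ⟨_, rfl⟩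
  have hXA : X ⊆ A := fun v hv => by
    obtain ⟨i, P, d, hi, hP, hd⟩ := hwalk v hv
    exact hA ▸ hP.mem_nearSet hi hd
  have hAconn : IsRootedConnected G root A := hA ▸ isRootedConnected_nearSet hc hX.1 hUX (hA ▸ hXA)
  have hUcost : ∀ u ∈ insert root W, cost u ≤ g := fun u hu =>
    (Finset.single_le_sum (fun v _ => hc v) (hUX hu)).trans hg
  have hg0 : 0 ≤ g := hc0.trans hg
  have hδg : δ * g ≤ g := mul_le_of_le_one_left hg0 hδ1
  have hAcost : ∀ v ∈ A, cost v ≤ g := fun v hv =>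
    cost_le_of_mem_nearSet hc hUcost hδg (hA ▸ hv)
  have hkA : k ≤ A.card := hX.2.trans (Finset.card_le_card hXA)
  have hAn : A.card ≤ n := by simpa using Finset.card_le_univ A
  have hAsum : ∑ v ∈ A, cost v ≤ n * g := by
    refine (Finset.sum_le_card_nsmul A cost g hAcost).trans ?_
    rw [nsmul_eq_mul]
    exact mul_le_mul_of_nonneg_right (by exact_mod_cast hAn) hg0
  have hloss : 0 ≤ loss δ := by
    rw [loss]
    positivity
  have hbig : r * ∑ v ∈ X, cost v ≤ (4 / 3 + loss δ) * r * ∑ v ∈ X, cost v := by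
    rw [mul_assoc]
    exact le_mul_of_one_le_left (mul_nonneg (by linarith) hc0) (by linarith)
  have hlag := fun lam hlam => isLagrangeTree_moatGrowing h hG hc hAconn hX hWX hXA (lam := lam) hlam
  rw [solveGuess_val hA hUcost hAconn hkA]
  split_ifs with h0
  · have hT := (hlag 0 le_rfl).1
    refine ⟨_, List.mem_singleton_self _, ⟨hT.conn, h0⟩, ?_⟩
    have := hT.sum_le
    rw [zero_mul, add_zero] at this
    exact this.trans hbig
  obtain ⟨top, htop⟩ : ∃ top : ℝ, top = if g = 0 then 1 else (n + 1) * g := ⟨_, rfl⟩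
  -- The upper multiplier exceeds the cost of all of `A`, so its tree is `A` and has at least `k`
  -- vertices. For `g = 0` the value `1` serves the same purpose.
  have htop1 : n * g < top := by
    rw [htop]
    split_ifs with hgz
    · rw [hgz, mul_zero]; exact one_pos
    · have : 0 < g := lt_of_le_of_ne hg0 (Ne.symm hgz)
      linarith
  have htop0 : 0 ≤ top := (mul_nonneg (Nat.cast_nonneg n) hg0).trans htop1.le
  have htopT := (hlag top htop0).2 (hAsum.trans_lt htop1)
  rw [searchAndMerge_val δ G cost root k g W _ A _ top htop]
  have hsearch := iterate_searchStep (k := k) (P := IsLagrangeTree G cost root k A W r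
    (∑ v ∈ X, cost v)) (fun lam hlam => (hlag lam hlam).1)
    { lo := 0, hi := top
      treeLo := (moatGrowing (lagrangeInstance G cost root A W 0)).val
      treeHi := (moatGrowing (lagrangeInstance G cost root A W top)).val }
    le_rfl htop0 (hlag 0 le_rfl).1 (hlag top htop0).1 (not_le.1 h0) (by rw [htopT]; exact hkA)
    (Nat.clog 2 ⌈3 * n * (n + 1) / δ⌉₊)
  dsimp only at hsearch ⊢
  obtain ⟨s, hs⟩ : ∃ s, (fun s => (searchStep G cost root k A W s).val)^[
    Nat.clog 2 ⌈3 * n * (n + 1) / δ⌉₊] { lo := 0, hi := top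
                                         treeLo := (moatGrowing (lagrangeInstance G cost root A W 0)).val
                                         treeHi := (moatGrowing (lagrangeInstance G cost root A W top)).val }
      = s := ⟨_, rfl⟩
  rw [hs] at hsearch ⊢
  obtain ⟨h1, h2, h3, h4, h5, h6, h7⟩ := hsearch
  split_ifs with hlucky
  · refine ⟨_, List.mem_singleton_self _, ⟨h4.conn, h6⟩, ?_⟩
    have := h4.sum_le
    rw [hlucky, sub_self, mul_zero, add_zero] at this
    exact this.trans hbig
  have h8 := h7.resolve_left hlucky
  rw [sub_zero] at h8
  -- For `g = 0` all vertices kept by the pruning are free, so the large tree is optimal however far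
  -- apart the multipliers are.
  by_cases hgz : g = 0
  · refine ⟨s.treeHi, by simp, ⟨h4.conn, h6⟩, ?_⟩
    have h9 : ∑ v ∈ s.treeHi, cost v ≤ ∑ v ∈ A, cost v :=
      Finset.sum_le_sum_of_subset_of_nonneg h4.alive fun v _ _ => hc v
    rw [hgz, mul_zero] at hAsum
    have : 0 ≤ (4 / 3 + loss δ) * r * ∑ v ∈ X, cost v := by positivity
    linarith
  rw [if_neg hgz] at htop
  have hk₂ : k < s.treeHi.card := lt_of_le_of_ne h6 (Ne.symm hlucky)
  have hn : s.treeHi.card ≤ n := by simpa using Finset.card_le_univ s.treeHi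
  obtain ⟨hM, p, hp, hMc⟩ := mergeTrees_spec (k := k) hc (Nat.clog 2 ⌈4 / δ⌉₊) (U := insert root W)
    (paths := (pathsTo G cost (insert root W)).val) (D := δ * g) h3.conn h4.conn
    (Finset.insert_subset h3.conn.1 h3.forced) (mul_nonneg hδ.le hg0) (fun v hv => by
      obtain ⟨i, P, d, hP, -, hw, hd⟩ := nearSet_walk (hA ▸ h4.alive hv)
      exact ⟨i, P, d, hP, hw, hd⟩) h5 h6
  have hη := one_div_two_pow_clog_le hδ
  have hη0 : (0 : ℝ) ≤ 1 / 2 ^ Nat.clog 2 ⌈4 / δ⌉₊ := by positivity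
  have hn0 : (0 : ℝ) < n := by exact_mod_cast (by omega : 0 < n)
  have hq : (0 : ℝ) < k - s.treeLo.card := sub_pos.2 (by exact_mod_cast h5)
  have hs' : (0 : ℝ) < s.treeHi.card - k := sub_pos.2 (by exact_mod_cast hk₂)
  -- The interval has initial length `(n + 1) g`, and the number of halvings is a logarithm of `3 n
  -- (n + 1) / δ`; hence `hi - lo ≤ δ g / (3 n)`. The excess over `k` is at most `n`, and `g ≤ (1 +
  -- δ) c ≤ 3 c`.
  have hgap : (s.hi - s.lo) * (s.treeHi.card - k) ≤ δ * ∑ v ∈ X, cost v := by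
    have h9 : (3 : ℝ) * n * (n + 1) / δ ≤ 2 ^ Nat.clog 2 ⌈3 * n * (n + 1) / δ⌉₊ :=
      (Nat.le_ceil _).trans (by exact_mod_cast Nat.le_pow_clog (by norm_num) _)
    have h10 : (s.hi - s.lo) * (3 * n * (n + 1) / δ) ≤ (n + 1) * g :=
      (mul_le_mul_of_nonneg_left h9 (by linarith)).trans (h8.trans htop.le)
    have h11 : (s.hi - s.lo) * (3 * n) ≤ δ * g := by
      have h12 : (s.hi - s.lo) * (3 * n * (n + 1) / δ) = (s.hi - s.lo) * (3 * n) / δ * (n + 1) := by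
        ring
      rw [h12, mul_comm ((n : ℝ) + 1) g] at h10
      have h13 := le_of_mul_le_mul_right h10 (by positivity)
      rw [div_le_iff₀ hδ] at h13
      linarith
    have h14 : (s.hi - s.lo) * (s.treeHi.card - k) ≤ (s.hi - s.lo) * n := by
      refine mul_le_mul_of_nonneg_left ?_ (by linarith)
      have : (s.treeHi.card : ℝ) ≤ n := by exact_mod_cast hn
      have : (0 : ℝ) ≤ k := Nat.cast_nonneg k
      linarith
    have h15 : δ * g ≤ δ * (3 * ∑ v ∈ X, cost v) := by
      refine mul_le_mul_of_nonneg_left (hg'.trans ?_) hδ.le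
      exact mul_le_mul_of_nonneg_right (by linarith) hc0
    linarith
  have hp' : p * ((k - s.treeLo.card) + (s.treeHi.card - k) : ℝ) ≤
      (∑ v ∈ s.treeHi, cost v) * ((k - s.treeLo.card) * (1 + 1 / 2 ^ Nat.clog 2 ⌈4 / δ⌉₊)) := by
    rw [Nat.cast_sub h5.le] at hp
    have hnn : (0 : ℝ) ≤ (k - s.treeLo.card) * (1 + 1 / 2 ^ Nat.clog 2 ⌈4 / δ⌉₊) := by positivity
    have h9 := hp.trans (mul_le_mul_of_nonneg_right (Finset.sum_le_sum_of_subset_of_nonneg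
      (Finset.sdiff_subset : s.treeHi \ s.treeLo ⊆ s.treeHi) fun v _ _ => hc v) hnn)
    -- The trees need not be nested, so `|T₂ \ T₁|` may exceed `|T₂| - |T₁|`; passing to the smaller
    -- factor is allowed for `p > 0`.
    rcases le_or_gt p 0 with hp0 | hp0
    · refine (mul_nonpos_of_nonpos_of_nonneg hp0 (by linarith)).trans ?_
      exact mul_nonneg (Finset.sum_nonneg fun v _ => hc v) hnn
    · refine le_trans (mul_le_mul_of_nonneg_left ?_ hp0.le) h9
      have h10 := Finset.le_card_sdiff s.treeLo s.treeHi
      have h11 : (s.treeHi.card : ℝ) ≤ s.treeLo.card + (s.treeHi \ s.treeLo).card := by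
        exact_mod_cast (by omega)
      linarith
  -- The price of the connecting paths, one of weight at most `δ g` for each nested call, where `g ≤
  -- 2 r c`.
  have hE : ((Nat.clog 2 ⌈4 / δ⌉₊ : ℝ) + 1) * (δ * g) ≤
      2 * δ * (Nat.clog 2 ⌈4 / δ⌉₊ + 1) * (r * ∑ v ∈ X, cost v) := by
    have h9 : g ≤ 2 * (r * ∑ v ∈ X, cost v) := by
      have h10 : ∑ v ∈ X, cost v ≤ r * ∑ v ∈ X, cost v := le_mul_of_one_le_left hc0 hr
      have h11 : (1 + δ) * ∑ v ∈ X, cost v ≤ 2 * ∑ v ∈ X, cost v :=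
        mul_le_mul_of_nonneg_right (by linarith) hc0
      linarith
    have h12 : (0 : ℝ) ≤ ((Nat.clog 2 ⌈4 / δ⌉₊ : ℝ) + 1) * δ := by positivity
    have := mul_le_mul_of_nonneg_left h9 h12
    linarith
  have hrc : 0 ≤ r * ∑ v ∈ X, cost v := mul_nonneg (by linarith) hc0
  have hηc : 1 / 2 ^ Nat.clog 2 ⌈4 / δ⌉₊ * (r * ∑ v ∈ X, cost v) ≤ δ / 4 * (r * ∑ v ∈ X, cost v) :=
    mul_le_mul_of_nonneg_right hη hrc
  have hδc : 0 ≤ δ * (r * ∑ v ∈ X, cost v) := mul_nonneg hδ.le hrc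
  have hLc : 0 ≤ 2 * δ * (Nat.clog 2 ⌈4 / δ⌉₊ + 1) * (r * ∑ v ∈ X, cost v) := by positivity
  have h3s : ∑ v ∈ s.treeLo, cost v ≤ r * (∑ v ∈ X, cost v - s.lo * (k - s.treeLo.card)) :=
    h3.sum_le.trans (le_of_eq (by ring))
  rcases merge_or_large (E := ((Nat.clog 2 ⌈4 / δ⌉₊ : ℝ) + 1) * (δ * g)) hr hc0 hq hs' h1 hgap hδ.le
    hδ1 hη0 (Finset.sum_nonneg fun v _ => hc v) h3s h4.sum_le hp' with hfin | hfin
  · refine ⟨_, List.mem_cons_self, hM, hMc.trans ?_⟩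
    refine hfin.trans ?_
    rw [loss]
    linarith
  · refine ⟨s.treeHi, by simp, ⟨h4.conn, h6⟩, hfin.trans ?_⟩
    rw [loss]
    linarith

end

/-! ### The enumeration of guesses, and the approximation ratio. -/

section

variable {n : ℕ}

theorem mem_smallSets {m : ℕ} {W : Finset (Fin n)} (hW : W.card ≤ m) :
    W ∈ (smallSets n m).val := by
  induction m generalizing W with
  | zero =>
    rw [Nat.le_zero, Finset.card_eq_zero] at hW
    exact hW ▸ List.mem_singleton_self _
  | succ m ih =>
    have hval : (smallSets n (m + 1)).val = (smallSets n m).val ++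
        ((List.finRange n).product (smallSets n m).val).map fun e =>
          (Timed.vertexSet fun u => Timed.test (u = e.1 ∨ u ∈ e.2)).val := rfl
    rw [hval, List.mem_append]
    rcases Nat.lt_or_ge m W.card with h | h
    · obtain ⟨a, ha⟩ := Finset.card_pos.1 (by omega : 0 < W.card)
      refine Or.inr (List.mem_map.2 ⟨(a, W.erase a), List.mem_product.2
        ⟨List.mem_finRange a, ih (by rw [Finset.card_erase_of_mem ha]; omega)⟩, ?_⟩)
      ext u
      rw [Timed.mem_vertexSet]
      simp only [Timed.val_test, decide_eq_true_eq]
      by_cases hu : u = a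
      · simp [hu, ha]
      · simp [hu]
    · exact Or.inl (ih h)

/-- For the heaviest vertex `v` of `X`, the cost of `X` lies between `cost v` and `n * cost v`. By
Bernoulli's inequality `⌈n / δ⌉` factors `1 + δ` bridge this gap, and the first power that reaches
the cost of `X` overshoots it by a factor of at most `1 + δ`. -/
theorem exists_optGuess {δ : ℝ} (hδ : 0 < δ) {cost : Fin n → ℝ} (hc : ∀ v, 0 ≤ cost v)
    {X : Finset (Fin n)} (hX : X.Nonempty) :
    ∃ g ∈ (optGuesses δ cost).val, ∑ v ∈ X, cost v ≤ g ∧ g ≤ (1 + δ) * ∑ v ∈ X, cost v := by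
  obtain ⟨v, hv, hmax⟩ := X.exists_max_image cost hX
  have hc0 : 0 ≤ ∑ v ∈ X, cost v := Finset.sum_nonneg fun v _ => hc v
  have hle : cost v ≤ ∑ v ∈ X, cost v := Finset.single_le_sum (fun v _ => hc v) hv
  have hn : ∑ v ∈ X, cost v ≤ n * cost v := by
    refine (Finset.sum_le_card_nsmul X cost _ hmax).trans ?_
    rw [nsmul_eq_mul]
    refine mul_le_mul_of_nonneg_right ?_ (hc v)
    exact_mod_cast (by simpa using Finset.card_le_univ X)
  have hex : ∑ v ∈ X, cost v ≤ cost v * (1 + δ) ^ ⌈n / δ⌉₊ := by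
    have h1 : 1 + (⌈n / δ⌉₊ : ℝ) * δ ≤ (1 + δ) ^ ⌈n / δ⌉₊ :=
      one_add_mul_le_pow (by linarith) _
    have h2 : (n : ℝ) ≤ ⌈n / δ⌉₊ * δ := (div_le_iff₀ hδ).1 (Nat.le_ceil _)
    have h3 := mul_le_mul_of_nonneg_left (h2.trans (by linarith : _ ≤ (1 + δ) ^ ⌈n / δ⌉₊)) (hc v)
    linarith
  have hex' : ∃ j, ∑ v ∈ X, cost v ≤ cost v * (1 + δ) ^ j := ⟨_, hex⟩
  obtain ⟨j, hj⟩ : ∃ j, j = Nat.find hex' := ⟨_, rfl⟩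
  have hspec := Nat.find_spec hex'
  have hjN : j ≤ ⌈n / δ⌉₊ := hj ▸ Nat.find_min' hex' hex
  rw [← hj] at hspec
  refine ⟨cost v * (1 + δ) ^ j, List.mem_map.2 ⟨(v, j), List.mem_product.2
    ⟨List.mem_finRange v, List.mem_range.2 (by omega)⟩, rfl⟩, hspec, ?_⟩
  cases j with
  | zero =>
    rw [pow_zero, mul_one]
    have := mul_nonneg hδ.le hc0
    linarith
  | succ j =>
    have hmin := not_le.1 (Nat.find_min hex' (m := j) (by omega))
    rw [pow_succ, ← mul_assoc, mul_comm]
    exact mul_le_mul_of_nonneg_left hmin.le (by linarith)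

theorem nwkMST_val (δ : ℝ) (G : SimpleGraph (Fin n)) (cost : Fin n → ℝ) (root : Fin n) (k : ℕ) :
    (nwkMST δ G cost root k).val =
      ((((optGuesses δ cost).val.product (smallSets n ⌊1 / δ⌋₊).val).flatMap fun e =>
        (solveGuess δ G cost root k e.1 e.2).val).foldl
          (fun best T => (keepBetter G cost root k best T).val) none).map Prod.fst := by
  rw [List.foldl_flatMap]
  simp only [nwkMST, Timed.val_bind, Timed.val_foldList, Timed.val_pure]

/-- The correct guess depends on `X`, but the output does not. The bound is therefore proved for
each `X` separately, without singling out an optimal one. -/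
theorem nwkMST_spec {𝒢 : ∀ n : ℕ, Set (SimpleGraph (Fin n))} {r : ℝ} (h : HasLMPRatio 𝒢 r)
    {G : SimpleGraph (Fin n)} (hG : G ∈ 𝒢 n) {cost : Fin n → ℝ} (hc : ∀ v, 0 ≤ cost v)
    {root : Fin n} {k : ℕ} {δ : ℝ} (hδ : 0 < δ) (hδ1 : δ ≤ 1) (hex : ∃ X, IsKSolution G root k X) :
    ∃ T, (nwkMST δ G cost root k).val = some T ∧ IsKSolution G root k T ∧
      ∀ X, IsKSolution G root k X →
        ∑ v ∈ T, cost v ≤ (4 / 3 + loss δ) * r * ∑ v ∈ X, cost v := by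
  obtain ⟨h1, h2⟩ := foldl_keepBetter G cost root k
    (((optGuesses δ cost).val.product (smallSets n ⌊1 / δ⌋₊).val).flatMap fun e =>
        (solveGuess δ G cost root k e.1 e.2).val) none (by simp)
  rw [nwkMST_val]
  generalize List.foldl (fun best T => (keepBetter G cost root k best T).val) none _ = best at h1 h2
  have key : ∀ X, IsKSolution G root k X →
      ∃ b ∈ best, b.2 ≤ (4 / 3 + loss δ) * r * ∑ v ∈ X, cost v := by
    intro X hX
    have hc0 : 0 ≤ ∑ v ∈ X, cost v := Finset.sum_nonneg fun v _ => hc v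
    obtain ⟨g, hgm, hg, hg'⟩ := exists_optGuess hδ hc ⟨root, hX.1.1⟩
    have hg0 : 0 ≤ g := hc0.trans hg
    obtain ⟨W, hWX, hW, hW0, hwalk⟩ := hX.1.exists_skeleton hc (mul_nonneg hδ.le hg0)
    have hWcard : W.card ≤ ⌊1 / δ⌋₊ := by
      -- `δ g |W| ≤ c(X) ≤ g` gives `|W| ≤ 1 / δ` if `g > 0`; for cost zero the skeleton is empty.
      rcases hc0.eq_or_lt with h0 | h0
      · rw [hW0 h0.symm]
        simp
      · refine Nat.le_floor ?_
        rw [le_div_iff₀ hδ]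
        have hgpos : 0 < g := h0.trans_le hg
        refine le_of_mul_le_mul_right ?_ hgpos
        linarith
    obtain ⟨T, hT, hTs, hTc⟩ := solveGuess_good h hG hc hδ hδ1 hX hg hg' hWX hwalk
    refine h2 _ (Or.inr ⟨T, List.mem_flatMap.2 ⟨(g, W), List.mem_product.2
      ⟨hgm, mem_smallSets hWcard⟩, hT⟩, hTs, hTc⟩)
  obtain ⟨X, hX⟩ := hex
  obtain ⟨b, hb, -⟩ := key X hX
  obtain rfl : best = some b := hb
  refine ⟨b.1, rfl, (h1 b rfl).1, fun X hX => ?_⟩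
  obtain ⟨b', hb', hle⟩ := key X hX
  obtain rfl : b = b' := Option.some.inj hb'
  exact (h1 b rfl).2 ▸ hle

end

/-! ### Running time: powers of a common bound `N`, and moat growing. -/

section

variable {n : ℕ}

/-- The computation `x` takes at most `N ^ e` elementary operations. -/
def Fast (N e : ℕ) {α : Type} (x : Timed α) : Prop := x.time ≤ N ^ e

namespace Fast

variable {N e : ℕ} {α β σ : Type}

theorem mono (hN : 2 ≤ N) {e' : ℕ} {x : Timed α} (h : Fast N e x) (he : e ≤ e') : Fast N e' x :=
  le_trans h (Nat.pow_le_pow_right (by omega) he)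

theorem pure (a : α) : Fast N e (Pure.pure a : Timed α) := Nat.zero_le _

theorem op (hN : 2 ≤ N) (a : α) : Fast N e (Timed.op a) := Nat.one_le_pow _ _ (by omega)

theorem test (hN : 2 ≤ N) (p : Prop) : Fast N e (Timed.test p) := Nat.one_le_pow _ _ (by omega)

theorem charge {m : ℕ} (hm : m ≤ N) : Fast N (e + 1) (Timed.charge m) :=
  hm.trans (Nat.le_self_pow (by omega) _)

/-- Since `N ≥ 2`, powers of `N` absorb constants: executing two programs in a row raises the
exponent by one, and a loop of at most `N` rounds raises it by two. So only exponents have to be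
tracked. -/
theorem add_le (hN : 2 ≤ N) {a b : ℕ} (ha : a ≤ N ^ e) (hb : b ≤ N ^ e) : a + b ≤ N ^ (e + 1) := by
  rw [pow_succ]
  nlinarith

theorem mul_le (hN : 2 ≤ N) {a b : ℕ} (ha : a ≤ N) (hb : b ≤ N ^ e) : a * (b + 1) ≤ N ^ (e + 2) := by
  have h1 : b + 1 ≤ N ^ (e + 1) := add_le hN hb (Nat.one_le_pow _ _ (by omega))
  calc a * (b + 1) ≤ N * N ^ (e + 1) := Nat.mul_le_mul ha h1
    _ = N ^ (e + 2) := by rw [pow_succ N (e + 1), mul_comm]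

theorem bind (hN : 2 ≤ N) {x : Timed α} {f : α → Timed β} (hx : Fast N e x)
    (hf : Fast N e (f x.val)) : Fast N (e + 1) (x >>= f) := add_le hN hx hf

theorem ite {p : Prop} [Decidable p] {x y : Timed α} (hx : Fast N e x) (hy : Fast N e y) :
    Fast N e (if p then x else y) := by
  split_ifs <;> assumption

theorem sum_le (hN : 2 ≤ N) (hn : n ≤ N) {t : Fin n → ℕ} (h : ∀ v, t v ≤ N ^ e) :
    ∑ v, (t v + 1) ≤ N ^ (e + 2) := by
  refine le_trans (Finset.sum_le_card_nsmul _ _ (N ^ e + 1) fun v _ => by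
    have := h v; omega) ?_
  rw [Finset.card_univ, Fintype.card_fin, smul_eq_mul]
  exact mul_le hN hn le_rfl

theorem list_sum_le (hN : 2 ≤ N) {l : List α} (hl : l.length ≤ N) {t : α → ℕ}
    (h : ∀ a ∈ l, t a ≤ N ^ e) : (l.map fun a => t a + 1).sum ≤ N ^ (e + 2) := by
  refine le_trans (List.sum_le_card_nsmul _ (N ^ e + 1) fun b hb => ?_) ?_
  · obtain ⟨a, ha, rfl⟩ := List.mem_map.1 hb
    have := h a ha
    omega
  · rw [List.length_map, smul_eq_mul]
    exact mul_le hN hl le_rfl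

theorem tabulate (hN : 2 ≤ N) (hn : n ≤ N) {f : Fin n → Timed α} (h : ∀ v, Fast N e (f v)) :
    Fast N (e + 2) (Timed.tabulate f) := sum_le hN hn h

theorem vertexSet (hN : 2 ≤ N) (hn : n ≤ N) {f : Fin n → Timed Bool} (h : ∀ v, Fast N e (f v)) :
    Fast N (e + 2) (Timed.vertexSet f) := sum_le hN hn h

theorem anyVertex (hN : 2 ≤ N) (hn : n ≤ N) {f : Fin n → Timed Bool} (h : ∀ v, Fast N e (f v)) :
    Fast N (e + 2) (Timed.anyVertex f) := sum_le hN hn h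

theorem allVertices (hN : 2 ≤ N) (hn : n ≤ N) {f : Fin n → Timed Bool} (h : ∀ v, Fast N e (f v)) :
    Fast N (e + 2) (Timed.allVertices f) := sum_le hN hn h

theorem sumVertices (hN : 2 ≤ N) (hn : n ≤ N) {f : Fin n → Timed ℝ} (h : ∀ v, Fast N e (f v)) :
    Fast N (e + 2) (Timed.sumVertices f) := sum_le hN hn h

theorem mapList (hN : 2 ≤ N) {l : List α} (hl : l.length ≤ N) {f : α → Timed β}
    (h : ∀ a ∈ l, Fast N e (f a)) : Fast N (e + 2) (Timed.mapList l f) := list_sum_le hN hl h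

theorem filterList (hN : 2 ≤ N) {l : List α} (hl : l.length ≤ N) {f : α → Timed Bool}
    (h : ∀ a ∈ l, Fast N e (f a)) : Fast N (e + 2) (Timed.filterList l f) := list_sum_le hN hl h

theorem anyList (hN : 2 ≤ N) {l : List α} (hl : l.length ≤ N) {f : α → Timed Bool}
    (h : ∀ a ∈ l, Fast N e (f a)) : Fast N (e + 2) (Timed.anyList l f) := list_sum_le hN hl h

theorem sumList (hN : 2 ≤ N) {l : List α} (hl : l.length ≤ N) {f : α → Timed ℝ}
    (h : ∀ a ∈ l, Fast N e (f a)) : Fast N (e + 2) (Timed.sumList l f) := list_sum_le hN hl h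

theorem minList (hN : 2 ≤ N) {l : List (α × ℝ)} (hl : l.length ≤ N) :
    Fast N (e + 2) (Timed.minList l) :=
  add_le hN (hl.trans (Nat.le_self_pow (by omega) _)) (Nat.one_le_pow _ _ (by omega))

theorem sortDesc (hN : 2 ≤ N) {l : List (α × ℕ)} (hl : l.length ≤ N) :
    Fast N (e + 3) (Timed.sortDesc l) :=
  add_le hN ((Nat.pow_le_pow_left hl 2).trans (Nat.pow_le_pow_right (by omega) (by omega)))
    (Nat.one_le_pow _ _ (by omega))

theorem card (hN : 2 ≤ N) (hn : n ≤ N) (S : Finset (Fin n)) : Fast N (e + 2) (Timed.card S) :=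
  add_le hN (hn.trans (Nat.le_self_pow (by omega) _)) (Nat.one_le_pow _ _ (by omega))

/-- The invariant is indexed by the round, because the time of a moat step is bounded only through
the lengths of lists that grow from round to round. -/
theorem iterate_aux {b : ℕ} (Inv : ℕ → σ → Prop) (m : ℕ) (f : σ → Timed σ)
    (h : ∀ i < m, ∀ s, Inv i s → (f s).time ≤ b ∧ Inv (i + 1) (f s).val) (s : σ) (h0 : Inv 0 s) :
    (Timed.iterate m f s).time ≤ m * (b + 1) ∧ Inv m (Timed.iterate m f s).val := by
  induction m generalizing Inv s with
  | zero => exact ⟨Nat.zero_le _, h0⟩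
  | succ m ih =>
    obtain ⟨h1, h2⟩ := h 0 (Nat.succ_pos m) s h0
    obtain ⟨h3, h4⟩ := ih (fun i => Inv (i + 1)) (fun i hi => h (i + 1) (by omega)) (f s).val h2
    refine ⟨?_, h4⟩
    change 1 + ((f s).time + (Timed.iterate m f (f s).val).time) ≤ _
    rw [Nat.succ_mul]
    omega

theorem iterate_inv (hN : 2 ≤ N) {m : ℕ} (hm : m ≤ N) (Inv : ℕ → σ → Prop) {f : σ → Timed σ} {s : σ}
    (h0 : Inv 0 s) (h : ∀ i < m, ∀ s, Inv i s → Fast N e (f s) ∧ Inv (i + 1) (f s).val) :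
    Fast N (e + 2) (Timed.iterate m f s) ∧ Inv m (Timed.iterate m f s).val := by
  obtain ⟨h1, h2⟩ := iterate_aux Inv m f h s h0
  exact ⟨h1.trans (mul_le hN hm le_rfl), h2⟩

theorem iterate (hN : 2 ≤ N) {m : ℕ} (hm : m ≤ N) {f : σ → Timed σ} {s : σ}
    (h : ∀ s, Fast N e (f s)) : Fast N (e + 2) (Timed.iterate m f s) :=
  (iterate_inv hN hm (fun _ _ => True) trivial fun _ _ s _ => ⟨h s, trivial⟩).1

theorem foldList (hN : 2 ≤ N) {l : List α} (hl : l.length ≤ N) {f : σ → α → Timed σ} {s : σ}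
    (h : ∀ s, ∀ a ∈ l, Fast N e (f s a)) : Fast N (e + 2) (Timed.foldList f s l) := by
  have key : (Timed.foldList f s l).time ≤ l.length * (N ^ e + 1) := by
    clear hl
    induction l generalizing s with
    | nil => exact Nat.zero_le _
    | cons a l ih =>
      have h1 := h s a List.mem_cons_self
      have h2 := ih (s := (f s a).val) fun s b hb => h s b (List.mem_cons_of_mem _ hb)
      change 1 + ((f s a).time + (Timed.foldList f (f s a).val l).time) ≤ _
      rw [List.length_cons, Nat.succ_mul]
      rw [Fast] at h1
      omega
  exact key.trans (mul_le hN hl le_rfl)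

end Fast

theorem fast_reach {N e : ℕ} (hN : 2 ≤ N) (hn : n ≤ N) {adj : Fin n → Fin n → Timed Bool}
    (hadj : ∀ u v, Fast N e (adj u v)) (B : Finset (Fin n)) (v : Fin n) :
    Fast N (e + 12) (reach adj B v) :=
  .bind hN (.vertexSet hN hn fun _ => .test hN _) (.iterate hN hn fun S =>
    .vertexSet hN hn fun u => .bind hN (.test hN _) (.bind hN (.test hN _) (.bind hN
      (.anyVertex hN hn fun w => .bind hN ((hadj w u).mono hN (by omega))
        (.bind hN (.test hN _) (.pure _))) (.pure _))))

theorem fast_graphAdj {N e : ℕ} (hN : 2 ≤ N) (G : SimpleGraph (Fin n)) (u v : Fin n) :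
    Fast N e (graphAdj G u v) := .test hN _

theorem fast_components {N : ℕ} (hN : 2 ≤ N) (hn : n ≤ N) (G : SimpleGraph (Fin n))
    (B : Finset (Fin n)) : Fast N 17 (components G B) ∧ (components G B).val.length ≤ n := by
  have hF : (List.finRange n).length ≤ N := by rwa [List.length_finRange]
  constructor
  · refine .bind hN (.tabulate hN hn fun v =>
      (fast_reach hN hn (fast_graphAdj (e := 0) hN G) B v).mono hN (by omega)) (.bind hN
      (.filterList hN hF fun v _ => .bind hN (.test hN _) (.bind hN
        (.allVertices hN hn fun u => .test hN _) (.pure _)))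
      (.mapList hN ?_ fun v _ => .op hN _))
    exact (List.length_filter_le _ _).trans hF
  · have : (components G B).val.length ≤ (List.finRange n).length := by
      simp only [components, Timed.val_bind, Timed.val_mapList, List.length_map,
        Timed.val_filterList]
      exact List.length_filter_le _ _
    rwa [List.length_finRange] at this

theorem fast_inBoundary {N : ℕ} (hN : 2 ≤ N) (hn : n ≤ N) (G : SimpleGraph (Fin n))
    (S : Finset (Fin n)) (v : Fin n) : Fast N 4 (inBoundary G S v) :=
  .bind hN (.anyVertex hN hn fun _ => .test hN _) (.bind hN (.test hN _) (.pure _))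

theorem fast_boughtSet {N : ℕ} (hN : 2 ≤ N) (hn : n ≤ N) {l : List (Fin n × ℝ)} (hl : l.length ≤ N) :
    Fast N 4 (boughtSet l) :=
  .vertexSet hN hn fun _ => .anyList hN hl fun _ _ => .test (e := 0) hN _

section MoatGrowing

variable {N : ℕ} (I : PrizeInstance n)

theorem fast_potential (hN : 2 ≤ N) (hn : n ≤ N) {y : List (Finset (Fin n) × ℝ)}
    (hy : y.length ≤ N) (S : Finset (Fin n)) : Fast N 10 (potential I y S) :=
  .bind hN (.sumVertices hN hn fun _ => .op hN _) (.bind hN (.sumList hN hy fun _ _ =>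
    .bind hN (.allVertices hN hn fun _ => .test hN _) (.pure _)) (.op hN _))

theorem fast_load (hN : 2 ≤ N) (hn : n ≤ N) {y : List (Finset (Fin n) × ℝ)}
    (hy : y.length ≤ N) (v : Fin n) : Fast N 10 (load I y v) :=
  .sumList hN hy fun _ _ => .bind hN ((fast_inBoundary hN hn _ _ _).mono hN (by omega)) (.pure _)

theorem fast_hasForced (hN : 2 ≤ N) (hn : n ≤ N) (S : Finset (Fin n)) : Fast N 4 (hasForced I S) :=
  .anyVertex hN hn fun _ => .test hN _

theorem fast_isActive (hN : 2 ≤ N) (hn : n ≤ N) {y : List (Finset (Fin n) × ℝ)}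
    (hy : y.length ≤ N) (S : Finset (Fin n)) : Fast N 15 (isActive I y S) :=
  .bind hN ((fast_hasForced I hN hn S).mono hN (by omega)) (.bind hN
    ((fast_potential I hN hn hy S).mono hN (by omega)) (.bind hN (.test hN _)
      (.bind hN (.test hN _) (.pure _))))

/-- The lists of bought vertices and of increments are short. -/
structure MoatState.Short (s : MoatState n) (a b : ℕ) : Prop where
  bought : s.bought.length ≤ a
  dual : s.dual.length ≤ b

theorem fast_markDead (hN : 2 ≤ N) (hn : n ≤ N) {s : MoatState n} (hs : s.Short N N) :
    Fast N 24 (markDead I s) := by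
  have hm := fast_components hN hn I.graph (boughtSet s.bought).val
  refine .bind hN ((fast_boughtSet hN hn hs.bought).mono hN (by omega)) (.bind hN
    (hm.1.mono hN (by omega)) (.bind hN (.filterList hN (hm.2.trans hn) fun S _ =>
      .bind hN ((fast_hasForced I hN hn S).mono hN (by omega)) (.bind hN
        ((fast_potential I hN hn hs.dual S).mono hN (by omega)) (.bind hN (.test hN _)
          (.bind hN (.test hN _) (.pure _))))) (.bind hN (.tabulate hN hn fun v => .bind hN
            (.anyList hN ?_ fun _ _ => .test hN _) (.bind hN (.test hN _) (.pure _))) (.pure _))))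
  exact (List.length_filter_le _ _).trans (hm.2.trans hn)

theorem short_markDead {a b : ℕ} {s : MoatState n} (hs : s.Short a b) : (markDead I s).val.Short a b :=
  ⟨hs.bought, hs.dual⟩

theorem fast_moatInit (hN : 2 ≤ N) (hn : n ≤ N) :
    Fast N 27 (moatInit I) ∧ (moatInit I).val.Short n 0 := by
  have hF : (List.finRange n).length ≤ N := by rwa [List.length_finRange]
  have hstart : ∀ p : Fin n → Bool, ((List.finRange n).filter p).length ≤ n := fun p => by
    have := List.length_filter_le p (List.finRange n)
    rwa [List.length_finRange] at this
  have hs : ∀ (p : Fin n → Bool) (f : Fin n → Fin n × ℝ) (m : Fin n → Option ℝ),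
      MoatState.Short ⟨0, ((List.finRange n).filter p).map f, [], m⟩ n 0 := fun p f m =>
    ⟨by rw [List.length_map]; exact hstart p, le_rfl⟩
  refine ⟨.bind hN (.filterList hN hF fun _ _ => .test hN _) (.bind hN
    (.mapList hN ((hstart _).trans hn) fun _ _ => .op hN _) (.bind hN
      (.tabulate hN hn fun _ => .op hN _) (fast_markDead I hN hn ?_))), ?_⟩
  · exact ⟨(hs _ _ fun _ => none).bought.trans hn, Nat.zero_le _⟩
  · exact short_markDead I (hs _ _ _)

theorem fast_advance (hN : 2 ≤ N) (hn : n ≤ N) {s : MoatState n} {a b : ℕ} (hs : s.Short a b)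
    (ha : a + 1 ≤ N) (hb : n + b ≤ N) {active : List (Finset (Fin n))} (hact : active.length ≤ n)
    (Δ : ℝ) (buy : Option (Fin n)) :
    Fast N 27 (advance I s active Δ buy) ∧ (advance I s active Δ buy).val.Short (a + 1) (n + b) := by
  have h1 := hs.bought
  have h2 := hs.dual
  have hnew : MoatState.Short (n := n) ⟨s.time + Δ, match buy with
        | none => s.bought
        | some v => (v, s.time + Δ) :: s.bought, active.map (fun S => (S, Δ)) ++ s.dual, s.mark⟩
      (a + 1) (n + b) := by
    refine ⟨?_, ?_⟩
    · cases buy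
      · exact h1.trans (by omega)
      · exact Nat.succ_le_succ h1
    · rw [List.length_append, List.length_map]
      omega
  refine ⟨.bind hN (.mapList hN (hact.trans hn) fun _ _ => .op hN _) (.bind hN
    (.charge (by omega)) ((fast_markDead I hN hn ?_).mono hN (by omega))),
    short_markDead I hnew⟩
  exact ⟨hnew.bought.trans ha, hnew.dual.trans hb⟩

theorem fast_moatStep (hN : 2 ≤ N) (hn : n ≤ N) {s : MoatState n} {a b : ℕ} (hs : s.Short a b)
    (ha : a + 1 ≤ N) (hb : n + b ≤ N) :
    Fast N 37 (moatStep I s) ∧ (moatStep I s).val.Short (a + 1) (n + b) := by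
  have hs' : s.Short (a + 1) (n + b) := ⟨hs.bought.trans (by omega), hs.dual.trans (by omega)⟩
  have hsd : s.dual.length ≤ N := hs'.dual.trans hb
  have hF : (List.finRange n).length ≤ N := by rwa [List.length_finRange]
  have hm := fast_components hN hn I.graph (boughtSet s.bought).val
  have hfil : ∀ p : Finset (Fin n) → Bool,
      ((components I.graph (boughtSet s.bought).val).val.filter p).length ≤ n := fun p =>
    (List.length_filter_le _ _).trans hm.2
  constructor
  · refine .bind hN ((fast_boughtSet hN hn (hs.bought.trans (by omega))).mono hN (by omega)) (.bind hN
      (hm.1.mono hN (by omega)) (.bind hN (.filterList hN (hm.2.trans hn) fun S _ =>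
        (fast_isActive I hN hn hsd S).mono hN (by omega)) (.bind hN (.filterList hN hF fun v _ =>
          .bind hN (.test hN _) (.bind hN (.anyList hN ((hfil _).trans hn) fun S _ =>
            (fast_inBoundary hN hn _ _ _).mono hN (by omega)) (.pure _))) (.bind hN (.mapList hN
              ((List.length_filter_le _ _).trans hF) fun v _ => .bind hN
                (.sumList hN ((hfil _).trans hn) fun S _ => .bind hN
                  ((fast_inBoundary hN hn _ _ _).mono hN (by omega)) (.pure _)) (.bind hN
                  ((fast_load I hN hn hsd v).mono hN (by omega)) (.op hN _))) (.bind hN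
                  (.filterList hN ((hfil _).trans hn) fun S _ => .bind hN
                    ((fast_hasForced I hN hn S).mono hN (by omega)) (.pure _)) (.bind hN
                    (.mapList hN ((List.length_filter_le _ _).trans ((hfil _).trans hn)) fun S _ =>
                      .bind hN ((fast_potential I hN hn hsd S).mono hN (by omega)) (.op hN _))
                    (.bind hN (.minList hN ?_) (.bind hN (.minList hN ?_) ?_))))))))
    · rw [Timed.val_mapList, List.length_map]
      exact (List.length_filter_le _ _).trans hF
    · rw [Timed.val_mapList, List.length_map]
      exact (List.length_filter_le _ _).trans ((hfil _).trans hn)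
    · have hadv := fun p Δ buy => (fast_advance I hN hn hs ha hb (hfil p) Δ buy).1
      split
      · exact .pure _
      · exact (hadv _ _ _).mono hN (by omega)
      · exact (hadv _ _ _).mono hN (by omega)
      · exact .bind hN (.test hN _) (.ite (hadv _ _ _) (hadv _ _ _))
  · have hadv := fun p Δ buy => (fast_advance I hN hn hs ha hb (hfil p) Δ buy).2
    simp only [moatStep, Timed.val_bind, Timed.val_filterList]
    split
    · exact hs'
    · exact hadv _ _ _
    · exact hadv _ _ _
    · rw [Timed.val_bind]
      split_ifs
      · exact hadv _ _ _
      · exact hadv _ _ _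

theorem fast_pruneStep (hN : 2 ≤ N) (hn : n ≤ N) (mark : Fin n → Option ℝ) (X : Finset (Fin n))
    (e : Fin n × ℝ) : Fast N 16 (pruneStep I mark X e) :=
  .bind hN (.vertexSet hN hn fun _ => .test hN _) (.bind hN
    ((fast_reach hN hn (fast_graphAdj (e := 0) hN _) _ _).mono hN (by omega)) (.bind hN
      ((fast_reach hN hn (fast_graphAdj (e := 0) hN _) _ _).mono hN (by omega)) (.bind hN
        (.allVertices hN hn fun _ => .test hN _) (.bind hN (.test hN _) (.pure _)))))

/-- After `i` events there are at most `n + i` bought entries and `n * i` dual increments, hence at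
most `3 n` and `2 n²` at the end. -/
theorem fast_moatGrowing (hN : 2 ≤ N) (hn : 3 * n + 1 ≤ N) (hn2 : 2 * n * n + n ≤ N) :
    Fast N 50 (moatGrowing I) := by
  have hn' : n ≤ N := by omega
  obtain ⟨h1, h2⟩ := fast_moatInit I hN hn'
  have h3 := Fast.iterate_inv (e := 37) hN (m := 2 * n) (by omega)
    (fun i s => MoatState.Short s (n + i) (n * i)) (f := moatStep I) (s := (moatInit I).val) h2
    (fun i hi s hs => by
      have : n * (i + 1) ≤ n * (2 * n) := Nat.mul_le_mul_left n hi
      have h4 := fast_moatStep I hN hn' hs (by omega) (by nlinarith)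
      rw [Nat.mul_succ, add_comm (n * i)]
      exact h4)
  have h5 : (Timed.iterate (2 * n) (moatStep I) (moatInit I).val).val.bought.length ≤ N :=
    h3.2.bought.trans (by omega)
  exact .bind hN (h1.mono hN (by omega)) (.bind hN (h3.1.mono hN (by omega)) (.bind hN
    ((fast_boughtSet hN hn' h5).mono hN (by omega)) (.foldList hN h5 fun _ _ _ =>
      (fast_pruneStep I hN hn' _ _ _).mono hN (by omega))))

end MoatGrowing

end

/-! ### Running time of tree merging. -/

section

variable {n N : ℕ}

theorem fast_contractedAdj (hN : 2 ≤ N) (hn : n ≤ N) (G : SimpleGraph (Fin n)) (M : Finset (Fin n))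
    (root a b : Fin n) : Fast N 6 (contractedAdj G M root a b) :=
  .bind hN (.test hN _) (.bind hN (.anyVertex hN hn fun _ => .test hN _) (.bind hN
    (.anyVertex hN hn fun _ => .test hN _) (.pure _)))

theorem fast_spanningTree (hN : 2 ≤ N) (hn : n * n + n ≤ N) {adj : Fin n → Fin n → Timed Bool}
    (hadj : ∀ u v, Fast N 6 (adj u v)) (B : Finset (Fin n)) (root : Fin n) :
    Fast N 16 (spanningTree adj B root) := by
  have hn' : n ≤ N := by omega
  have hF : ((List.finRange n).product (List.finRange n)).length ≤ N := by
    change (List.finRange n ×ˢ List.finRange n).length ≤ N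
    rw [List.length_product, List.length_finRange]
    omega
  refine .bind hN (.vertexSet hN hn' fun _ => .test hN _) (.bind hN (.iterate hN hn' fun s => ?_)
    (.pure _))
  refine .bind hN (.filterList hN hF fun e _ => .bind hN ((hadj _ _).mono hN (by omega))
    (.bind hN (.test hN _) (.pure _))) ?_
  split
  · exact .pure _
  · exact .op hN _

theorem fast_edgeAdj (hN : 2 ≤ N) {E : List (Fin n × Fin n)} (hE : E.length ≤ N) (u v : Fin n) :
    Fast N 2 (edgeAdj E u v) := .anyList hN hE fun _ _ => .test hN _

theorem fast_edgesInside (hN : 2 ≤ N) {E : List (Fin n × Fin n)} (hE : E.length ≤ N)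
    (X : Finset (Fin n)) : Fast N 2 (edgesInside X E) := .filterList hN hE fun _ _ => .test hN _

theorem fast_edgesNotInside (hN : 2 ≤ N) {E : List (Fin n × Fin n)} (hE : E.length ≤ N)
    (X : Finset (Fin n)) : Fast N 2 (edgesNotInside X E) := .filterList hN hE fun _ _ => .test hN _

theorem fast_superSize (hN : 2 ≤ N) (hn : n ≤ N) (D : PickData n) (X : Finset (Fin n)) :
    Fast N 3 (superSize D X) := .bind hN (.vertexSet hN hn fun _ => .test hN _) (.card hN hn _)

theorem fast_costEffective (hN : 2 ≤ N) (hn : n ≤ N) (D : PickData n) (X : Finset (Fin n)) :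
    Fast N 5 (costEffective D X) :=
  .bind hN ((fast_superSize hN hn D X).mono hN (by omega)) (.bind hN
    (.sumVertices hN hn fun _ => .op hN _) (.test hN _))

theorem fast_sideOf (hN : 2 ≤ N) (hn : n ≤ N) {H : ContractedTree n}
    (hH : H.edges.length + H.contracted.length ≤ N) (e : Fin n × Fin n) (x : Fin n) :
    Fast N 15 (sideOf H e x) := by
  refine .bind hN (.filterList hN (by omega) fun _ _ => .test hN _)
    (fast_reach hN hn (fun u v => fast_edgeAdj hN ?_ u v) _ _)
  have := List.length_filter_le (fun f => (Timed.test (f ≠ e)).val) H.edges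
  rw [List.length_append, Timed.val_filterList]
  omega

/-- A step moves edges from one list to the other or removes some, so the bound `n` on their total
number persists through all rounds. -/
theorem fast_contractStep (hN : 2 ≤ N) (hn : n ≤ N) (D : PickData n) (q : ℕ) {H : ContractedTree n}
    (hH : H.edges.length + H.contracted.length ≤ n) (hn2 : 2 * n ≤ N) :
    Fast N 20 (contractStep D q H) ∧
      (contractStep D q H).val.edges.length + (contractStep D q H).val.contracted.length ≤ n := by
  have hE : H.edges.length ≤ N := by omega
  have hC : H.contracted.length ≤ N := by omega
  constructor
  · refine .bind hN (.mapList hN hE fun e _ => (fast_sideOf hN hn (by omega) _ _).mono hN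
      (by omega)) (.bind hN (.mapList hN hE fun e _ =>
        (fast_sideOf hN hn (by omega) _ _).mono hN (by omega)) (.bind hN (.filterList hN ?_
          fun X _ => .bind hN ((fast_costEffective hN hn D X).mono hN (by omega)) (.bind hN
            ((fast_superSize hN hn D X).mono hN (by omega)) (.bind hN (.test hN _) (.bind hN
              ((fast_edgesInside hN hE X).mono hN (by omega)) (.bind hN (.test hN _)
                (.pure _)))))) ?_))
    · rw [List.length_append, Timed.val_mapList, Timed.val_mapList, List.length_map,
        List.length_map]
      omega
    · split
      · exact .pure _
      · exact .bind hN ((fast_superSize hN hn D _).mono hN (by omega)) (.bind hN (.test hN _)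
          (.bind hN ((fast_edgesInside hN hE _).mono hN (by omega)) (.bind hN
            ((fast_edgesInside hN hC _).mono hN (by omega)) (.bind hN
              ((fast_edgesNotInside hN hE _).mono hN (by omega)) (.pure _)))))
  · simp only [contractStep, Timed.val_bind]
    split
    · exact hH
    · rename_i X _
      have h1 := length_edgesInside_add X H.edges
      have h2 := (edgesInside_sublist X H.contracted).length_le
      simp only [Timed.val_bind, Timed.val_pure]
      split_ifs
      · dsimp only
        omega
      · dsimp only
        rw [List.length_append]
        omega

theorem fast_block (hN : 2 ≤ N) (hn : n ≤ N) {H : ContractedTree n} (hH : H.contracted.length ≤ N)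
    (x : Fin n) : Fast N 14 (block H x) :=
  fast_reach hN hn (fun u v => fast_edgeAdj hN hH u v) _ _

theorem fast_blockDegree (hN : 2 ≤ N) {H : ContractedTree n} (hH : H.edges.length ≤ N)
    (X : Finset (Fin n)) : Fast N 3 (blockDegree H X) :=
  .bind hN (.filterList hN hH fun _ _ => .test hN _) (.op hN _)

theorem fast_takeLeaves (hN : 2 ≤ N) (hn : n ≤ N) (q : ℕ) (l : List (Finset (Fin n) × ℕ))
    (hl : l.length ≤ N) (S : Finset (Fin n)) (t : ℕ) : Fast N 7 (takeLeaves q S t l) := by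
  have key : ∀ S t, (takeLeaves q S t l).time ≤ l.length * (N ^ 5 + 1) := by
    clear hl
    induction l with
    | nil => exact fun _ _ => Nat.zero_le _
    | cons a l ih =>
      intro S t
      obtain ⟨L, s⟩ := a
      obtain ⟨V, hV⟩ : ∃ V, V = Timed.vertexSet fun v => Timed.test (v ∈ S ∨ v ∈ L) := ⟨_, rfl⟩
      have h1 : Fast N 2 V := hV ▸ .vertexSet hN hn fun _ => .test hN _
      have h2 : (takeLeaves q S t ((L, s) :: l)).time ≤ 2 + V.time + l.length * (N ^ 5 + 1) := by
        have h3 : (takeLeaves q S t ((L, s) :: l)).time = 1 + (1 + (V.time +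
            (if (Timed.test (q < t + s)).val then pure (S, t, some L)
              else if (Timed.test (q = t + s)).val then pure (V.val, t + s, none)
              else takeLeaves q V.val (t + s) l :
              Timed (Finset (Fin n) × ℕ × Option (Finset (Fin n)))).time)) := by
          rw [hV]; rfl
        rw [h3]
        have := ih V.val (t + s)
        split_ifs
        · rw [Timed.time_pure]; omega
        · rw [Timed.time_pure]; omega
        · omega
      have h4 : 2 + V.time ≤ N ^ 5 + 1 := by
        have h5 : 1 + V.time ≤ N ^ 3 := Fast.add_le hN (Nat.one_le_pow _ _ (by omega)) h1
        have h6 : N ^ 3 ≤ N ^ 5 := Nat.pow_le_pow_right (by omega) (by omega)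
        omega
      rw [List.length_cons, Nat.succ_mul]
      omega
  exact (key S t).trans (Fast.mul_le hN hl le_rfl)

theorem fast_pickTail {e : ℕ} (hN : 2 ≤ N) (hn : n ≤ N) (next : PickCall n) (q : ℕ)
    {E : List (Fin n × Fin n)} (hE : E.length ≤ n)
    (hnext : ∀ f ∈ next, ∀ q U E, E.length ≤ n → Fast N e (f q U E)) (center : List (Fin n))
    (x : Finset (Fin n) × ℕ × Option (Finset (Fin n))) :
    Fast N (e + 5) (pickTail next q E center x) := by
  obtain ⟨S, t, _ | L⟩ := x
  · exact .pure _
  · cases next with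
    | none => exact .bind hN (.vertexSet hN hn fun _ => .test hN _) (.pure _)
    | some f =>
      exact .bind hN ((fast_edgesInside hN (hE.trans hn) L).mono hN (by omega)) (.bind hN
        ((hnext f rfl _ _ _ ((edgesInside_sublist L E).length_le.trans hE)).mono hN (by omega))
        (.bind hN (.vertexSet hN hn fun _ => .test hN _) (.pure _)))

theorem fast_pickWith {e : ℕ} (hN : 2 ≤ N) (hn : n ≤ N) (hn2 : 2 * n ≤ N) (D : PickData n)
    (next : PickCall n) (q : ℕ) (U : Finset (Fin n)) {E : List (Fin n × Fin n)} (hE : E.length ≤ n)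
    (hnext : ∀ f ∈ next, ∀ q U E, E.length ≤ n → Fast N e (f q U E)) :
    Fast N (e + 40) (pickWith D next q U E) := by
  have hF : (List.finRange n).length ≤ N := by rwa [List.length_finRange]
  obtain ⟨h1, h2⟩ := Fast.iterate_inv (e := 20) hN (m := 2 * n) hn2
    (fun _ (H : ContractedTree n) => H.edges.length + H.contracted.length ≤ n)
    (f := contractStep D q) (s := { vertices := U, edges := E, contracted := [] })
    (by simpa using hE) fun _ _ H hH => fast_contractStep hN hn D q hH hn2
  obtain ⟨H, hH⟩ : ∃ H, (Timed.iterate (2 * n) (contractStep D q)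
    { vertices := U, edges := E, contracted := [] }).val = H := ⟨_, rfl⟩
  have h3 : (H.edges.map Prod.fst ++ H.edges.map Prod.snd).length ≤ N := by
    rw [List.length_append, List.length_map, List.length_map, ← hH]
    omega
  refine .bind hN (h1.mono hN (by omega)) ?_
  rw [hH] at h2 ⊢
  have h4 : ∀ (f : Fin n → Timed (Fin n × Finset (Fin n) × ℕ × ℕ)), (Timed.mapList
      (H.edges.map Prod.fst ++ H.edges.map Prod.snd) f).val.length ≤ N := by
    intro f
    rwa [Timed.val_mapList, List.length_map]
  refine .bind hN (.mapList hN h3 fun x _ => .bind hN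
    ((fast_block hN hn (by omega) x).mono hN (by omega)) (.bind hN
      ((fast_blockDegree hN (by omega) _).mono hN (by omega)) (.bind hN
        ((fast_superSize hN hn D _).mono hN (by omega)) (.pure _)))) (.bind hN (.filterList hN (h4 _)
        fun _ _ => .test hN _) (.bind hN (.filterList hN (h4 _) fun _ _ => .test hN _) (.bind hN
          ((fast_superSize hN hn D _).mono hN (by omega)) (.bind hN (.test hN _) (.ite
            (.bind hN (.filterList hN hF fun _ _ => .test hN _) (.pure _))
            (.bind hN (.sortDesc hN ?_) (.bind hN (.filterList hN hF fun _ _ => .test hN _)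
              (.bind hN ((fast_takeLeaves hN hn q _ ?_ _ _).mono hN (by omega))
                ((fast_pickTail hN hn next q hE hnext _ _).mono hN (by omega))))))))))
  · rw [List.length_map]
    exact (List.length_filter_le _ _).trans (h4 _)
  · rw [Timed.val_sortDesc, List.length_insertionSort, List.length_map]
    exact (List.length_filter_le _ _).trans (h4 _)

/-- Each nested call adds `40` to the exponent. In the algorithm the depth depends on `δ` alone, so
the exponent does not depend on `n`. The number of centres is bounded as well, since a path is added
for each of them. -/
theorem fast_pick (hN : 2 ≤ N) (hn : n ≤ N) (hn2 : 2 * n ≤ N) (D : PickData n) (depth : ℕ) :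
    ∀ (q : ℕ) (U : Finset (Fin n)) (E : List (Fin n × Fin n)), E.length ≤ n →
      Fast N (40 * (depth + 1)) (pick D depth q U E) ∧
        (pick D depth q U E).val.2.length ≤ depth + 1 := by
  have htake : ∀ l : List (Fin n), (l.take 1).length ≤ 1 := fun l => by
    rw [List.length_take]; omega
  induction depth with
  | zero =>
    intro q U E hE
    rw [pick_zero, pickWith_val]
    refine ⟨fast_pickWith (e := 0) hN hn hn2 D none q U hE (by simp), ?_⟩
    split_ifs
    · exact htake _
    · rw [pickTail_val]
      split
      · exact htake _
      · exact htake _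
      · rename_i h
        exact absurd h (by simp)
  | succ depth ih =>
    intro q U E hE
    rw [pick_succ, pickWith_val]
    refine ⟨fast_pickWith hN hn hn2 D _ q U hE ?_, ?_⟩
    · intro f hf q U E hE
      obtain rfl := Option.mem_some_iff.1 hf
      exact (ih q U E hE).1
    split_ifs
    · exact (htake _).trans (by omega)
    · rw [pickTail_val]
      split
      · exact (htake _).trans (by omega)
      · rename_i h
        exact absurd h (by simp)
      · rename_i L f _ h
        obtain rfl := Option.some.inj h
        have h1 := (ih (q - (takeLeaves q ∅ 0 (leafList D (stableTree D q U E))).val.2.1) L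
          (edgesInside L E).val ((edgesInside_sublist L E).length_le.trans hE)).2
        have h2 := htake (((nodeList D (stableTree D q U E)).filter fun b =>
          (Timed.test (b.2.2.1 ≠ 1)).val).map Prod.fst ++ (List.finRange n).filter fun v =>
            (Timed.test (∃ L ∈ (leafList D (stableTree D q U E)).head?, v ∈ L.1)).val)
        rw [List.length_append]
        rw [centerList]
        omega

theorem fast_pathsTo (hN : 2 ≤ N) (hn : n + 1 ≤ N) (G : SimpleGraph (Fin n)) (cost : Fin n → ℝ)
    (U : Finset (Fin n)) : Fast N 11 (pathsTo G cost U) := by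
  have hn' : n ≤ N := by omega
  have hF : (List.finRange n).length ≤ N := by rwa [List.length_finRange]
  refine .bind hN (.tabulate hN hn' fun _ => .op hN _) (.iterate hN hn' fun lab =>
    .tabulate hN hn' fun v => .bind hN (.filterList hN hF fun _ _ => .test hN _) (.bind hN
      (.mapList hN ((List.length_filter_le _ _).trans hF) fun _ _ => .op hN _) (.minList hN ?_)))
  rw [List.length_append, Timed.val_mapList, List.length_map, Timed.val_filterList]
  have h1 := List.length_filter_le (fun u => (Timed.test (G.Adj v u ∧ lab u ≠ none)).val)
    (List.finRange n)
  rw [List.length_finRange] at h1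
  have h2 : (lab v).toList.length ≤ 1 := by cases lab v <;> simp
  omega

theorem length_pathList_le (G : SimpleGraph (Fin n)) (cost : Fin n → ℝ) (U : Finset (Fin n))
    (x : Fin n) : (pathList (pathsTo G cost U).val x).length ≤ n + 1 := by
  rw [pathList]
  split
  · exact Nat.zero_le _
  · rename_i P d h
    obtain ⟨i, hi, hP⟩ := (pathsTo_spec G cost U).1 x P d h
    rw [hP.length_eq]
    omega

theorem fast_mergeTrees (hN : 2 ≤ N) (hn : 2 * n ≤ N) (hn2 : n * n + n ≤ N)
    (G : SimpleGraph (Fin n)) (cost : Fin n → ℝ) (root : Fin n) (k depth : ℕ) (hd : depth + 1 ≤ N)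
    {paths : Fin n → Option (List (Fin n) × ℝ)} (hpaths : ∀ x, (pathList paths x).length ≤ N)
    (T₁ T₂ : Finset (Fin n)) :
    Fast N (40 * (depth + 1) + 30) (mergeTrees G cost root k depth paths T₁ T₂) := by
  have hn' : n ≤ N := by omega
  have hV : ∀ {e : ℕ} {p : Fin n → Prop}, Fast N (e + 2)
      (Timed.vertexSet fun v => Timed.test (p v)) := .vertexSet hN hn' fun _ => .test hN _
  have hE := fun M B => length_spanningTree_le (contractedAdj G M root) B root
  refine .bind hN hV (.bind hN hV (.bind hN hV (.bind hN
    ((fast_spanningTree hN hn2 (fast_contractedAdj hN hn' G _ root) _ _).mono hN (by omega)) (.bind hN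
      (.sumVertices hN hn' fun _ => .op hN _) (.bind hN (.card hN hn' _) (.bind hN (.card hN hn' _)
        (.bind hN ((fast_pick hN hn' hn _ depth _ _ _ (hE _ _)).1.mono hN (by omega)) (.bind hN hV
          (.foldList hN ((fast_pick hN hn' hn _ depth _ _ _ (hE _ _)).2.trans hd) fun _ x _ =>
            .foldList hN (hpaths x) fun _ _ _ => .op hN _)))))))))

end

/-! ### Running time of the whole algorithm. -/

section

variable {n N : ℕ}

theorem fast_searchStep (hN : 2 ≤ N) (hn : 3 * n + 1 ≤ N) (hn2 : 2 * n * n + n ≤ N)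
    (G : SimpleGraph (Fin n)) (cost : Fin n → ℝ) (root : Fin n) (k : ℕ) (A W : Finset (Fin n))
    (s : SearchState n) : Fast N 60 (searchStep G cost root k A W s) := by
  have hn' : n ≤ N := by omega
  exact .bind hN (.card hN hn' _) (.bind hN (.test hN _) (.ite (.pure _) (.bind hN
    ((fast_moatGrowing _ hN hn hn2).mono hN (by omega)) (.bind hN (.card hN hn' _) (.bind hN
      (.test hN _) (.pure _))))))

theorem fast_searchAndMerge {δ : ℝ} (hN : 2 ≤ N) (hn : 3 * n + 1 ≤ N) (hn2 : 2 * n * n + n ≤ N)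
    (hδ : ⌈3 * n * (n + 1) / δ⌉₊ ≤ N) (hd : Nat.clog 2 ⌈4 / δ⌉₊ + 1 ≤ N) (G : SimpleGraph (Fin n))
    (cost : Fin n → ℝ) (root : Fin n) (k : ℕ) (g : ℝ) (U W A T₀ : Finset (Fin n)) :
    Fast N (40 * (Nat.clog 2 ⌈4 / δ⌉₊ + 1) + 70)
      (searchAndMerge δ G cost root k g W (pathsTo G cost U).val A T₀) := by
  have hn' : n ≤ N := by omega
  have hclog : Nat.clog 2 ⌈3 * n * (n + 1) / δ⌉₊ ≤ N := by
    refine le_trans (Nat.clog_le_of_le_pow ?_) hδ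
    exact Nat.lt_two_pow_self.le
  exact .bind hN ((fast_moatGrowing _ hN hn hn2).mono hN (by omega)) (.bind hN (.charge hδ) (.bind hN
    (.iterate hN hclog fun s => (fast_searchStep hN hn hn2 G cost root k A W s).mono hN (by omega))
    (.bind hN (.card hN hn' _) (.bind hN (.test hN _) (.ite (.pure _) (.bind hN
      ((fast_mergeTrees hN (by omega) (by nlinarith) G cost root k _ hd (fun x =>
        (length_pathList_le G cost U x).trans (by omega)) _ _).mono hN (by omega)) (.pure _)))))))

theorem fast_solveGuess {δ : ℝ} (hN : 2 ≤ N) (hn : 3 * n + 1 ≤ N) (hn2 : 2 * n * n + n ≤ N)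
    (hδ : ⌈3 * n * (n + 1) / δ⌉₊ ≤ N) (hd : Nat.clog 2 ⌈4 / δ⌉₊ + 1 ≤ N) (G : SimpleGraph (Fin n))
    (cost : Fin n → ℝ) (root : Fin n) (k : ℕ) (g : ℝ) (W : Finset (Fin n)) :
    Fast N (40 * (Nat.clog 2 ⌈4 / δ⌉₊ + 1) + 90) (solveGuess δ G cost root k g W) := by
  have hn' : n ≤ N := by omega
  rw [solveGuess_eq]
  have hV : ∀ {e : ℕ} {p : Fin n → Prop}, Fast N (e + 2)
      (Timed.vertexSet fun v => Timed.test (p v)) := .vertexSet hN hn' fun _ => .test hN _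
  have hA : ∀ {e : ℕ} {p : Fin n → Prop}, Fast N (e + 2)
      (Timed.allVertices fun v => Timed.test (p v)) := .allVertices hN hn' fun _ => .test hN _
  exact .bind hN hV (.bind hN ((fast_pathsTo hN (by omega) G cost _).mono hN (by omega)) (.bind hN hV
    (.bind hN hA (.bind hN ((fast_reach hN hn' (fast_graphAdj (e := 0) hN _) _ _).mono hN (by omega))
      (.bind hN hA (.bind hN (.card hN hn' _) (.bind hN (.test hN _) (.ite (.pure _) (.bind hN
        ((fast_moatGrowing _ hN hn hn2).mono hN (by omega)) (.bind hN (.card hN hn' _) (.bind hN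
          (.test hN _) (.ite (.pure _) ((fast_searchAndMerge hN hn hn2 hδ hd G cost root k g _ W _
            _).mono hN (by omega))))))))))))))

theorem length_solveGuess_le (δ : ℝ) (G : SimpleGraph (Fin n)) (cost : Fin n → ℝ) (root : Fin n)
    (k : ℕ) (g : ℝ) (W : Finset (Fin n)) : (solveGuess δ G cost root k g W).val.length ≤ 2 := by
  rw [solveGuess_eq]
  simp only [Timed.val_bind]
  split_ifs
  · simp
  · rw [Timed.val_bind, Timed.val_bind, Timed.val_bind]
    split_ifs
    · simp
    · rw [searchAndMerge_val _ _ _ _ _ _ _ _ _ _ _ rfl]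
      dsimp only
      split_ifs <;> simp

theorem length_smallSets (n m : ℕ) : (smallSets n m).val.length = (n + 1) ^ m := by
  induction m with
  | zero => rfl
  | succ m ih =>
    have hval : (smallSets n (m + 1)).val = (smallSets n m).val ++
        ((List.finRange n) ×ˢ (smallSets n m).val).map fun e =>
          (Timed.vertexSet fun u => Timed.test (u = e.1 ∨ u ∈ e.2)).val := rfl
    rw [hval, List.length_append, List.length_map, List.length_product, List.length_finRange, ih]
    ring

theorem fast_smallSets (hN : 2 ≤ N) (hn : n ≤ N) {m : ℕ} (hm : (n + 1) ^ m ≤ N) :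
    Fast N (m + 5) (smallSets n m) := by
  induction m with
  | zero => exact .op hN _
  | succ m ih =>
    have hpow : (n + 1) ^ m ≤ N := (Nat.pow_le_pow_right (by omega) (by omega)).trans hm
    refine .bind hN (ih hpow) (.bind hN (.mapList hN ?_ fun _ _ =>
      .vertexSet hN hn fun _ => .test hN _) (.pure _))
    change (List.finRange n ×ˢ (smallSets n m).val).length ≤ N
    rw [List.length_product, List.length_finRange, length_smallSets]
    rw [pow_succ] at hm
    nlinarith

theorem length_optGuesses (δ : ℝ) (cost : Fin n → ℝ) :
    (optGuesses δ cost).val.length = n * (⌈n / δ⌉₊ + 1) := by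
  have hval : (optGuesses δ cost).val = (List.finRange n ×ˢ List.range (⌈n / δ⌉₊ + 1)).map
      fun e => cost e.1 * (1 + δ) ^ e.2 := rfl
  rw [hval, List.length_map, List.length_product, List.length_finRange, List.length_range]

theorem fast_optGuesses {δ : ℝ} (hN : 2 ≤ N) (hn : ⌈n / δ⌉₊ ≤ N) (hn2 : n * (⌈n / δ⌉₊ + 1) ≤ N)
    (cost : Fin n → ℝ) : Fast N 4 (optGuesses δ cost) := by
  refine .mapList hN ?_ fun e he => .bind hN (.charge ?_) (.op hN _)
  · change (List.finRange n ×ˢ List.range (⌈n / δ⌉₊ + 1)).length ≤ N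
    rwa [List.length_product, List.length_finRange, List.length_range]
  · have := List.mem_range.1 (List.mem_product.1 he).2
    omega

theorem fast_keepBetter (hN : 2 ≤ N) (hn : n ≤ N) (G : SimpleGraph (Fin n)) (cost : Fin n → ℝ)
    (root : Fin n) (k : ℕ) (best : Option (Finset (Fin n) × ℝ)) (T : Finset (Fin n)) :
    Fast N 20 (keepBetter G cost root k best T) :=
  .bind hN ((fast_reach hN hn (fast_graphAdj (e := 0) hN _) _ _).mono hN (by omega)) (.bind hN
    (.allVertices hN hn fun _ => .test hN _) (.bind hN (.card hN hn _) (.bind hN (.test hN _)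
      (.bind hN (.sumVertices hN hn fun _ => .op hN _) (.bind hN (.test hN _) (.pure _))))))

theorem fast_nwkMST {δ : ℝ} (hN : 2 ≤ N) (hn : 3 * n + 1 ≤ N) (hn2 : 2 * n * n + n ≤ N)
    (hδ : ⌈3 * n * (n + 1) / δ⌉₊ ≤ N) (hd : Nat.clog 2 ⌈4 / δ⌉₊ + 1 ≤ N) (hg : ⌈n / δ⌉₊ ≤ N)
    (hm : ⌊1 / δ⌋₊ ≤ N) (hl : n * (⌈n / δ⌉₊ + 1) * (n + 1) ^ ⌊1 / δ⌋₊ ≤ N)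
    (hs : (n + 1) ^ ⌊1 / δ⌋₊ ≤ N) (hgn : n * (⌈n / δ⌉₊ + 1) ≤ N) (G : SimpleGraph (Fin n))
    (cost : Fin n → ℝ) (root : Fin n) (k : ℕ) :
    Fast N (40 * (Nat.clog 2 ⌈4 / δ⌉₊ + 1) + ⌊1 / δ⌋₊ + 100) (nwkMST δ G cost root k) := by
  have hn' : n ≤ N := by omega
  refine .bind hN ((fast_optGuesses hN hg hgn cost).mono hN (by omega)) (.bind hN (.charge hm)
    (.bind hN ((fast_smallSets hN hn' hs).mono hN (by omega)) (.bind hN (.foldList hN ?_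
      fun best e _ => .bind hN ((fast_solveGuess hN hn hn2 hδ hd G cost root k e.1 e.2).mono hN
        (by omega)) (.foldList hN ((length_solveGuess_le ..).trans hN) fun best T _ =>
          (fast_keepBetter hN hn' G cost root k best T).mono hN (by omega))) (.pure _))))
  change ((optGuesses δ cost).val ×ˢ (smallSets n ⌊1 / δ⌋₊).val).length ≤ N
  rwa [List.length_product, length_optGuesses, length_smallSets]

/-- The running time of the algorithm is polynomial for fixed accuracy. -/
theorem exists_polynomial_time (δ : ℝ) : ∃ p : Polynomial ℕ, ∀ (n : ℕ)
    (G : SimpleGraph (Fin n)) (cost : Fin n → ℝ) (root : Fin n) (k : ℕ),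
      (nwkMST δ G cost root k).time ≤ p.eval n := by
  obtain ⟨C, hC⟩ : ∃ C, C = ⌈1 / δ⌉₊ := ⟨_, rfl⟩
  obtain ⟨m, hm⟩ : ∃ m, m = ⌊1 / δ⌋₊ := ⟨_, rfl⟩
  obtain ⟨d, hd⟩ : ∃ d, d = Nat.clog 2 ⌈4 / δ⌉₊ := ⟨_, rfl⟩
  have hceil : ∀ a : ℕ, ⌈(a : ℝ) / δ⌉₊ ≤ a * C := by
    intro a
    rw [Nat.ceil_le, Nat.cast_mul, div_eq_mul_one_div]
    exact mul_le_mul_of_nonneg_left (hC ▸ Nat.le_ceil _) (Nat.cast_nonneg a)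
  -- The base bounds all loop lengths: `(n + 1) ^ m` counts the skeletons, `(n + 1) ^ 3` dominates
  -- the list lengths and, up to constant factors that include `C`, the number of values `g` and `3
  -- n (n + 1) / δ`; the coefficient also covers the constants `d` and `m`.
  refine ⟨(Polynomial.C (d + m + C + 3) * (Polynomial.X + 1) ^ (m + 3)) ^ (40 * (d + 1) + m + 100),
    fun n G cost root k => ?_⟩
  rw [Polynomial.eval_pow, Polynomial.eval_mul, Polynomial.eval_C, Polynomial.eval_pow,
    Polynomial.eval_add, Polynomial.eval_X, Polynomial.eval_one]
  have h1 : 1 ≤ (n + 1) ^ m := Nat.one_le_pow _ _ (by omega)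
  have hN : (d + m + C + 3) * (n + 1) ^ (m + 3) = (d + m + C + 3) * (n + 1) ^ 3 * (n + 1) ^ m := by
    rw [pow_add]; ring
  have h2 : (d + m + C + 3) * (n + 1) ^ 3 ≤ (d + m + C + 3) * (n + 1) ^ (m + 3) := by
    rw [hN]; exact Nat.le_mul_of_pos_right _ h1
  have h3 : (n + 1) ^ 3 = n * n * n + 3 * (n * n) + 3 * n + 1 := by ring
  have h4 : 3 * (n + 1) ^ 3 + (d + m) + C * (n + 1) ^ 3 ≤ (d + m + C + 3) * (n + 1) ^ 3 := by
    have : 1 ≤ (n + 1) ^ 3 := Nat.one_le_pow _ _ (by omega)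
    nlinarith
  have h5 : 0 ≤ C * (n + 1) ^ 3 := Nat.zero_le _
  have h6 : ⌈(n : ℝ) / δ⌉₊ ≤ n * C := hceil n
  have h7 : ⌈3 * (n : ℝ) * (n + 1) / δ⌉₊ ≤ 3 * n * (n + 1) * C := by
    have := hceil (3 * n * (n + 1))
    push_cast at this
    exact this
  have h8 : n * (⌈(n : ℝ) / δ⌉₊ + 1) ≤ (C + 1) * (n + 1) ^ 3 := by
    have h9 : n * (⌈(n : ℝ) / δ⌉₊ + 1) ≤ n * (n * C + 1) := Nat.mul_le_mul_left n (by omega)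
    rw [h3]
    nlinarith [Nat.zero_le (C * n), Nat.zero_le (C * (n * n * n)), Nat.zero_le (n * n * n)]
  have h9 : (C + 1) * (n + 1) ^ 3 ≤ (d + m + C + 3) * (n + 1) ^ 3 :=
    Nat.mul_le_mul_right _ (by omega)
  have h10 : 3 * n * (n + 1) * C ≤ C * (n + 1) ^ 3 := by
    rw [h3]
    nlinarith [Nat.zero_le (C * n), Nat.zero_le (C * (n * n * n)), Nat.zero_le C]
  subst hm hd
  refine fast_nwkMST ?_ ?_ ?_ ?_ ?_ ?_ ?_ ?_ ?_ ?_ G cost root k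
  · omega
  · omega
  · nlinarith
  · omega
  · omega
  · have : n * C ≤ C * (n + 1) ^ 3 := by
      rw [h3]
      nlinarith [Nat.zero_le (C * n), Nat.zero_le (C * (n * n * n)), Nat.zero_le (C * (n * n))]
    omega
  · omega
  · rw [hN]
    exact Nat.mul_le_mul_right _ (h8.trans h9)
  · rw [hN]
    refine Nat.le_mul_of_pos_left _ ?_
    positivity
  · exact (h8.trans h9).trans h2

end

theorem mainTheorem2 (ε : ℝ) (hε : 0 < ε) :
    ∃ δ₀ : ℝ, 0 < δ₀ ∧ ∀ δ : ℝ, 0 < δ → δ ≤ δ₀ →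
      (∃ p : Polynomial ℕ, ∀ (n : ℕ) (G : SimpleGraph (Fin n)) (cost : Fin n → ℝ)
        (root : Fin n) (k : ℕ), (nwkMST δ G cost root k).time ≤ p.eval n) ∧
      ∀ (𝒢 : ∀ n : ℕ, Set (SimpleGraph (Fin n))) (r : ℝ), HasLMPRatio 𝒢 r →
        ∀ (n : ℕ) (G : SimpleGraph (Fin n)), G ∈ 𝒢 n →
        ∀ (cost : Fin n → ℝ) (root : Fin n) (k : ℕ), (∀ v, 0 ≤ cost v) → 1 ≤ k →
          (∃ X, IsKSolution G root k X) →
          ∃ T, (nwkMST δ G cost root k).val = some T ∧ IsKSolution G root k T ∧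
            ∀ X, IsKSolution G root k X →
              ∑ v ∈ T, cost v ≤ (4 / 3 + ε) * r * ∑ v ∈ X, cost v := by
  -- The last two terms are the bounds under which `loss_le` gives `loss δ ≤ ε`; `δ ≤ 1` is needed
  -- throughout the analysis of a guess.
  refine ⟨min 1 (min (ε / 12) (ε ^ 2 / 320)), by positivity, fun δ hδ hle =>
    ⟨exists_polynomial_time δ, fun 𝒢 r h n G hG cost root k hc _ hex => ?_⟩⟩
  have hδ1 : δ ≤ 1 := hle.trans (min_le_left _ _)
  have hloss : loss δ ≤ ε := loss_le hδ hδ1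
    (hle.trans ((min_le_right _ _).trans (min_le_left _ _)))
    (hle.trans ((min_le_right _ _).trans (min_le_right _ _)))
  obtain ⟨T, hT, hs, hcost⟩ := nwkMST_spec h hG hc hδ hδ1 hex
  refine ⟨T, hT, hs, fun X hX => (hcost X hX).trans ?_⟩
  have hr := h.one_le hG root
  rw [mul_assoc, mul_assoc]
  exact mul_le_mul_of_nonneg_right (by linarith)
    (mul_nonneg (by linarith) (Finset.sum_nonneg fun v _ => hc v))
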